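/- Assume the Riemann hypothesis and that all but finitely many of the zeros of the Riemann zeta function are simple. For a real number $M\ge 1$ and a real sequence $(x_n)_{n\le M}$ put $A(s)=\sum_{n\le M}x_n n^{-s}$, $\|x_n\|_\infty=\max_{n\le M}|x_n|$ and $\|x_n\|_1=\sum_{n\le M}|x_n|$ (and likewise $\|\tfrac{x_n}{n}\|_1=\sum_{n\le M}|x_n|/n$, $\|x_n^2\|_1=\sum_{n\le M}x_n^2$). Let $T_1=T+O(1)$ and $T_2=2T+O(1)$ be such that, for $j=1,2$, uniformly for $-1\le\sigma\le 2$ one has $\zeta(\sigma+iT_j)\ne 0$ and $\zeta(\sigma+iT_j)^{-1}\ll_\delta T_j^{\delta}$ for every $\delta>0$, and suppose that $\|\tfrac{x_n}{n}\|_1\ll_\delta T^{\delta}$ for every $\delta>0$. Then for every $\varepsilon>0$ and all sufficiently large $T$ \[ S_3:=\sum_{T_1<\gamma<T_2}\zeta'(\rho)^{-1}|A(\rho)|^2=\frac{T_2-T_1}{2\pi}\sum_{hn\le M}\frac{\mu(n)x_hx_{nh}}{nh}+O\Bigl(T^{\varepsilon}\bigl(M\|x_n\|_\infty+\|x_n\|_1+T^{1/2}\|x_n^2\|_1^{1/2}\bigr)\Bigr),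 \] where the first sum runs over the nontrivial zeros $\rho=\beta+i\gamma$ of $\zeta$ with $T_1<\gamma<T_2$, the second over positive integers $h,n$ with $hn\le M$, and $\mu$ is the Möbius function. The implied constant and the meaning of "sufficiently large" depend only on $\varepsilon$ and on the implied constants in the hypotheses (the bounds for $|T_1-T|$ and $|T_2-2T|$, and the constants in the bounds $\ll_\delta$). -/

import Mathlib

open scoped NNReal

noncomputable section

/-- The set of nontrivial zeros `ρ = β + iγ` of the Riemann zeta function with `T₁ < γ < T₂`. -/
def zetaZerosBetween (T₁ T₂ : ℝ) : Set ℂ :=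
  {ρ | riemannZeta ρ = 0 ∧ (0 < ρ.re ∧ ρ.re < 1) ∧ (T₁ < ρ.im ∧ ρ.im < T₂)}

theorem zetaZerosBetween_finite (T₁ T₂ : ℝ) : (zetaZerosBetween T₁ T₂).Finite := by
  have hc : IsCompact (Set.Icc (0 : ℝ) 1 ×ℂ Set.Icc T₁ T₂) := isCompact_Icc.reProdIm isCompact_Icc
  refine hc.inter_riemannZetaZeros_finite.subset ?_
  rintro ρ ⟨h0, ⟨h1, h2⟩, h3, h4⟩
  exact ⟨⟨⟨h1.le, h2.le⟩, h3.le, h4.le⟩, h0⟩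

/-- The Dirichlet polynomial `A(s) = ∑_{n ≤ M} xₙ n^{-s}`. -/
def dirichletPoly (x : ℕ → ℝ) (M : ℝ) (s : ℂ) : ℂ :=
  ∑ n ∈ Finset.Icc 1 ⌊M⌋₊, (x n : ℂ) * (n : ℂ) ^ (-s)

/-- `‖xₙ‖₁ = ∑_{n ≤ M} |xₙ|`. -/
def seqNormOne (x : ℕ → ℝ) (M : ℝ) : ℝ :=
  ∑ n ∈ Finset.Icc 1 ⌊M⌋₊, |x n|

/-- `‖xₙ‖_∞ = max_{n ≤ M} |xₙ|`. -/
def seqNormSup (x : ℕ → ℝ) (M : ℝ) : ℝ :=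
  ((Finset.Icc 1 ⌊M⌋₊).sup fun n => ‖x n‖₊ : ℝ≥0)

/-- The sum `∑_{T₁ < γ < T₂} ζ'(ρ)⁻¹ |A(ρ)|²` over the nontrivial zeros. -/
def zetaZeroMoment (x : ℕ → ℝ) (M T₁ T₂ : ℝ) : ℂ :=
  ∑ ρ ∈ (zetaZerosBetween_finite T₁ T₂).toFinset,
    (deriv riemannZeta ρ)⁻¹ * ((‖dirichletPoly x M ρ‖ ^ 2 : ℝ) : ℂ)

/-- The sum `∑_{hn ≤ M} μ(n) x_h x_{nh} / (nh)` over positive integers `h`, `n`. -/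
def moebiusQuadraticForm (x : ℕ → ℝ) (M : ℝ) : ℝ :=
  ∑ p ∈ Finset.Icc 1 ⌊M⌋₊ ×ˢ Finset.Icc 1 ⌊M⌋₊ with ((p.1 * p.2 : ℕ) : ℝ) ≤ M,
    (ArithmeticFunction.moebius p.2 : ℝ) * x p.1 * x (p.2 * p.1) / ((p.2 * p.1 : ℕ) : ℝ)

/-- `t` is a height at which `ζ(σ + it)⁻¹ ≪ t^δ` for every `δ > 0`, uniformly for
`-1 ≤ σ ≤ 2`, with implied constants `K δ`. -/
def IsGoodHeight (K : ℝ → ℝ) (t : ℝ) : Prop :=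
  ∀ σ : ℝ, -1 ≤ σ → σ ≤ 2 →
    riemannZeta (σ + t * Complex.I) ≠ 0 ∧
      ∀ δ : ℝ, 0 < δ → ‖(riemannZeta (σ + t * Complex.I))⁻¹‖ ≤ K δ * t ^ δ

end

/-!
Under the Riemann hypothesis `|A(ρ)|² = ∑ x_h x_k k⁻¹ (k / h)^ρ`, the sum running over pairs
`h, k ≤ M`, so everything rests on the sums `∑ r^ρ / ζ'(ρ)` with `r = k / h`. By the residue
theorem such a sum is the integral of `r^s / ζ(s)` around a rectangle of height `T₂ - T₁`, whose
horizontal sides are negligible because `T₁` and `T₂` are good heights.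

On the right side `Re s = 1 + δ` one expands `1 / ζ(s) = ∑ μ(n) n^{-s}`: the term with `n h = k`
does not oscillate and gives the main term `(T₂ - T₁) μ(k / h)`, while the others are bounded in
terms of `|log (k / (n h))|` and are only large when `n h` is close to `k`. On the left side
`Re s = -δ` the functional equation gives `1 / ζ(-δ + i t) ≪ t^{-1/2}`; summing over `h` before
integrating, Cauchy–Schwarz and a mean value theorem for exponential sums give the error terms
`T^{1/2} ‖x_n²‖₁^{1/2}` and `M ‖x_n‖_∞`.

This loses a power `r^{±δ}`, which is harmless unless `r` lies outside `[T^{-E}, T^E]`. For such `r`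
the rectangle over `[1/4, 3/4]` is used instead: there `1 / ζ` is at most a power of `T`, by
Borel–Carathéodory applied to `log ζ` to the right of the critical line and the functional equation
to the left, and the saving in `r` outweighs it.
-/

open Complex Set MeasureTheory intervalIntegral Filter
open scoped Interval Topology

section ContourIntegral

variable {a b c d : ℝ}

/-- The integral of `g` along the positively oriented boundary of `[a, b] × [c, d]`. -/
noncomputable def rectBoundaryIntegral (g : ℂ → ℂ) (a b c d : ℝ) : ℂ :=
  (∫ x in a..b, g (x + c * I)) - (∫ x in a..b, g (x + d * I)) +
    I * (∫ y in c..d, g (b + y * I)) - I * (∫ y in c..d, g (a + y * I))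

/-- The boundary of `[a, b] × [c, d]`. -/
def rectBoundary (a b c d : ℝ) : Set ℂ :=
  (Icc a b ×ℂ Icc c d) \ (Ioo a b ×ℂ Ioo c d)

theorem horizontal_mem_rectBoundary {e x : ℝ} (hcd : c ≤ d) (he : e = c ∨ e = d)
    (hx : x ∈ Icc a b) : (x + e * I : ℂ) ∈ rectBoundary a b c d := by
  refine ⟨⟨by simpa using hx, ?_⟩, fun h => ?_⟩
  · rcases he with rfl | rfl <;> simp [hcd]
  · have him := h.2
    rcases he with rfl | rfl <;> simp at him

theorem vertical_mem_rectBoundary {e y : ℝ} (hab : a ≤ b) (he : e = a ∨ e = b)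
    (hy : y ∈ Icc c d) : (e + y * I : ℂ) ∈ rectBoundary a b c d := by
  refine ⟨⟨?_, by simpa using hy⟩, fun h => ?_⟩
  · rcases he with rfl | rfl <;> simp [hab]
  · have hre := h.1
    rcases he with rfl | rfl <;> simp at hre

theorem rectBoundaryIntegral_congr {f g : ℂ → ℂ} (hab : a ≤ b) (hcd : c ≤ d)
    (h : EqOn f g (rectBoundary a b c d)) :
    rectBoundaryIntegral f a b c d = rectBoundaryIntegral g a b c d := by
  have horizontal {e : ℝ} (he : e = c ∨ e = d) :
      ∫ x in a..b, f (x + e * I) = ∫ x in a..b, g (x + e * I) :=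
    integral_congr fun x hx => h (horizontal_mem_rectBoundary hcd he (uIcc_of_le hab ▸ hx))
  have vertical {e : ℝ} (he : e = a ∨ e = b) :
      ∫ y in c..d, f (e + y * I) = ∫ y in c..d, g (e + y * I) :=
    integral_congr fun y hy => h (vertical_mem_rectBoundary hab he (uIcc_of_le hcd ▸ hy))
  rw [rectBoundaryIntegral, horizontal (.inl rfl), horizontal (.inr rfl), vertical (.inl rfl),
    vertical (.inr rfl), rectBoundaryIntegral]

theorem intervalIntegrable_horizontal {g : ℂ → ℂ} {e : ℝ} (hab : a ≤ b)
    (hcd : c ≤ d) (hg : ContinuousOn g (rectBoundary a b c d)) (he : e = c ∨ e = d) :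
    IntervalIntegrable (fun x : ℝ => g (x + e * I)) volume a b :=
  ContinuousOn.intervalIntegrable <| hg.comp (by fun_prop) fun _ hx =>
    horizontal_mem_rectBoundary hcd he (uIcc_of_le hab ▸ hx)

theorem intervalIntegrable_vertical {g : ℂ → ℂ} {e : ℝ} (hab : a ≤ b)
    (hcd : c ≤ d) (hg : ContinuousOn g (rectBoundary a b c d)) (he : e = a ∨ e = b) :
    IntervalIntegrable (fun y : ℝ => g (e + y * I)) volume c d :=
  ContinuousOn.intervalIntegrable <| hg.comp (by fun_prop) fun _ hy =>
    vertical_mem_rectBoundary hab he (uIcc_of_le hcd ▸ hy)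

theorem rectBoundaryIntegral_sub {f g : ℂ → ℂ} (hab : a ≤ b) (hcd : c ≤ d)
    (hf : ContinuousOn f (rectBoundary a b c d)) (hg : ContinuousOn g (rectBoundary a b c d)) :
    rectBoundaryIntegral (fun s => f s - g s) a b c d =
      rectBoundaryIntegral f a b c d - rectBoundaryIntegral g a b c d := by
  unfold rectBoundaryIntegral
  rw [integral_sub (intervalIntegrable_horizontal hab hcd hf (.inl rfl))
      (intervalIntegrable_horizontal hab hcd hg (.inl rfl)),
    integral_sub (intervalIntegrable_horizontal hab hcd hf (.inr rfl))
      (intervalIntegrable_horizontal hab hcd hg (.inr rfl)),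
    integral_sub (intervalIntegrable_vertical hab hcd hf (.inl rfl))
      (intervalIntegrable_vertical hab hcd hg (.inl rfl)),
    integral_sub (intervalIntegrable_vertical hab hcd hf (.inr rfl))
      (intervalIntegrable_vertical hab hcd hg (.inr rfl))]
  ring

theorem rectBoundaryIntegral_finsetSum {ι : Type*} {Z : Finset ι} {f : ι → ℂ → ℂ} (hab : a ≤ b)
    (hcd : c ≤ d) (hf : ∀ i ∈ Z, ContinuousOn (f i) (rectBoundary a b c d)) :
    rectBoundaryIntegral (fun s => ∑ i ∈ Z, f i s) a b c d =
      ∑ i ∈ Z, rectBoundaryIntegral (f i) a b c d := by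
  unfold rectBoundaryIntegral
  rw [integral_finsetSum fun i hi => intervalIntegrable_horizontal hab hcd (hf i hi) (.inl rfl),
    integral_finsetSum fun i hi => intervalIntegrable_horizontal hab hcd (hf i hi) (.inr rfl),
    integral_finsetSum fun i hi => intervalIntegrable_vertical hab hcd (hf i hi) (.inl rfl),
    integral_finsetSum fun i hi => intervalIntegrable_vertical hab hcd (hf i hi) (.inr rfl)]
  simp only [Finset.sum_add_distrib, Finset.sum_sub_distrib, Finset.mul_sum]

theorem rectBoundaryIntegral_const_mul (r : ℂ) (g : ℂ → ℂ) :
    rectBoundaryIntegral (fun s => r * g s) a b c d = r * rectBoundaryIntegral g a b c d := by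
  simp only [rectBoundaryIntegral, intervalIntegral.integral_const_mul]
  ring

/-! ### The residue theorem for simple poles in a rectangle -/

theorem log_sub_log_neg_I_mul {w : ℂ} (hre : 0 < w.re) (him : 0 < w.im) :
    log w - log (-I * w) = Real.pi / 2 * I := by
  have hw : w ≠ 0 := by rintro rfl; simp at hre
  have harg : arg w < Real.pi / 2 :=
    (abs_lt.1 (Complex.abs_arg_lt_pi_div_two_iff.2 (Or.inl hre))).2
  have harg0 : 0 ≤ arg w := Complex.arg_nonneg_iff.2 him.le
  rw [Complex.log_mul (by simp) hw, Complex.log_neg_I]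
  · ring
  · rw [Complex.arg_neg_I]
    constructor <;> linarith [Real.pi_pos]

/-- The factor `u` rotates the segment away from the branch cut of the logarithm. -/
theorem mul_integral_inv_eq_log_sub_log {u w v : ℂ} (s t : ℝ)
    (h : ∀ x : ℝ, u * (w + x * v) ∈ slitPlane) :
    v * ∫ x in s..t, (w + x * v)⁻¹ = log (u * (w + t * v)) - log (u * (w + s * v)) := by
  have hne (x : ℝ) : u * (w + x * v) ≠ 0 := slitPlane_ne_zero (h x)
  have hderiv (x : ℝ) :
      HasDerivAt (fun x : ℝ => log (u * (w + x * v))) (v * (w + x * v)⁻¹) x := by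
    have hlin : HasDerivAt (fun x : ℝ => u * (w + x * v)) (u * (1 * v)) x :=
      ((Complex.ofRealCLM.hasDerivAt.mul_const v).const_add w).const_mul u
    have hlog := hlin.clog_real (h x)
    rwa [one_mul, mul_div_mul_left _ _ (left_ne_zero_of_mul (hne x)), div_eq_mul_inv] at hlog
  rw [← intervalIntegral.integral_const_mul]
  refine integral_eq_sub_of_hasDerivAt (fun x _ => hderiv x) (Continuous.intervalIntegrable ?_ _ _)
  exact continuous_const.mul
    (Continuous.inv₀ (by fun_prop) fun x => right_ne_zero_of_mul (hne x))

-- Each side contributes a difference of logarithms; the branches used on two adjacent sides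
-- differ at the common corner by a quarter turn.
theorem rectBoundaryIntegral_inv_sub {ρ : ℂ} (hρ : ρ ∈ Ioo a b ×ℂ Ioo c d) :
    rectBoundaryIntegral (fun s => (s - ρ)⁻¹) a b c d = 2 * Real.pi * I := by
  obtain ⟨⟨ha, hb⟩, hc, hd⟩ := hρ
  have bottom := mul_integral_inv_eq_log_sub_log (u := I) (w := c * I - ρ) (v := 1) a b
    fun x => .inl (by simp; linarith)
  have top := mul_integral_inv_eq_log_sub_log (u := -I) (w := d * I - ρ) (v := 1) a b
    fun x => .inl (by simp; linarith)
  have right := mul_integral_inv_eq_log_sub_log (u := 1) (w := b - ρ) (v := I) c d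
    fun x => .inl (by simp; linarith)
  have left := mul_integral_inv_eq_log_sub_log (u := -1) (w := a - ρ) (v := I) c d
    fun x => .inl (by simp; linarith)
  have corner₁ := log_sub_log_neg_I_mul (w := I * (c * I - ρ + b * 1))
    (by simp; linarith) (by simp; linarith)
  have corner₂ := log_sub_log_neg_I_mul (w := 1 * (b - ρ + d * I))
    (by simp; linarith) (by simp; linarith)
  have corner₃ := log_sub_log_neg_I_mul (w := -I * (d * I - ρ + a * 1))
    (by simp; linarith) (by simp; linarith)
  have corner₄ := log_sub_log_neg_I_mul (w := -1 * (a - ρ + c * I))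
    (by simp; linarith) (by simp; linarith)
  rw [show -I * (I * (c * I - ρ + b * 1)) = 1 * (b - ρ + c * I) by
    linear_combination (-(c * I - ρ + b * 1)) * I_sq] at corner₁
  rw [show -I * (1 * (b - ρ + d * I)) = -I * (d * I - ρ + b * 1) by ring] at corner₂
  rw [show -I * (-I * (d * I - ρ + a * 1)) = -1 * (a - ρ + d * I) by
    linear_combination (d * I - ρ + a * 1) * I_sq] at corner₃
  rw [show -I * (-1 * (a - ρ + c * I)) = I * (c * I - ρ + a * 1) by ring] at corner₄
  have horizontal (e : ℝ) : (∫ x in a..b, ((x : ℂ) + e * I - ρ)⁻¹) =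
      1 * ∫ x in a..b, (e * I - ρ + (x : ℂ) * 1)⁻¹ := by
    rw [one_mul]; congr! 3; ring
  have vertical (e : ℝ) : (∫ y in c..d, ((e : ℂ) + y * I - ρ)⁻¹) =
      ∫ y in c..d, (e - ρ + y * I)⁻¹ := by
    congr! 3; ring
  rw [rectBoundaryIntegral, horizontal, horizontal, vertical, vertical, bottom, top, right, left]
  linear_combination corner₁ + corner₂ + corner₃ + corner₄

theorem tendsto_limUnder_of_tendsto_sub_mul {h : ℂ → ℂ} {ρ : ℂ}
    (hd : ∀ᶠ z in 𝓝[≠] ρ, DifferentiableAt ℂ h z)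
    (h0 : Tendsto (fun z => (z - ρ) * h z) (𝓝[≠] ρ) (𝓝 0)) :
    Tendsto h (𝓝[≠] ρ) (𝓝 (limUnder (𝓝[≠] ρ) h)) := by
  refine tendsto_limUnder_of_differentiable_on_punctured_nhds_of_isLittleO hd ?_
  refine (Asymptotics.isLittleO_iff_tendsto' ?_).2 ?_
  · filter_upwards [self_mem_nhdsWithin] with z hz hinv
    exact absurd hinv (inv_ne_zero (sub_ne_zero.2 hz))
  · have hconst : Tendsto (fun z => (z - ρ) * h ρ) (𝓝[≠] ρ) (𝓝 0) :=
      (Continuous.tendsto' (by fun_prop) ρ 0 (by simp)).mono_left nhdsWithin_le_nhds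
    refine (sub_zero (0 : ℂ) ▸ h0.sub hconst).congr fun z => ?_
    rw [div_inv_eq_mul]
    ring

theorem rectBoundaryIntegral_eq_zero {h : ℂ → ℂ} {Z : Finset ℂ} (hab : a ≤ b)
    (hcd : c ≤ d) (hZ : ↑Z ⊆ Ioo a b ×ℂ Ioo c d)
    (hh : ∀ s ∈ Icc a b ×ℂ Icc c d, s ∉ Z → DifferentiableAt ℂ h s)
    (h0 : ∀ ρ ∈ Z, Tendsto (fun s => (s - ρ) * h s) (𝓝[≠] ρ) (𝓝 0)) :
    rectBoundaryIntegral h a b c d = 0 := by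
  classical
  have Ioo_subset : Ioo a b ×ℂ Ioo c d ⊆ Icc a b ×ℂ Icc c d := fun s hs =>
    ⟨Ioo_subset_Icc_self hs.1, Ioo_subset_Icc_self hs.2⟩
  set H : ℂ → ℂ := fun s => if s ∈ Z then limUnder (𝓝[≠] s) h else h s with hH
  have H_near {s : ℂ} (hs : s ∉ Z) : H =ᶠ[𝓝 s] h := by
    filter_upwards [Z.finite_toSet.isClosed.isOpen_compl.mem_nhds hs] with z hz using if_neg hz
  have notMem_near (s : ℂ) : ∀ᶠ z in 𝓝[≠] s, z ∉ Z :=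
    nhdsNE_le_cofinite s Z.finite_toSet.compl_mem_cofinite
  have hcont : ContinuousOn H (Icc a b ×ℂ Icc c d) := by
    refine fun s hs => ContinuousAt.continuousWithinAt ?_
    by_cases hsZ : s ∈ Z
    · have hd : ∀ᶠ z in 𝓝[≠] s, DifferentiableAt ℂ h z := by
        filter_upwards [notMem_near s, nhdsWithin_le_nhds
          ((isOpen_Ioo.reProdIm isOpen_Ioo).mem_nhds (hZ hsZ))] with z hzZ hz
        exact hh z (Ioo_subset hz) hzZ
      rw [continuousAt_iff_punctured_nhds, hH]
      simp only [hsZ, if_true]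
      refine (tendsto_limUnder_of_tendsto_sub_mul hd (h0 s hsZ)).congr' ?_
      filter_upwards [notMem_near s] with z hz using (if_neg hz).symm
    · exact (hh s hs hsZ).continuousAt.congr (H_near hsZ).symm
  have hdiff : ∀ s ∈ Ioo a b ×ℂ Ioo c d \ Z, DifferentiableAt ℂ H s := fun s hs =>
    (hh s (Ioo_subset hs.1) hs.2).congr_of_eventuallyEq (H_near hs.2)
  have hzero := integral_boundary_rect_eq_zero_of_differentiable_on_off_countable H
    (a + c * I) (b + d * I) Z Z.countable_toSet
    (by simpa [uIcc_of_le hab, uIcc_of_le hcd] using hcont) (by simpa [hab, hcd] using hdiff)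
  rw [← rectBoundaryIntegral_congr hab hcd (f := H) fun s hs => if_neg fun hsZ => hs.2 (hZ hsZ)]
  simpa [rectBoundaryIntegral] using hzero

theorem tendsto_sub_mul_inv_sub (r σ ρ : ℂ) :
    Tendsto (fun s => (s - ρ) * (r * (s - σ)⁻¹)) (𝓝[≠] ρ) (𝓝 (if σ = ρ then r else 0)) := by
  split_ifs with hσ
  · refine tendsto_const_nhds.congr' ?_
    filter_upwards [self_mem_nhdsWithin] with s hs
    have hs' : s - ρ ≠ 0 := sub_ne_zero.2 hs
    rw [hσ]
    field_simp
  · refine Tendsto.mono_left ?_ nhdsWithin_le_nhds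
    have hcont : ContinuousAt (fun s => (s - ρ) * (r * (s - σ)⁻¹)) ρ := by
      have hne : ρ - σ ≠ 0 := sub_ne_zero.2 (Ne.symm hσ)
      fun_prop (disch := assumption)
    simpa using hcont.tendsto

theorem rectBoundaryIntegral_eq_sum_residues {g : ℂ → ℂ} {Z : Finset ℂ} {r : ℂ → ℂ}
    (hab : a ≤ b) (hcd : c ≤ d) (hZ : ↑Z ⊆ Ioo a b ×ℂ Ioo c d)
    (hg : ∀ s ∈ Icc a b ×ℂ Icc c d, s ∉ Z → DifferentiableAt ℂ g s)
    (hr : ∀ ρ ∈ Z, Tendsto (fun s => (s - ρ) * g s) (𝓝[≠] ρ) (𝓝 (r ρ))) :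
    rectBoundaryIntegral g a b c d = 2 * Real.pi * I * ∑ ρ ∈ Z, r ρ := by
  have hpole {σ s : ℂ} (hs : s ≠ σ) : DifferentiableAt ℂ (fun s => r σ * (s - σ)⁻¹) s :=
    ((differentiableAt_id.sub_const σ).inv (sub_ne_zero.2 hs)).const_mul _
  have hpoles {s : ℂ} (hs : s ∉ Z) :
      DifferentiableAt ℂ (fun s => ∑ σ ∈ Z, r σ * (s - σ)⁻¹) s :=
    DifferentiableAt.fun_sum fun σ hσ => hpole (ne_of_mem_of_not_mem hσ hs).symm
  have hboundary {s : ℂ} (hs : s ∈ rectBoundary a b c d) : s ∉ Z := fun hsZ => hs.2 (hZ hsZ)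
  have hzero : rectBoundaryIntegral (fun s => g s - ∑ σ ∈ Z, r σ * (s - σ)⁻¹) a b c d = 0 := by
    refine rectBoundaryIntegral_eq_zero hab hcd hZ
      (fun s hs hsZ => (hg s hs hsZ).sub (hpoles hsZ)) fun ρ hρ => ?_
    have hsum := (hr ρ hρ).sub (tendsto_finsetSum Z fun σ _ =>
      tendsto_sub_mul_inv_sub (r σ) σ ρ)
    simp only [Finset.sum_ite_eq', hρ, if_true, sub_self] at hsum
    exact hsum.congr fun s => by rw [mul_sub, Finset.mul_sum]
  rw [rectBoundaryIntegral_sub hab hcd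
      (fun s hs => (hg s hs.1 (hboundary hs)).continuousAt.continuousWithinAt)
      (fun s hs => (hpoles (hboundary hs)).continuousAt.continuousWithinAt),
    rectBoundaryIntegral_finsetSum hab hcd fun σ hσ s hs =>
      (hpole (ne_of_mem_of_not_mem hσ (hboundary hs)).symm).continuousAt.continuousWithinAt,
    sub_eq_zero] at hzero
  rw [hzero, Finset.mul_sum]
  refine Finset.sum_congr rfl fun σ hσ => ?_
  rw [rectBoundaryIntegral_const_mul, rectBoundaryIntegral_inv_sub (hZ hσ), mul_comm]

theorem tendsto_sub_mul_div {f F : ℂ → ℂ} {ρ : ℂ} (hf : DifferentiableAt ℂ f ρ) (h0 : f ρ = 0)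
    (hf' : deriv f ρ ≠ 0) (hF : ContinuousAt F ρ) :
    Tendsto (fun s => (s - ρ) * (F s / f s)) (𝓝[≠] ρ) (𝓝 ((deriv f ρ)⁻¹ * F ρ)) := by
  refine ((hf.hasDerivAt.tendsto_slope.inv₀ hf').mul
    (hF.tendsto.mono_left nhdsWithin_le_nhds)).congr fun s => ?_
  rw [slope_def_field, h0, sub_zero, inv_div]
  ring

end ContourIntegral

theorem re_eq_half_of_riemannZeta_eq_zero (hRH : RiemannHypothesis) {s : ℂ}
    (hs : riemannZeta s = 0) (him : s.im ≠ 0) : s.re = 1 / 2 := by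
  refine hRH s hs ?_ ?_
  · rintro ⟨n, rfl⟩
    simp [Complex.mul_im] at him
  · rintro rfl
    simp at him

theorem mem_zetaZerosBetween_iff (hRH : RiemannHypothesis) {T₁ T₂ : ℝ} (hT₁ : 0 ≤ T₁) {s : ℂ} :
    s ∈ zetaZerosBetween T₁ T₂ ↔ riemannZeta s = 0 ∧ T₁ < s.im ∧ s.im < T₂ := by
  refine ⟨fun h => ⟨h.1, h.2.2⟩, fun h => ⟨h.1, ?_, h.2⟩⟩
  rw [re_eq_half_of_riemannZeta_eq_zero hRH h.1 (hT₁.trans_lt h.2.1).ne']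
  norm_num

theorem rectBoundaryIntegral_div_riemannZeta (hRH : RiemannHypothesis) {F : ℂ → ℂ}
    (hF : Differentiable ℂ F) {a b T₁ T₂ : ℝ} (ha : a < 1 / 2) (hb : 1 / 2 < b) (hT₁ : 0 < T₁)
    (hT : T₁ ≤ T₂) (hsimple : ∀ s, riemannZeta s = 0 → T₁ ≤ s.im → deriv riemannZeta s ≠ 0)
    (hζ₁ : riemannZeta (1 / 2 + T₁ * I) ≠ 0) (hζ₂ : riemannZeta (1 / 2 + T₂ * I) ≠ 0) :
    rectBoundaryIntegral (fun s => F s / riemannZeta s) a b T₁ T₂ =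
      2 * Real.pi * I * ∑ ρ ∈ (zetaZerosBetween_finite T₁ T₂).toFinset,
        (deriv riemannZeta ρ)⁻¹ * F ρ := by
  have hdiff {s : ℂ} (him : T₁ ≤ s.im) : DifferentiableAt ℂ riemannZeta s :=
    differentiableAt_riemannZeta (by rintro rfl; simp at him; linarith)
  have hre {s : ℂ} (hs : riemannZeta s = 0) (him : T₁ ≤ s.im) : s = 1 / 2 + s.im * I := by
    apply Complex.ext <;>
      simp [re_eq_half_of_riemannZeta_eq_zero hRH hs (hT₁.trans_le him).ne']
  refine rectBoundaryIntegral_eq_sum_residues (ha.trans hb).le hT ?_ ?_ ?_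
  · intro s hs
    rw [Finite.coe_toFinset] at hs
    refine ⟨?_, hs.2.2⟩
    rw [mem_preimage, re_eq_half_of_riemannZeta_eq_zero hRH hs.1 (hT₁.trans hs.2.2.1).ne']
    exact ⟨ha, hb⟩
  · rintro s ⟨-, him₁, him₂⟩ hsZ
    refine hF.differentiableAt.div (hdiff him₁) fun h0 => hsZ ?_
    rw [Finite.mem_toFinset, mem_zetaZerosBetween_iff hRH hT₁.le]
    refine ⟨h0, him₁.lt_of_ne ?_, him₂.lt_of_ne ?_⟩
    · rintro rfl
      exact hζ₁ (hre h0 le_rfl ▸ h0)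
    · rintro rfl
      exact hζ₂ (hre h0 hT ▸ h0)
  · intro ρ hρ
    rw [Finite.mem_toFinset] at hρ
    exact tendsto_sub_mul_div (hdiff hρ.2.2.1.le) hρ.1 (hsimple ρ hρ.1 hρ.2.2.1.le)
      hF.continuous.continuousAt

/-! ### Growth of `ζ` to the right of the imaginary axis -/

theorem norm_ofReal_cpow_neg_sub_le {s : ℂ} (hs : 0 ≤ s.re) {m x : ℝ} (hm : 0 < m)
    (hx : x ∈ Icc m (m + 1)) :
    ‖(x : ℂ) ^ (-s) - (m : ℂ) ^ (-s)‖ ≤ ‖s‖ * m ^ (-s.re - 1) := by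
  rcases eq_or_ne s 0 with rfl | hs0
  · simp
  have hmvt := (convex_Icc m (m + 1)).norm_image_sub_le_of_norm_hasDerivWithin_le
    (f := fun x : ℝ => (x : ℂ) ^ (-s)) (f' := fun x : ℝ => -s * (x : ℂ) ^ (-s - 1))
    (C := ‖s‖ * m ^ (-s.re - 1))
    (fun y hy => (hasDerivAt_ofReal_cpow_const (hm.trans_le hy.1).ne'
      (neg_ne_zero.2 hs0)).hasDerivWithinAt) ?_ ⟨le_rfl, by linarith⟩ hx
  · have hxm : ‖x - m‖ ≤ 1 := by
      rw [Real.norm_eq_abs, abs_le]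
      constructor <;> linarith [hx.1, hx.2]
    exact hmvt.trans (mul_le_of_le_one_right (by positivity) hxm)
  · intro y hy
    rw [norm_mul, norm_neg, norm_cpow_eq_rpow_re_of_pos (hm.trans_le hy.1)]
    simp only [sub_re, neg_re, one_re]
    gcongr ‖s‖ * ?_
    exact Real.rpow_le_rpow_of_nonpos hm hy.1 (by linarith)

/-- The `n`-th term of the Euler–Maclaurin expansion of `(s - 1) ζ(s) - 1`: it is
`(s - 1) ∫ x in n..n + 1, (n ^ (-s) - x ^ (-s))`, written so as to make sense at `s = 1`. -/
noncomputable def zetaCorrection (n : ℕ) (s : ℂ) : ℂ :=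
  (s - 1) * (n : ℂ) ^ (-s) + (((n + 1 : ℕ) : ℂ) ^ (1 - s) - (n : ℂ) ^ (1 - s))

theorem norm_zetaCorrection_le {s : ℂ} (hs : 0 ≤ s.re) {n : ℕ} (hn : 0 < n) :
    ‖zetaCorrection n s‖ ≤ ‖s - 1‖ * ‖s‖ * (n : ℝ) ^ (-s.re - 1) := by
  rcases eq_or_ne s 1 with rfl | hs1
  · simp [zetaCorrection]
  have hn' : (0 : ℝ) < n := by exact_mod_cast hn
  have hmvt := (convex_Icc (n : ℝ) (n + 1)).norm_image_sub_le_of_norm_hasDerivWithin_le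
    (f := fun x : ℝ => (s - 1) * (n : ℂ) ^ (-s) * (x - n) + (x : ℂ) ^ (1 - s))
    (f' := fun x : ℝ => (s - 1) * (n : ℂ) ^ (-s) * 1 + (1 - s) * (x : ℂ) ^ (1 - s - 1))
    (C := ‖s - 1‖ * ‖s‖ * (n : ℝ) ^ (-s.re - 1)) (x := n) (y := n + 1) ?_ ?_
    ⟨le_rfl, by linarith⟩ ⟨by linarith, le_rfl⟩
  · convert hmvt using 1
    · simp [zetaCorrection, add_sub_assoc]
    · simp
  · intro y hy
    have hlin : HasDerivAt (fun x : ℝ => (s - 1) * (n : ℂ) ^ (-s) * ((x : ℂ) - n))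
        ((s - 1) * (n : ℂ) ^ (-s) * 1) y :=
      (Complex.ofRealCLM.hasDerivAt.sub_const (n : ℂ)).const_mul _
    exact (hlin.add (hasDerivAt_ofReal_cpow_const (hn'.trans_le hy.1).ne'
      (sub_ne_zero.2 hs1.symm))).hasDerivWithinAt
  · intro y hy
    have hfactor : (s - 1) * (n : ℂ) ^ (-s) * 1 + (1 - s) * (y : ℂ) ^ (1 - s - 1) =
        -((s - 1) * ((y : ℂ) ^ (-s) - ((n : ℝ) : ℂ) ^ (-s))) := by
      rw [show (1 : ℂ) - s - 1 = -s by ring, ofReal_natCast]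
      ring
    rw [hfactor, norm_neg, norm_mul, mul_assoc]
    gcongr
    exact norm_ofReal_cpow_neg_sub_le hs hn' hy

theorem summable_natCast_add_one_rpow {p : ℝ} (hp : p < -1) :
    Summable fun n : ℕ => ((n + 1 : ℕ) : ℝ) ^ p :=
  (summable_nat_add_iff 1).2 (Real.summable_nat_rpow.2 hp)

theorem norm_zetaCorrection_succ_le {σ : ℝ} (hσ : 0 ≤ σ) {s : ℂ} (hs : σ ≤ s.re) (n : ℕ) :
    ‖zetaCorrection (n + 1) s‖ ≤ ‖s - 1‖ * ‖s‖ * ((n + 1 : ℕ) : ℝ) ^ (-σ - 1) := by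
  refine (norm_zetaCorrection_le (hσ.trans hs) n.succ_pos).trans ?_
  gcongr
  exact_mod_cast n.succ_pos

theorem hasSum_zetaCorrection_of_one_lt_re {s : ℂ} (hs : 1 < s.re) :
    HasSum (fun n : ℕ => zetaCorrection (n + 1) s) ((s - 1) * riemannZeta s - 1) := by
  have hζ : HasSum (fun n : ℕ => ((n + 1 : ℕ) : ℂ) ^ (-s)) (riemannZeta s) := by
    have hsum := (summable_nat_add_iff 1).2 (Complex.summable_one_div_nat_cpow.2 hs)
    simp only [one_div, ← cpow_neg] at hsum
    rw [zeta_eq_tsum_one_div_nat_add_one_cpow hs]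
    simpa [cpow_neg] using hsum.hasSum
  have hlim : Tendsto (fun n : ℕ => (n : ℂ) ^ (1 - s)) atTop (𝓝 0) := by
    rw [tendsto_zero_iff_norm_tendsto_zero]
    refine ((tendsto_rpow_neg_atTop (y := s.re - 1) (by linarith)).comp
      tendsto_natCast_atTop_atTop).congr' ?_
    filter_upwards [eventually_gt_atTop 0] with n hn
    rw [norm_natCast_cpow_of_pos hn]
    simp
  have hcorr : Summable fun n : ℕ => zetaCorrection (n + 1) s :=
    .of_norm_bounded ((summable_natCast_add_one_rpow (by linarith)).mul_left _)
      (norm_zetaCorrection_succ_le zero_le_one hs.le)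
  have htele : HasSum (fun n : ℕ => ((n + 1 + 1 : ℕ) : ℂ) ^ (1 - s) - ((n + 1 : ℕ) : ℂ) ^ (1 - s))
      (0 - 1) := by
    have hsum := hcorr.sub (hζ.summable.mul_left (s - 1))
    simp only [zetaCorrection, add_sub_cancel_left] at hsum
    rw [hsum.hasSum_iff_tendsto_nat]
    simp only [Finset.sum_range_sub fun i : ℕ => ((i + 1 : ℕ) : ℂ) ^ (1 - s)]
    simpa using ((tendsto_add_atTop_iff_nat 1).2 hlim).sub_const 1
  rw [sub_eq_add_neg, ← zero_sub]
  exact (hζ.mul_left (s - 1)).add htele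

theorem differentiableOn_tsum_zetaCorrection :
    DifferentiableOn ℂ (fun s => ∑' n : ℕ, zetaCorrection (n + 1) s) {s | 0 < s.re} := by
  intro z hz
  set V : Set ℂ := {s | z.re / 2 < s.re} ∩ Metric.ball z 1
  have hVo : IsOpen V :=
    (isOpen_lt continuous_const Complex.continuous_re).inter Metric.isOpen_ball
  have hzV : z ∈ V := ⟨half_lt_self (show 0 < z.re from hz), by simp⟩
  have hdiff (n : ℕ) : Differentiable ℂ (zetaCorrection (n + 1)) := by
    have hn (m : ℕ) : ((m + 1 : ℕ) : ℂ) ≠ 0 := by exact_mod_cast m.succ_ne_zero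
    unfold zetaCorrection
    have := hn n
    have := hn (n + 1)
    fun_prop (disch := simp_all)
  have hV : DifferentiableOn ℂ (fun s => ∑' n : ℕ, zetaCorrection (n + 1) s) V := by
    refine differentiableOn_tsum_of_summable_norm
      ((summable_natCast_add_one_rpow (p := -(z.re / 2) - 1) (by
        linarith [show 0 < z.re from hz])).mul_left ((‖z‖ + 2) * (‖z‖ + 2)))
      (fun n => (hdiff n).differentiableOn) hVo fun n w hw => ?_
    refine (norm_zetaCorrection_succ_le (half_pos hz).le hw.1.le n).trans ?_
    have hwz : ‖w - z‖ < 1 := mem_ball_iff_norm.1 hw.2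
    have hw1 : ‖w - 1‖ ≤ ‖w‖ + 1 := by simpa using norm_sub_le w 1
    have hw2 : ‖w‖ ≤ ‖z‖ + 1 := by linarith [norm_sub_norm_le w z]
    gcongr <;> linarith
  exact (hV.differentiableAt (hVo.mem_nhds hzV)).differentiableWithinAt

theorem sub_one_mul_riemannZeta {s : ℂ} (hs : 0 < s.re) (hs1 : s ≠ 1) :
    (s - 1) * riemannZeta s = 1 + ∑' n : ℕ, zetaCorrection (n + 1) s := by
  have hUo : IsOpen {s : ℂ | 0 < s.re} := isOpen_lt continuous_const Complex.continuous_re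
  have hζ₁ {w : ℂ} (hw : w ≠ 1) : riemannZeta₁ w = (w - 1) * riemannZeta w := by
    rw [riemannZeta_eq_inv_sub_mul hw, mul_inv_cancel_left₀ (sub_ne_zero.2 hw)]
  rw [← hζ₁ hs1]
  refine AnalyticOnNhd.eqOn_of_preconnected_of_eventuallyEq
    (differentiable_riemannZeta₁.differentiableOn.analyticOnNhd hUo)
    ((differentiableOn_tsum_zetaCorrection.const_add 1).analyticOnNhd hUo)
    (convex_halfSpace_re_gt 0).isPreconnected (z₀ := 2) (by simp) ?_ hs
  filter_upwards [(isOpen_lt continuous_const Complex.continuous_re).mem_nhds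
    (show (2 : ℂ) ∈ {s : ℂ | 1 < s.re} by simp)] with w hw
  rw [hζ₁ (by rintro rfl; simp at hw), (hasSum_zetaCorrection_of_one_lt_re hw).tsum_eq]
  ring

theorem exists_norm_riemannZeta_le {σ : ℝ} (hσ : 0 < σ) :
    ∃ C : ℝ, 0 < C ∧ ∀ s : ℂ, σ ≤ s.re → 1 ≤ |s.im| → ‖riemannZeta s‖ ≤ C * ‖s‖ := by
  have hsum := summable_natCast_add_one_rpow (p := -σ - 1) (by linarith)
  set D := ∑' n : ℕ, ((n + 1 : ℕ) : ℝ) ^ (-σ - 1)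
  have hD0 : 0 ≤ D := tsum_nonneg fun n => by positivity
  refine ⟨1 + D, add_pos_of_pos_of_nonneg one_pos hD0, fun s hs him => ?_⟩
  have hs1 : s ≠ 1 := by rintro rfl; simp at him; linarith
  have hnorm1 : 1 ≤ ‖s - 1‖ := him.trans (by simpa using Complex.abs_im_le_norm (s - 1))
  have hnorm : 1 ≤ ‖s‖ := him.trans (Complex.abs_im_le_norm s)
  have htail : ‖∑' n : ℕ, zetaCorrection (n + 1) s‖ ≤ ‖s - 1‖ * ‖s‖ * D :=
    tsum_of_norm_bounded (hsum.hasSum.mul_left _) (norm_zetaCorrection_succ_le hσ.le hs)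
  have hprod : 1 ≤ ‖s - 1‖ * ‖s‖ := one_le_mul_of_one_le_of_one_le hnorm1 hnorm
  refine le_of_mul_le_mul_left ?_ (zero_lt_one.trans_le hnorm1)
  calc ‖s - 1‖ * ‖riemannZeta s‖ = ‖1 + ∑' n : ℕ, zetaCorrection (n + 1) s‖ := by
        rw [← norm_mul, sub_one_mul_riemannZeta (hσ.trans_le hs) hs1]
    _ ≤ 1 + ‖s - 1‖ * ‖s‖ * D := (norm_add_le _ _).trans (by simpa using htail)
    _ ≤ ‖s - 1‖ * ‖s‖ + ‖s - 1‖ * ‖s‖ * D := by gcongr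
    _ = ‖s - 1‖ * ((1 + D) * ‖s‖) := by ring

/-! ### Bounds for `1 / ζ` to the right of the critical line -/

theorem norm_inv_riemannZeta_le {s : ℂ} (hs : 1 < s.re) :
    ‖(riemannZeta s)⁻¹‖ ≤ ∑' n : ℕ, (n : ℝ) ^ (-s.re) := by
  have hinv := ArithmeticFunction.LSeries_zeta_mul_Lseries_moebius hs
  rw [ArithmeticFunction.LSeries_zeta_eq_riemannZeta hs] at hinv
  rw [← eq_inv_of_mul_eq_one_right hinv, LSeries]
  refine tsum_of_norm_bounded (Real.summable_nat_rpow.2 (by linarith)).hasSum fun n => ?_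
  rcases Nat.eq_zero_or_pos n with rfl | hn
  · rw [LSeries.term_zero, norm_zero]
    positivity
  · rw [LSeries.term_of_ne_zero hn.ne', norm_div, norm_natCast_cpow_of_pos hn,
      Real.rpow_neg n.cast_nonneg, ← one_div, Complex.norm_intCast]
    gcongr
    exact_mod_cast ArithmeticFunction.abs_moebius_le_one

theorem exists_eq_mul_exp_of_forall_ne_zero {f : ℂ → ℂ} {c : ℂ} {R : ℝ} (hR : 0 < R)
    (hf : DifferentiableOn ℂ f (Metric.ball c R)) (hne : ∀ w ∈ Metric.ball c R, f w ≠ 0) :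
    ∃ g : ℂ → ℂ, DifferentiableOn ℂ g (Metric.ball c R) ∧ g c = 0 ∧
      ∀ w ∈ Metric.ball c R, f w = f c * exp (g w) := by
  have hc : c ∈ Metric.ball c R := Metric.mem_ball_self hR
  obtain ⟨g, hg⟩ := ((hf.deriv Metric.isOpen_ball).div hf hne).isExactOn_ball
  refine ⟨fun w => g w - g c,
    fun w hw => ((hg w hw).differentiableAt.sub_const _).differentiableWithinAt,
    sub_self _, fun w hw => ?_⟩
  have hconst : f w * exp (-g w) = f c * exp (-g c) := by
    refine IsOpen.is_const_of_deriv_eq_zero (f := fun w => f w * exp (-g w)) Metric.isOpen_ball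
      (convex_ball c R).isPreconnected
      (hf.mul fun w hw => (hg w hw).differentiableAt.neg.cexp.differentiableWithinAt)
      (fun w hw => ?_) hw hc
    have hderiv := (hf.differentiableAt (Metric.isOpen_ball.mem_nhds hw)).hasDerivAt.mul
      (hg w hw).neg.cexp
    refine hderiv.deriv.trans ?_
    have := hne w hw
    simp only [Pi.div_apply, Pi.zero_apply]
    field_simp
    ring
  change f w = f c * exp (g w - g c)
  rw [sub_eq_neg_add, exp_add, ← mul_assoc, ← hconst, mul_assoc, ← exp_add, neg_add_cancel,
    exp_zero, mul_one]

/-- The Borel–Carathéodory theorem for the logarithm of `f`. -/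
theorem norm_inv_le_of_norm_le {f : ℂ → ℂ} {c z : ℂ} {R r B m : ℝ} (hr : 0 ≤ r) (hrR : r < R)
    (hB : 1 < B) (hm : 0 < m) (hf : DifferentiableOn ℂ f (Metric.ball c R))
    (hne : ∀ w ∈ Metric.ball c R, f w ≠ 0) (hfB : ∀ w ∈ Metric.ball c R, ‖f w‖ ≤ m * B)
    (hfm : m ≤ ‖f c‖) (hz : ‖z - c‖ ≤ r) :
    ‖(f z)⁻¹‖ ≤ m⁻¹ * B ^ (2 * r / (R - r)) := by
  have hR : 0 < R := hr.trans_lt hrR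
  obtain ⟨g, hg, hgc, hfg⟩ := exists_eq_mul_exp_of_forall_ne_zero hR hf hne
  have hlog : 0 < Real.log B := Real.log_pos hB
  have hmap : MapsTo (fun w => c + w) (Metric.ball (0 : ℂ) R) (Metric.ball c R) := fun w hw => by
    simpa [mem_ball_iff_norm] using hw
  have hzR : z - c ∈ Metric.ball (0 : ℂ) R := mem_ball_zero_iff.2 (hz.trans_lt hrR)
  have hg_re {w : ℂ} (hw : w ∈ Metric.ball (0 : ℂ) R) : (g (c + w)).re ≤ Real.log B := by
    rw [Real.le_log_iff_exp_le (by linarith), ← norm_exp]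
    refine le_of_mul_le_mul_left ?_ (hm.trans_le hfm)
    rw [← norm_mul, ← hfg _ (hmap hw)]
    exact (hfB _ (hmap hw)).trans (by gcongr)
  have hg_norm : ‖g z‖ ≤ Real.log B * (2 * r / (R - r)) := by
    have hBC := Complex.borelCaratheodory_zero hlog (hg.comp (by fun_prop) hmap)
      (fun w hw => hg_re hw) hR hzR (by simp [hgc])
    calc ‖g z‖ ≤ 2 * Real.log B * ‖z - c‖ / (R - ‖z - c‖) := by simpa using hBC
      _ ≤ 2 * Real.log B * r / (R - r) := by gcongr
      _ = Real.log B * (2 * r / (R - r)) := by ring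
  have hzc : z ∈ Metric.ball c R := by simpa using hmap hzR
  rw [hfg z hzc, mul_inv, norm_mul, norm_inv, ← exp_neg, norm_exp,
    Real.rpow_def_of_pos (by linarith)]
  gcongr
  exact (Complex.re_le_norm _).trans (by rwa [norm_neg])

theorem half_lt_re_and_im_norm_le_of_mem_ball {t : ℝ} (ht : 3 ≤ t) {w : ℂ}
    (hw : w ∈ Metric.ball (2 + t * I) (3 / 2)) :
    1 / 2 < w.re ∧ 3 / 2 ≤ w.im ∧ ‖w‖ ≤ 6 * t := by
  rw [mem_ball_iff_norm] at hw
  have hre := (Complex.abs_re_le_norm (w - (2 + t * I))).trans_lt hw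
  have him := (Complex.abs_im_le_norm (w - (2 + t * I))).trans_lt hw
  simp only [sub_re, add_re, re_ofNat, mul_re, ofReal_re, I_re, mul_zero, ofReal_im, I_im,
    mul_one, sub_self, add_zero, sub_im, add_im, im_ofNat, mul_im, zero_add, abs_lt] at hre him
  refine ⟨by linarith, by linarith, (Complex.norm_le_abs_re_add_abs_im w).trans ?_⟩
  rw [abs_of_pos (by linarith), abs_of_pos (by linarith)]
  linarith

theorem exists_norm_inv_riemannZeta_le_rpow (hRH : RiemannHypothesis) {σ : ℝ} (hσ : 1 / 2 < σ)
    (hσ2 : σ ≤ 2) :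
    ∃ C A : ℝ, 0 < C ∧ 0 ≤ A ∧ ∀ t : ℝ, 3 ≤ t → ‖(riemannZeta (σ + t * I))⁻¹‖ ≤ C * t ^ A := by
  obtain ⟨C, hC, hζ⟩ := exists_norm_riemannZeta_le one_half_pos
  set S := ∑' n : ℕ, (n : ℝ) ^ (-2 : ℝ)
  have hS0 : 0 < S :=
    (Real.summable_nat_rpow.2 (by norm_num)).tsum_pos (fun n => by positivity) 1 (by simp)
  set A := 2 * (2 - σ) / (3 / 2 - (2 - σ))
  have hA : 0 ≤ A := div_nonneg (by linarith) (by linarith)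
  refine ⟨S * (6 * C * S + 1) ^ A, A, by positivity, hA, fun t ht => ?_⟩
  have hcenter : S⁻¹ ≤ ‖riemannZeta (2 + t * I)‖ := by
    have hinv := norm_inv_riemannZeta_le (s := 2 + t * I) (by simp)
    rw [norm_inv, show (2 + t * I : ℂ).re = 2 by simp] at hinv
    exact inv_le_of_inv_le₀ (norm_pos_iff.2 (riemannZeta_ne_zero_of_one_lt_re (by simp))) hinv
  have hbound {w : ℂ} (hw : w ∈ Metric.ball (2 + t * I) (3 / 2)) :
      ‖riemannZeta w‖ ≤ S⁻¹ * (6 * C * S * t + 1) := by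
    obtain ⟨hre, him, hnorm⟩ := half_lt_re_and_im_norm_le_of_mem_ball ht hw
    calc ‖riemannZeta w‖ ≤ C * ‖w‖ := hζ w hre.le (by rw [abs_of_pos] <;> linarith)
      _ ≤ C * (6 * t) + S⁻¹ := le_add_of_le_of_nonneg (by gcongr) (by positivity)
      _ = S⁻¹ * (6 * C * S * t + 1) := by field_simp
  calc ‖(riemannZeta (σ + t * I))⁻¹‖ ≤ S⁻¹⁻¹ * (6 * C * S * t + 1) ^ A := by
        refine norm_inv_le_of_norm_le (by linarith) (by linarith)
          (lt_add_of_pos_left _ (by positivity)) (by positivity) ?_ ?_ (fun w => hbound) hcenter ?_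
        · refine fun w hw => (differentiableAt_riemannZeta ?_).differentiableWithinAt
          rintro rfl
          have him := (half_lt_re_and_im_norm_le_of_mem_ball ht hw).2.1
          norm_num at him
        · intro w hw h0
          obtain ⟨hre, him, -⟩ := half_lt_re_and_im_norm_le_of_mem_ball ht hw
          linarith [re_eq_half_of_riemannZeta_eq_zero hRH h0 (by linarith)]
        · rw [add_sub_add_right_eq_sub, ← ofReal_ofNat, ← ofReal_sub, Complex.norm_real,
            Real.norm_eq_abs, abs_sub_comm, abs_of_nonneg (by linarith)]
    _ ≤ S * ((6 * C * S + 1) * t) ^ A := by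
        rw [inv_inv]
        gcongr
        linarith
    _ = S * (6 * C * S + 1) ^ A * t ^ A := by
        rw [Real.mul_rpow (by positivity) (by positivity)]
        ring

/-! ### Bounds for `1 / ζ` to the left of the critical line -/

theorem norm_betaIntegral_le_norm_betaIntegral_re (u v : ℂ) :
    ‖betaIntegral u v‖ ≤ ‖betaIntegral u.re v.re‖ := by
  have hreal : betaIntegral (u.re : ℂ) (v.re : ℂ) =
      ((∫ x : ℝ in 0..1, x ^ (u.re - 1) * (1 - x) ^ (v.re - 1) : ℝ) : ℂ) := by
    rw [betaIntegral, ← intervalIntegral.integral_ofReal]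
    refine intervalIntegral.integral_congr fun x hx => ?_
    rw [uIcc_of_le zero_le_one] at hx
    push_cast
    rw [ofReal_cpow hx.1, ofReal_cpow (by linarith [hx.2])]
    push_cast
    rfl
  have hnonneg : 0 ≤ ∫ x : ℝ in 0..1, x ^ (u.re - 1) * (1 - x) ^ (v.re - 1) :=
    intervalIntegral.integral_nonneg zero_le_one fun x hx =>
      mul_nonneg (Real.rpow_nonneg hx.1 _) (Real.rpow_nonneg (sub_nonneg.2 hx.2) _)
  rw [hreal, Complex.norm_real, Real.norm_of_nonneg hnonneg, betaIntegral]
  refine (intervalIntegral.norm_integral_le_integral_norm zero_le_one).trans_eq ?_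
  rw [integral_of_le zero_le_one, integral_of_le zero_le_one,
    integral_Ioc_eq_integral_Ioo, integral_Ioc_eq_integral_Ioo]
  refine setIntegral_congr_fun measurableSet_Ioo fun x hx => ?_
  have hsub : 1 - (x : ℂ) = ((1 - x : ℝ) : ℂ) := by push_cast; rfl
  simp only [norm_mul]
  rw [hsub, norm_cpow_eq_rpow_re_of_pos hx.1, norm_cpow_eq_rpow_re_of_pos (by linarith [hx.2])]
  simp only [sub_re, one_re]

theorem Gamma_re_add_mul_norm_Gamma_le {s : ℂ} {δ : ℝ} (hs : 0 < s.re) (hδ : 0 < δ) :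
    Real.Gamma (s.re + δ) * ‖Gamma s‖ ≤ Real.Gamma s.re * ‖Gamma (s + δ)‖ := by
  have hbeta := congrArg norm (Gamma_mul_Gamma_eq_betaIntegral hs (t := δ) (by simpa))
  have hbeta_re := congrArg norm
    (Gamma_mul_Gamma_eq_betaIntegral (s := s.re) (t := δ) (by simpa) (by simpa))
  have hle := norm_betaIntegral_le_norm_betaIntegral_re s δ
  have hΓδ := Real.Gamma_pos_of_pos hδ
  have hΓs := Real.Gamma_pos_of_pos hs
  have hΓ := Real.Gamma_pos_of_pos (add_pos hs hδ)
  rw [norm_mul, norm_mul, Gamma_ofReal, Complex.norm_real, Real.norm_of_nonneg hΓδ.le] at hbeta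
  rw [norm_mul, norm_mul, ← ofReal_add, Gamma_ofReal, Gamma_ofReal, Gamma_ofReal,
    Complex.norm_real, Complex.norm_real, Complex.norm_real, Real.norm_of_nonneg hΓδ.le,
    Real.norm_of_nonneg hΓs.le, Real.norm_of_nonneg hΓ.le] at hbeta_re
  rw [ofReal_re] at hle
  refine le_of_mul_le_mul_left ?_ hΓδ
  calc Real.Gamma δ * (Real.Gamma (s.re + δ) * ‖Gamma s‖)
      = Real.Gamma (s.re + δ) * (‖Gamma (s + δ)‖ * ‖betaIntegral s δ‖) := by rw [← hbeta]; ring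
    _ ≤ Real.Gamma (s.re + δ) * (‖Gamma (s + δ)‖ * ‖betaIntegral s.re δ‖) := by gcongr
    _ = Real.Gamma δ * (Real.Gamma s.re * ‖Gamma (s + δ)‖) := by
        rw [mul_left_comm, ← hbeta_re]
        ring

theorem norm_Gamma_one_add_mul_I_sq {t : ℝ} (ht : 0 < t) :
    ‖Gamma (1 + t * I)‖ ^ 2 = Real.pi * t / Real.sinh (Real.pi * t) := by
  have hsucc : ‖Gamma (1 + t * I)‖ = t * ‖Gamma (t * I)‖ := by
    rw [add_comm, Gamma_add_one _ (by simp [ht.ne']), norm_mul, norm_mul, norm_I,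
      Complex.norm_real, Real.norm_of_nonneg ht.le, mul_one]
  have hconj : ‖Gamma (1 - t * I)‖ = ‖Gamma (1 + t * I)‖ := by
    rw [show (1 - t * I : ℂ) = (starRingEnd ℂ) (1 + t * I) by simp [sub_eq_add_neg], Gamma_conj,
      RCLike.norm_conj]
  have hsin : ‖sin (Real.pi * (t * I))‖ = Real.sinh (Real.pi * t) := by
    rw [← mul_assoc, sin_mul_I, norm_mul, norm_I, mul_one, ← ofReal_mul, ← ofReal_sinh,
      Complex.norm_real, Real.norm_of_nonneg (Real.sinh_nonneg_iff.2 (by positivity))]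
  have hreflection := congrArg norm (Complex.Gamma_mul_Gamma_one_sub (t * I))
  rw [norm_mul, norm_div, hsin, hconj, Complex.norm_real,
    Real.norm_of_nonneg Real.pi_pos.le] at hreflection
  calc ‖Gamma (1 + t * I)‖ ^ 2 = t * (‖Gamma (t * I)‖ * ‖Gamma (1 + t * I)‖) := by
        rw [hsucc]
        ring
    _ = Real.pi * t / Real.sinh (Real.pi * t) := by
        rw [hreflection]
        ring

theorem abs_sinh_im_le_norm_cos (z : ℂ) : |Real.sinh z.im| ≤ ‖cos z‖ := by
  have hcos : cos z = ((Real.cos z.re * Real.cosh z.im : ℝ) : ℂ) -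
      ((Real.sin z.re * Real.sinh z.im : ℝ) : ℂ) * I := by
    conv_lhs => rw [← re_add_im z, cos_add_mul_I]
    push_cast
    rfl
  refine abs_le_of_sq_le_sq ?_ (norm_nonneg _)
  have hnorm : ‖cos z‖ ^ 2 = Real.cos z.re ^ 2 + Real.sinh z.im ^ 2 := by
    rw [hcos, Complex.sq_norm, Complex.normSq_apply]
    simp only [sub_re, ofReal_re, mul_re, I_re, ofReal_im, I_im, sub_im, mul_im]
    linear_combination Real.cos z.re ^ 2 * Real.cosh_sq z.im +
      Real.sinh z.im ^ 2 * Real.sin_sq_add_cos_sq z.re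
  rw [hnorm]
  exact le_add_of_nonneg_left (sq_nonneg _)

theorem cosh_le_mul_sinh {y : ℝ} (hy : 1 ≤ y) : Real.cosh y ≤ 3 / 2 * Real.sinh y := by
  have hexp_two : 5 ≤ Real.exp (2 * y) :=
    calc (5 : ℝ) ≤ Real.exp 1 * Real.exp 1 := by nlinarith [Real.exp_one_gt_d9]
      _ = Real.exp (1 + 1) := (Real.exp_add 1 1).symm
      _ ≤ Real.exp (2 * y) := Real.exp_le_exp.2 (by linarith)
  have hexp : 5 * Real.exp (-y) ≤ Real.exp y :=
    calc 5 * Real.exp (-y) ≤ Real.exp (2 * y) * Real.exp (-y) := by gcongr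
      _ = Real.exp y := by
        rw [← Real.exp_add]
        ring_nf
  rw [Real.cosh_eq, Real.sinh_eq]
  linarith

theorem sqrt_le_norm_Gamma_mul_norm_cos {t : ℝ} (ht : 1 ≤ t) {z : ℂ}
    (hz : z.im = Real.pi * t / 2) : √t ≤ ‖Gamma (1 + t * I)‖ * ‖cos z‖ := by
  set y := Real.pi * t / 2 with hy
  have hy1 : 1 ≤ y := by nlinarith [Real.pi_gt_three]
  have hsinh : 0 < Real.sinh y := Real.sinh_pos_iff.2 (by linarith)
  have hcos : Real.sinh y ≤ ‖cos z‖ := by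
    simpa only [hz, abs_of_pos hsinh] using abs_sinh_im_le_norm_cos z
  have hsq : t ≤ (‖Gamma (1 + t * I)‖ * Real.sinh y) ^ 2 := by
    rw [mul_pow, norm_Gamma_one_add_mul_I_sq (by linarith),
      show Real.pi * t = 2 * y by rw [hy]; ring, Real.sinh_two_mul, div_mul_eq_mul_div,
      le_div_iff₀ (by positivity)]
    calc t * (2 * Real.sinh y * Real.cosh y)
        ≤ t * (2 * Real.sinh y * (3 / 2 * Real.sinh y)) := by
          gcongr
          exact cosh_le_mul_sinh hy1
      _ = 3 * (t * Real.sinh y ^ 2) := by ring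
      _ ≤ Real.pi * (t * Real.sinh y ^ 2) := by
          gcongr
          exact Real.pi_gt_three.le
      _ = 2 * y * Real.sinh y ^ 2 := by ring
  calc √t ≤ ‖Gamma (1 + t * I)‖ * Real.sinh y := Real.sqrt_le_iff.2 ⟨by positivity, hsq⟩
    _ ≤ ‖Gamma (1 + t * I)‖ * ‖cos z‖ := by gcongr

theorem Gamma_mul_sqrt_le {δ t : ℝ} (hδ : 0 < δ) (ht : 1 ≤ t) {z : ℂ}
    (hz : z.im = Real.pi * t / 2) :
    Real.Gamma (1 + δ) * √t ≤ ‖Gamma ((1 + δ : ℝ) + t * I)‖ * ‖cos z‖ := by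
  have hΓ := Gamma_re_add_mul_norm_Gamma_le (s := 1 + t * I) (by simp) hδ
  rw [show (1 + t * I : ℂ).re = 1 by simp, Real.Gamma_one, one_mul,
    show (1 + t * I + δ : ℂ) = (1 + δ : ℝ) + t * I by push_cast; ring] at hΓ
  calc Real.Gamma (1 + δ) * √t
      ≤ Real.Gamma (1 + δ) * (‖Gamma (1 + t * I)‖ * ‖cos z‖) :=
        mul_le_mul_of_nonneg_left (sqrt_le_norm_Gamma_mul_norm_cos ht hz)
          (Real.Gamma_pos_of_pos (by linarith)).le
    _ = Real.Gamma (1 + δ) * ‖Gamma (1 + t * I)‖ * ‖cos z‖ := (mul_assoc _ _ _).symm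
    _ ≤ ‖Gamma ((1 + δ : ℝ) + t * I)‖ * ‖cos z‖ := by gcongr

theorem norm_riemannZeta_one_sub (σ : ℝ) {t : ℝ} (ht : 0 < t) :
    ‖riemannZeta ((1 - σ : ℝ) + t * I)‖ = 2 * (2 * Real.pi) ^ (-σ) *
      (‖Gamma (σ + t * I)‖ * ‖cos (Real.pi * (σ + t * I) / 2)‖) * ‖riemannZeta (σ + t * I)‖ := by
  have him {w : ℂ} (hw : w.im = 0) : (σ + t * I : ℂ) ≠ w := fun h => by
    simp [← h, ht.ne'] at hw
  have hconj : ((1 - σ : ℝ) + t * I : ℂ) = (starRingEnd ℂ) (1 - (σ + t * I)) := by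
    simp only [map_sub, map_one, map_add, map_mul, conj_ofReal, conj_I]
    push_cast
    ring
  have hpi : ‖(2 * Real.pi : ℂ) ^ (-(σ + t * I : ℂ))‖ = (2 * Real.pi) ^ (-σ) := by
    rw [← ofReal_ofNat, ← ofReal_mul, norm_cpow_eq_rpow_re_of_pos (by positivity)]
    simp
  rw [hconj, riemannZeta_conj, RCLike.norm_conj,
    riemannZeta_one_sub (fun n => him (by simp)) (him one_im)]
  simp only [norm_mul, hpi, norm_ofNat]
  ring

theorem norm_inv_riemannZeta_one_sub_le {σ t m : ℝ} (ht : 0 < t) (hm : 0 < m)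
    (hle : m ≤ ‖Gamma (σ + t * I)‖ * ‖cos (Real.pi * (σ + t * I) / 2)‖) :
    ‖(riemannZeta ((1 - σ : ℝ) + t * I))⁻¹‖ ≤
      (2 * (2 * Real.pi) ^ (-σ) * m)⁻¹ * ‖(riemannZeta (σ + t * I))⁻¹‖ := by
  rw [norm_inv, norm_riemannZeta_one_sub σ ht, mul_inv, norm_inv]
  gcongr

theorem im_pi_mul_div_two (σ t : ℝ) :
    (Real.pi * (σ + t * I) / 2 : ℂ).im = Real.pi * t / 2 := by
  rw [show (Real.pi * (σ + t * I) / 2 : ℂ) =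
    (Real.pi * σ / 2 : ℝ) + (Real.pi * t / 2 : ℝ) * I by push_cast; ring]
  simp only [add_im, ofReal_im, mul_im, ofReal_re, I_re, I_im, mul_zero, mul_one, zero_add,
    add_zero]

theorem Gamma_div_le {σ t : ℝ} (hσ : 0 < σ) (ht : 1 ≤ t) (hσt : σ ≤ t) :
    Real.Gamma (1 + σ) / (2 * t) ≤
      ‖Gamma (σ + t * I)‖ * ‖cos (Real.pi * (σ + t * I) / 2)‖ := by
  have hσ0 : (σ + t * I : ℂ) ≠ 0 := fun h => hσ.ne' (by simpa using congrArg re h)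
  have hnorm : ‖(σ + t * I : ℂ)‖ ≤ 2 * t := by
    refine (norm_add_le _ _).trans ?_
    rw [norm_mul, norm_I, Complex.norm_real, Complex.norm_real, Real.norm_of_nonneg hσ.le,
      Real.norm_of_nonneg (by linarith)]
    linarith
  have hΓ := Gamma_mul_sqrt_le hσ ht (im_pi_mul_div_two σ t)
  rw [show ((1 + σ : ℝ) + t * I : ℂ) = σ + t * I + 1 by push_cast; ring,
    Gamma_add_one _ hσ0, norm_mul] at hΓ
  rw [div_le_iff₀' (by positivity), ← mul_assoc]
  calc Real.Gamma (1 + σ) ≤ Real.Gamma (1 + σ) * √t :=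
        le_mul_of_one_le_right (Real.Gamma_pos_of_pos (by linarith)).le (Real.one_le_sqrt.2 ht)
    _ ≤ ‖(σ + t * I : ℂ)‖ * ‖Gamma (σ + t * I)‖ * ‖cos (Real.pi * (σ + t * I) / 2)‖ := hΓ
    _ ≤ 2 * t * ‖Gamma (σ + t * I)‖ * ‖cos (Real.pi * (σ + t * I) / 2)‖ := by gcongr

theorem exists_norm_inv_riemannZeta_neg_le {δ : ℝ} (hδ : 0 < δ) :
    ∃ C : ℝ, 0 < C ∧ ∀ t : ℝ, 1 ≤ t →
      ‖(riemannZeta ((-δ : ℝ) + t * I))⁻¹‖ ≤ C * t ^ (-(1 / 2) : ℝ) := by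
  set S := ∑' n : ℕ, (n : ℝ) ^ (-(1 + δ))
  have hS : 0 < S :=
    (Real.summable_nat_rpow.2 (by linarith)).tsum_pos (fun n => by positivity) 1 (by simp)
  refine ⟨(2 * (2 * Real.pi) ^ (-(1 + δ)) * Real.Gamma (1 + δ))⁻¹ * S, by positivity,
    fun t ht => ?_⟩
  have ht0 : 0 < t := by linarith
  have hright := norm_inv_riemannZeta_le (s := (1 + δ : ℝ) + t * I) (by simpa)
  rw [show ((1 + δ : ℝ) + t * I : ℂ).re = 1 + δ by simp] at hright
  have hfe := norm_inv_riemannZeta_one_sub_le ht0 (by positivity)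
    (Gamma_mul_sqrt_le hδ ht (im_pi_mul_div_two (1 + δ) t))
  rw [sub_add_cancel_left] at hfe
  refine (hfe.trans (mul_le_mul_of_nonneg_left hright (by positivity))).trans_eq ?_
  rw [Real.rpow_neg ht0.le, ← Real.sqrt_eq_rpow]
  simp only [mul_inv]
  ring

theorem exists_norm_inv_riemannZeta_le_rpow_and_one_sub (hRH : RiemannHypothesis) {σ : ℝ}
    (hσ : 1 / 2 < σ) (hσ1 : σ ≤ 1) :
    ∃ C A : ℝ, 0 < C ∧ 0 ≤ A ∧ ∀ t : ℝ, 3 ≤ t →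
      ‖(riemannZeta (σ + t * I))⁻¹‖ ≤ C * t ^ A ∧
      ‖(riemannZeta ((1 - σ : ℝ) + t * I))⁻¹‖ ≤ C * t ^ A := by
  obtain ⟨C, A, hC, hA, hζ⟩ := exists_norm_inv_riemannZeta_le_rpow hRH hσ (by linarith)
  have hσ0 : 0 < σ := by linarith
  set p := 2 * (2 * Real.pi) ^ (-σ)
  refine ⟨C + 2 * C * (p * Real.Gamma (1 + σ))⁻¹, A + 1, by positivity, by linarith,
    fun t ht => ⟨?_, ?_⟩⟩
  · calc ‖(riemannZeta (σ + t * I))⁻¹‖ ≤ C * t ^ A := hζ t ht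
      _ ≤ (C + 2 * C * (p * Real.Gamma (1 + σ))⁻¹) * t ^ (A + 1) := by
        gcongr
        · exact le_add_of_nonneg_right (by positivity)
        · linarith
        · linarith
  · calc ‖(riemannZeta ((1 - σ : ℝ) + t * I))⁻¹‖
        ≤ (p * (Real.Gamma (1 + σ) / (2 * t)))⁻¹ * ‖(riemannZeta (σ + t * I))⁻¹‖ :=
          norm_inv_riemannZeta_one_sub_le (by linarith) (by positivity)
            (Gamma_div_le hσ0 (by linarith) (by linarith))
      _ ≤ (p * (Real.Gamma (1 + σ) / (2 * t)))⁻¹ * (C * t ^ A) := by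
          gcongr
          exact hζ t ht
      _ = 2 * C * (p * Real.Gamma (1 + σ))⁻¹ * t ^ (A + 1) := by
          rw [Real.rpow_add_one (by positivity)]
          field_simp
      _ ≤ (C + 2 * C * (p * Real.Gamma (1 + σ))⁻¹) * t ^ (A + 1) := by
          gcongr
          exact le_add_of_nonneg_left hC.le

/-! ### The residue theorem for `r ^ s / ζ(s)` -/

/-- The sum `∑ r^ρ / ζ'(ρ)` over the nontrivial zeros with `T₁ < γ < T₂`. -/
noncomputable def zetaZeroSum (T₁ T₂ r : ℝ) : ℂ :=
  ∑ ρ ∈ (zetaZerosBetween_finite T₁ T₂).toFinset, (deriv riemannZeta ρ)⁻¹ * (r : ℂ) ^ ρ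

/-- The integral of `r^s / ζ(s)` along the segment from `a + iT₁` to `a + iT₂`, divided by `i`. -/
noncomputable def verticalIntegral (T₁ T₂ a r : ℝ) : ℂ :=
  ∫ y in T₁..T₂, (r : ℂ) ^ (a + y * I : ℂ) / riemannZeta (a + y * I)

/-- The conditions on the heights `T₁` and `T₂` under which the argument runs: both are good,
`T₁ ≍ T`, `T₂ ≪ T`, and the zeros of `ζ` above the height `T₁` are simple. -/
structure IsAdmissibleWindow (K : ℝ → ℝ) (T T₁ T₂ : ℝ) : Prop where
  two_le : 2 ≤ T
  three_le : 3 ≤ T₁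
  le_two_mul : T ≤ 2 * T₁
  le : T₁ ≤ T₂
  le_three_mul : T₂ ≤ 3 * T
  deriv_ne_zero : ∀ s, riemannZeta s = 0 → T₁ ≤ s.im → deriv riemannZeta s ≠ 0
  isGoodHeight_left : IsGoodHeight K T₁
  isGoodHeight_right : IsGoodHeight K T₂

theorem rpow_le_rpow_add_rpow {r a b x : ℝ} (hr : 0 < r) (hx : x ∈ Icc a b) :
    r ^ x ≤ r ^ a + r ^ b := by
  rcases le_total 1 r with h | h
  · exact (Real.rpow_le_rpow_of_exponent_le h hx.2).trans
      (le_add_of_nonneg_left (Real.rpow_nonneg hr.le _))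
  · exact (Real.rpow_le_rpow_of_exponent_ge hr h hx.1).trans
      (le_add_of_nonneg_right (Real.rpow_nonneg hr.le _))

theorem norm_ofReal_cpow_add_mul_I {r : ℝ} (hr : 0 < r) (x y : ℝ) :
    ‖(r : ℂ) ^ (x + y * I : ℂ)‖ = r ^ x := by
  rw [norm_cpow_eq_rpow_re_of_pos hr]
  simp

namespace IsGoodHeight

variable {K : ℝ → ℝ} {t δ : ℝ}

theorem riemannZeta_half_ne_zero (h : IsGoodHeight K t) : riemannZeta (1 / 2 + t * I) ≠ 0 := by
  have := (h (1 / 2) (by norm_num) (by norm_num)).1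
  rwa [ofReal_div, ofReal_one, ofReal_ofNat] at this

theorem norm_integral_horizontal_le {a b r : ℝ} (h : IsGoodHeight K t) (hab : a ≤ b)
    (ha : -1 ≤ a) (hb : b ≤ 2) (hδ : 0 < δ) (hr : 0 < r) :
    ‖∫ x in a..b, (r : ℂ) ^ (x + t * I : ℂ) / riemannZeta (x + t * I)‖ ≤
      (r ^ a + r ^ b) * (K δ * t ^ δ) * (b - a) := by
  rw [← abs_of_nonneg (sub_nonneg.2 hab)]
  refine intervalIntegral.norm_integral_le_of_norm_le_const fun x hx => ?_
  rw [uIoc_of_le hab] at hx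
  rw [div_eq_mul_inv, norm_mul, norm_ofReal_cpow_add_mul_I hr]
  exact mul_le_mul (rpow_le_rpow_add_rpow hr (Ioc_subset_Icc_self hx))
    ((h x (by linarith [hx.1]) (by linarith [hx.2])).2 δ hδ) (norm_nonneg _) (by positivity)

theorem mul_rpow_le {T : ℝ} (hδ : 0 < δ) (hδ1 : δ ≤ 1) (ht : 0 ≤ t) (htT : t ≤ 3 * T) :
    K δ * t ^ δ ≤ 3 * |K δ| * T ^ δ := by
  have hrpow : t ^ δ ≤ 3 * T ^ δ :=
    calc t ^ δ ≤ (3 * T) ^ δ := by gcongr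
      _ = 3 ^ δ * T ^ δ := Real.mul_rpow (by norm_num) (by linarith)
      _ ≤ 3 * T ^ δ :=
        mul_le_mul_of_nonneg_right (Real.rpow_le_self_of_one_le (by norm_num) hδ1)
          (Real.rpow_nonneg (by linarith) _)
  calc K δ * t ^ δ ≤ |K δ| * (3 * T ^ δ) := by
        gcongr
        exact le_abs_self _
    _ = 3 * |K δ| * T ^ δ := by ring

end IsGoodHeight

theorem two_pi_mul_zetaZeroSum_sub (hRH : RiemannHypothesis) {K : ℝ → ℝ} {a b T T₁ T₂ r : ℝ}
    (ha : a < 1 / 2) (hb : 1 / 2 < b) (hr : 0 < r) (hW : IsAdmissibleWindow K T T₁ T₂) :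
    2 * Real.pi * zetaZeroSum T₁ T₂ r -
        (verticalIntegral T₁ T₂ b r - verticalIntegral T₁ T₂ a r) =
      -I * ((∫ x in a..b, (r : ℂ) ^ (x + T₁ * I : ℂ) / riemannZeta (x + T₁ * I)) -
        ∫ x in a..b, (r : ℂ) ^ (x + T₂ * I : ℂ) / riemannZeta (x + T₂ * I)) := by
  have hdiff : Differentiable ℂ fun s : ℂ => (r : ℂ) ^ s := fun s =>
    differentiableAt_id.const_cpow (Or.inl (ofReal_ne_zero.2 hr.ne'))
  have hres := rectBoundaryIntegral_div_riemannZeta hRH hdiff ha hb (by linarith [hW.three_le])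
    hW.le hW.deriv_ne_zero hW.isGoodHeight_left.riemannZeta_half_ne_zero
    hW.isGoodHeight_right.riemannZeta_half_ne_zero
  unfold rectBoundaryIntegral at hres
  unfold zetaZeroSum verticalIntegral
  set S := ∑ ρ ∈ (zetaZerosBetween_finite T₁ T₂).toFinset, (deriv riemannZeta ρ)⁻¹ * (r : ℂ) ^ ρ
  set A₁ := ∫ x in a..b, (r : ℂ) ^ (x + T₁ * I : ℂ) / riemannZeta (x + T₁ * I)
  set A₂ := ∫ x in a..b, (r : ℂ) ^ (x + T₂ * I : ℂ) / riemannZeta (x + T₂ * I)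
  set V₁ := ∫ y in T₁..T₂, (r : ℂ) ^ (a + y * I : ℂ) / riemannZeta (a + y * I)
  set V₂ := ∫ y in T₁..T₂, (r : ℂ) ^ (b + y * I : ℂ) / riemannZeta (b + y * I)
  linear_combination I * hres + (2 * Real.pi * S - V₂ + V₁) * I_sq

theorem norm_two_pi_mul_zetaZeroSum_sub_le (hRH : RiemannHypothesis) {K : ℝ → ℝ}
    {a b T T₁ T₂ δ r : ℝ} (ha : -1 ≤ a) (ha' : a < 1 / 2) (hb' : 1 / 2 < b) (hb : b ≤ 2)
    (hδ : 0 < δ) (hδ1 : δ ≤ 1) (hr : 0 < r) (hW : IsAdmissibleWindow K T T₁ T₂) :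
    ‖2 * Real.pi * zetaZeroSum T₁ T₂ r -
        (verticalIntegral T₁ T₂ b r - verticalIntegral T₁ T₂ a r)‖ ≤
      18 * |K δ| * T ^ δ * (r ^ a + r ^ b) := by
  have hside {t : ℝ} (ht : IsGoodHeight K t) (ht0 : 0 ≤ t) (htT : t ≤ 3 * T) :
      ‖∫ x in a..b, (r : ℂ) ^ (x + t * I : ℂ) / riemannZeta (x + t * I)‖ ≤
        9 * |K δ| * T ^ δ * (r ^ a + r ^ b) := by
    have hT : 0 ≤ T := by linarith
    calc _ ≤ (r ^ a + r ^ b) * (K δ * t ^ δ) * (b - a) :=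
          ht.norm_integral_horizontal_le (by linarith) ha hb hδ hr
      _ ≤ (r ^ a + r ^ b) * (3 * |K δ| * T ^ δ) * 3 :=
          mul_le_mul (mul_le_mul_of_nonneg_left (IsGoodHeight.mul_rpow_le hδ hδ1 ht0 htT)
            (by positivity)) (by linarith) (by linarith) (by positivity)
      _ = 9 * |K δ| * T ^ δ * (r ^ a + r ^ b) := by ring
  rw [two_pi_mul_zetaZeroSum_sub hRH ha' hb' hr hW, norm_mul, norm_neg, norm_I, one_mul]
  have h₁ := hW.three_le
  have h₂ := hW.le
  have h₃ := hW.le_three_mul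
  refine (norm_sub_le_of_le (hside hW.isGoodHeight_left (by linarith) (by linarith))
    (hside hW.isGoodHeight_right (by linarith) h₃)).trans_eq (by ring)

theorem norm_verticalIntegral_le {a r T₁ T₂ D : ℝ} (hr : 0 < r) (hT : T₁ ≤ T₂)
    (hD : ∀ t, T₁ ≤ t → t ≤ T₂ → ‖(riemannZeta (a + t * I))⁻¹‖ ≤ D) :
    ‖verticalIntegral T₁ T₂ a r‖ ≤ r ^ a * D * (T₂ - T₁) := by
  rw [← abs_of_nonneg (sub_nonneg.2 hT)]
  refine intervalIntegral.norm_integral_le_of_norm_le_const fun y hy => ?_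
  rw [uIoc_of_le hT] at hy
  rw [div_eq_mul_inv, norm_mul, norm_ofReal_cpow_add_mul_I hr]
  gcongr
  exact hD y hy.1.le hy.2

theorem rpow_quarter_add_rpow_three_quarters_le {r : ℝ} (hr : 0 < r) :
    r ^ (1 / 4 : ℝ) + r ^ (3 / 4 : ℝ) ≤ 2 * (1 + r) := by
  have h₁ := rpow_le_rpow_add_rpow hr (a := 0) (b := 1) (x := 1 / 4) (by norm_num)
  have h₃ := rpow_le_rpow_add_rpow hr (a := 0) (b := 1) (x := 3 / 4) (by norm_num)
  rw [Real.rpow_zero, Real.rpow_one] at h₁ h₃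
  linarith

theorem rpow_quarter_add_rpow_three_quarters_mul_le {T B r : ℝ} (hT : 1 ≤ T) (hB : 0 ≤ B)
    (hr : 0 < r) (hfar : T ^ (4 * B) ≤ r ∨ r ≤ T ^ (-(4 * B))) :
    (r ^ (1 / 4 : ℝ) + r ^ (3 / 4 : ℝ)) * T ^ B ≤ 2 * (1 + r) := by
  have hT0 : 0 < T := by linarith
  rcases hfar with hlarge | hsmall
  · have hr1 : 1 ≤ r := (Real.one_le_rpow hT (by positivity)).trans hlarge
    have hTr : T ^ B ≤ r ^ (1 / 4 : ℝ) :=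
      calc T ^ B = (T ^ (4 * B)) ^ (1 / 4 : ℝ) := by
            rw [← Real.rpow_mul hT0.le]
            ring_nf
        _ ≤ r ^ (1 / 4 : ℝ) := by gcongr
    have hle : r ^ (1 / 4 : ℝ) ≤ r ^ (3 / 4 : ℝ) :=
      Real.rpow_le_rpow_of_exponent_le hr1 (by norm_num)
    calc _ ≤ 2 * r ^ (3 / 4 : ℝ) * r ^ (1 / 4 : ℝ) := by
          gcongr
          linarith
      _ = 2 * r := by
          rw [mul_assoc, ← Real.rpow_add hr]
          norm_num
      _ ≤ 2 * (1 + r) := by linarith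
  · have hr1 : r ≤ 1 := hsmall.trans (Real.rpow_le_one_of_one_le_of_nonpos hT (by linarith))
    have hrT : r ^ (1 / 4 : ℝ) ≤ T ^ (-B) :=
      calc r ^ (1 / 4 : ℝ) ≤ (T ^ (-(4 * B))) ^ (1 / 4 : ℝ) := by gcongr
        _ = T ^ (-B) := by
            rw [← Real.rpow_mul hT0.le]
            ring_nf
    have hle : r ^ (3 / 4 : ℝ) ≤ r ^ (1 / 4 : ℝ) :=
      Real.rpow_le_rpow_of_exponent_ge hr hr1 (by norm_num)
    calc _ ≤ 2 * T ^ (-B) * T ^ B := by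
          gcongr
          linarith
      _ = 2 := by rw [mul_assoc, ← Real.rpow_add hT0, neg_add_cancel, Real.rpow_zero, mul_one]
      _ ≤ 2 * (1 + r) := by linarith

theorem norm_verticalIntegral_quarter_add_three_quarters_le {K : ℝ → ℝ} {C A T T₁ T₂ r : ℝ}
    (hC : 0 < C) (hA : 0 ≤ A)
    (hζ : ∀ t : ℝ, 3 ≤ t → ‖(riemannZeta ((3 / 4 : ℝ) + t * I))⁻¹‖ ≤ C * t ^ A ∧
      ‖(riemannZeta ((1 / 4 : ℝ) + t * I))⁻¹‖ ≤ C * t ^ A)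
    (hW : IsAdmissibleWindow K T T₁ T₂) (hr : 0 < r)
    (hfar : T ^ (4 * (A + 1)) ≤ r ∨ r ≤ T ^ (-(4 * (A + 1)))) :
    ‖verticalIntegral T₁ T₂ (3 / 4) r‖ + ‖verticalIntegral T₁ T₂ (1 / 4) r‖ ≤
      6 * C * 3 ^ A * (1 + r) := by
  obtain ⟨hT, h₁, -, h₁₂, h₂, -⟩ := hW
  have hT0 : 0 < T := by linarith
  have hD {t : ℝ} (ht : T₁ ≤ t) (ht' : t ≤ T₂) : C * t ^ A ≤ C * (3 ^ A * T ^ A) := by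
    rw [← Real.mul_rpow (by norm_num) hT0.le]
    exact mul_le_mul_of_nonneg_left
      (Real.rpow_le_rpow (by linarith) (ht'.trans h₂) hA) hC.le
  have hright := norm_verticalIntegral_le (a := 3 / 4) hr h₁₂
    fun t ht ht' => (hζ t (h₁.trans ht)).1.trans (hD ht ht')
  have hleft := norm_verticalIntegral_le (a := 1 / 4) hr h₁₂
    fun t ht ht' => (hζ t (h₁.trans ht)).2.trans (hD ht ht')
  calc _ ≤ (r ^ (1 / 4 : ℝ) + r ^ (3 / 4 : ℝ)) * (C * (3 ^ A * T ^ A)) * (T₂ - T₁) := by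
        linarith
    _ ≤ (r ^ (1 / 4 : ℝ) + r ^ (3 / 4 : ℝ)) * (C * (3 ^ A * T ^ A)) * (3 * T) := by
        gcongr
        linarith
    _ = 3 * C * 3 ^ A * ((r ^ (1 / 4 : ℝ) + r ^ (3 / 4 : ℝ)) * T ^ (A + 1)) := by
        rw [Real.rpow_add_one hT0.ne']
        ring
    _ ≤ 3 * C * 3 ^ A * (2 * (1 + r)) :=
        mul_le_mul_of_nonneg_left (rpow_quarter_add_rpow_three_quarters_mul_le (by linarith)
          (by linarith) hr hfar) (by positivity)
    _ = 6 * C * 3 ^ A * (1 + r) := by ring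

theorem exists_norm_zetaZeroSum_le (hRH : RiemannHypothesis) (K : ℝ → ℝ) :
    ∃ E : ℝ, 0 ≤ E ∧ ∀ δ : ℝ, 0 < δ → δ ≤ 1 → ∃ C : ℝ, 0 < C ∧ ∀ T T₁ T₂ r : ℝ,
      IsAdmissibleWindow K T T₁ T₂ → 0 < r → T ^ E ≤ r ∨ r ≤ T ^ (-E) →
        ‖zetaZeroSum T₁ T₂ r‖ ≤ C * T ^ δ * (1 + r) := by
  obtain ⟨C, A, hC, hA, hζ⟩ := exists_norm_inv_riemannZeta_le_rpow_and_one_sub hRH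
    (σ := 3 / 4) (by norm_num) (by norm_num)
  norm_num only at hζ
  refine ⟨4 * (A + 1), by positivity, fun δ hδ hδ1 =>
    ⟨6 * C * 3 ^ A + 36 * |K δ|, by positivity, fun T T₁ T₂ r hW hr hfar => ?_⟩⟩
  have hT : 1 ≤ T := by linarith [hW.two_le]
  have hsides := norm_verticalIntegral_quarter_add_three_quarters_le hC hA hζ hW hr hfar
  have hrect := norm_two_pi_mul_zetaZeroSum_sub_le hRH (a := 1 / 4) (b := 3 / 4) (by norm_num)
    (by norm_num) (by norm_num) (by norm_num) hδ hδ1 hr hW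
  have hpi : (1 : ℝ) ≤ ‖(2 * Real.pi : ℂ)‖ := by
    rw [norm_mul, Complex.norm_real, Real.norm_of_nonneg Real.pi_pos.le, norm_ofNat]
    linarith [Real.pi_gt_three]
  calc ‖zetaZeroSum T₁ T₂ r‖ ≤ ‖2 * Real.pi * zetaZeroSum T₁ T₂ r‖ := by
        rw [norm_mul]
        exact le_mul_of_one_le_left (norm_nonneg _) hpi
    _ ≤ 18 * |K δ| * T ^ δ * (r ^ (1 / 4 : ℝ) + r ^ (3 / 4 : ℝ)) + 6 * C * 3 ^ A * (1 + r) :=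
        (norm_le_norm_sub_add _ _).trans
          (add_le_add hrect ((norm_sub_le _ _).trans hsides))
    _ ≤ 18 * |K δ| * T ^ δ * (2 * (1 + r)) + 6 * C * 3 ^ A * T ^ δ * (1 + r) :=
        add_le_add
          (mul_le_mul_of_nonneg_left (rpow_quarter_add_rpow_three_quarters_le hr) (by positivity))
          (mul_le_mul_of_nonneg_right
            (le_mul_of_one_le_right (by positivity) (Real.one_le_rpow hT hδ.le)) (by positivity))
    _ = (6 * C * 3 ^ A + 36 * |K δ|) * T ^ δ * (1 + r) := by ring

/-! ### The line to the right of the critical strip -/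

theorem ofReal_cpow_add_mul_I {u : ℝ} (hu : 0 < u) (c y : ℝ) :
    (u : ℂ) ^ (c + y * I : ℂ) = (u ^ c : ℝ) * exp (Real.log u * I * y) := by
  have hu' : (u : ℂ) ≠ 0 := ofReal_ne_zero.2 hu.ne'
  rw [cpow_add _ _ hu', ← ofReal_cpow hu.le, cpow_def_of_ne_zero hu', ← ofReal_log hu.le,
    mul_right_comm, ← mul_assoc]

theorem norm_integral_cpow_le {u : ℝ} (hu : 0 < u) (c : ℝ) {T₁ T₂ : ℝ} (hT : T₁ ≤ T₂) :
    ‖∫ y in T₁..T₂, (u : ℂ) ^ (c + y * I : ℂ)‖ ≤ u ^ c * (T₂ - T₁) := by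
  rw [← abs_of_nonneg (sub_nonneg.2 hT)]
  exact intervalIntegral.norm_integral_le_of_norm_le_const fun y _ =>
    (norm_ofReal_cpow_add_mul_I hu c y).le

theorem norm_integral_cpow_le_div_log {u : ℝ} (hu : 0 < u) (hu1 : u ≠ 1) (c T₁ T₂ : ℝ) :
    ‖∫ y in T₁..T₂, (u : ℂ) ^ (c + y * I : ℂ)‖ ≤ u ^ c * (2 / |Real.log u|) := by
  have hlog : (Real.log u * I : ℂ) ≠ 0 :=
    mul_ne_zero (ofReal_ne_zero.2 (Real.log_ne_zero_of_pos_of_ne_one hu hu1)) I_ne_zero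
  have hexp (y : ℝ) : ‖exp (Real.log u * I * y)‖ = 1 := by
    rw [mul_right_comm, ← ofReal_mul, norm_exp_ofReal_mul_I]
  simp only [ofReal_cpow_add_mul_I hu]
  rw [intervalIntegral.integral_const_mul, integral_exp_mul_complex hlog, norm_mul, norm_div,
    Complex.norm_real, Real.norm_of_nonneg (Real.rpow_nonneg hu.le _), norm_mul, norm_I, mul_one,
    Complex.norm_real, Real.norm_eq_abs]
  gcongr
  refine (norm_sub_le _ _).trans_eq ?_
  rw [hexp, hexp, one_add_one_eq_two]

theorem abs_sub_div_le_abs_log_div {k v : ℝ} (hk : 0 < k) (hv : 0 < v) (hvk : v ≤ 2 * k) :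
    |k - v| / (2 * k) ≤ |Real.log (k / v)| := by
  rw [div_le_iff₀ (by positivity)]
  rcases le_total v k with h | h
  · have hlog := Real.one_sub_inv_le_log_of_pos (div_pos hk hv)
    rw [inv_div] at hlog
    calc |k - v| = (1 - v / k) * k := by
          rw [abs_of_nonneg (by linarith)]
          field_simp
      _ ≤ |Real.log (k / v)| * (2 * k) := by
          gcongr
          · exact hlog.trans (le_abs_self _)
          · linarith
  · have hlog := Real.one_sub_inv_le_log_of_pos (div_pos hv hk)
    rw [inv_div, ← inv_div k v, Real.log_inv] at hlog
    calc |k - v| = (1 - k / v) * v := by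
          rw [abs_of_nonpos (by linarith)]
          field_simp
          ring
      _ ≤ |Real.log (k / v)| * (2 * k) := by
          gcongr
          exact hlog.trans (neg_le_abs _)

theorem half_le_abs_log_of_two_le {u : ℝ} (h : 2 ≤ u ∨ 2 ≤ u⁻¹) :
    1 / 2 ≤ |Real.log u| := by
  have htwo : (1 / 2 : ℝ) ≤ Real.log 2 := by linarith [Real.log_two_gt_d9]
  rcases h with h | h
  · exact htwo.trans ((Real.log_le_log two_pos h).trans (le_abs_self _))
  · exact htwo.trans ((Real.log_le_log two_pos h).trans ((Real.log_inv u).trans_le (neg_le_abs _)))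

theorem norm_integral_div_cpow_le_four_mul {k v : ℝ} (hk : 0 < k) (hv : 0 < v)
    (h : 2 * v ≤ k ∨ 2 * k ≤ v) (c T₁ T₂ : ℝ) :
    ‖∫ y in T₁..T₂, ((k / v : ℝ) : ℂ) ^ (c + y * I : ℂ)‖ ≤ 4 * (k / v) ^ c := by
  have hlog : 1 / 2 ≤ |Real.log (k / v)| := by
    refine half_le_abs_log_of_two_le ?_
    rwa [inv_div, le_div_iff₀ hv, le_div_iff₀ hk]
  have hne : k / v ≠ 1 := fun h0 => by norm_num [h0] at hlog
  refine (norm_integral_cpow_le_div_log (div_pos hk hv) hne c T₁ T₂).trans ?_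
  rw [mul_comm (4 : ℝ)]
  gcongr
  rw [div_le_iff₀ (by linarith)]
  linarith

theorem le_rpow_mul_rpow_one_sub {N a b δ : ℝ} (hN : 0 ≤ N) (ha : N ≤ a) (hb : N ≤ b)
    (hδ : 0 ≤ δ) (hδ1 : δ ≤ 1) : N ≤ a ^ δ * b ^ (1 - δ) :=
  calc N = N ^ δ * N ^ (1 - δ) := by
        rw [← Real.rpow_add_of_nonneg hN hδ (by linarith), add_sub_cancel, Real.rpow_one]
    _ ≤ a ^ δ * b ^ (1 - δ) := by
        have : 0 ≤ a := hN.trans ha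
        have : 0 ≤ 1 - δ := by linarith
        gcongr

theorem norm_integral_div_cpow_le_rpow {k v T δ : ℝ} (hk : 0 < k) (hv : 0 < v) (hkv : k < 2 * v)
    (hvk : v < 2 * k) (hne : k ≠ v) (hδ : 0 ≤ δ) (hδ1 : δ ≤ 1) {T₁ T₂ : ℝ} (hT : T₁ ≤ T₂)
    (hT3 : T₂ - T₁ ≤ 3 * T) :
    ‖∫ y in T₁..T₂, ((k / v : ℝ) : ℂ) ^ ((1 + δ : ℝ) + y * I : ℂ)‖ ≤
      16 * (T ^ δ * (k / |k - v|) ^ (1 - δ)) := by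
  have hu : 0 < k / v := div_pos hk hv
  have hpow : (k / v) ^ (1 + δ) ≤ 4 :=
    calc (k / v) ^ (1 + δ) ≤ 2 ^ (1 + δ) := by
          gcongr
          exact ((div_lt_iff₀ hv).2 hkv).le
      _ ≤ 2 ^ (2 : ℝ) := Real.rpow_le_rpow_of_exponent_le one_le_two (by linarith)
      _ = 4 := by norm_num
  set N := ‖∫ y in T₁..T₂, ((k / v : ℝ) : ℂ) ^ ((1 + δ : ℝ) + y * I : ℂ)‖
  have htrivial : N ≤ 16 * T :=
    calc N ≤ (k / v) ^ (1 + δ) * (T₂ - T₁) := norm_integral_cpow_le hu (1 + δ) hT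
      _ ≤ 4 * (3 * T) := mul_le_mul hpow hT3 (sub_nonneg.2 hT) (by norm_num)
      _ ≤ 16 * T := by linarith
  have hosc : N ≤ 16 * (k / |k - v|) :=
    calc N ≤ (k / v) ^ (1 + δ) * (2 / |Real.log (k / v)|) :=
          norm_integral_cpow_le_div_log hu (by rwa [Ne, div_eq_one_iff_eq hv.ne']) (1 + δ) T₁ T₂
      _ ≤ 4 * (2 / (|k - v| / (2 * k))) := by
          have : 0 < |k - v| := abs_pos.2 (sub_ne_zero.2 hne)
          gcongr
          exact abs_sub_div_le_abs_log_div hk hv hvk.le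
      _ = 16 * (k / |k - v|) := by
          field_simp
          norm_num
  calc N ≤ (16 * T) ^ δ * (16 * (k / |k - v|)) ^ (1 - δ) :=
        le_rpow_mul_rpow_one_sub (norm_nonneg _) htrivial hosc hδ hδ1
    _ = 16 ^ δ * 16 ^ (1 - δ) * (T ^ δ * (k / |k - v|) ^ (1 - δ)) := by
        rw [Real.mul_rpow (by norm_num) (by linarith), Real.mul_rpow (by norm_num) (by positivity)]
        ring
    _ = 16 * (T ^ δ * (k / |k - v|) ^ (1 - δ)) := by
        rw [← Real.rpow_add (by norm_num), add_sub_cancel, Real.rpow_one]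

theorem norm_moebius_le_one (n : ℕ) : ‖(ArithmeticFunction.moebius n : ℂ)‖ ≤ 1 := by
  rw [Complex.norm_intCast]
  exact_mod_cast ArithmeticFunction.abs_moebius_le_one

theorem hasSum_moebius_mul_cpow {r : ℝ} (hr : 0 ≤ r) {s : ℂ} (hs : 1 < s.re) :
    HasSum (fun n : ℕ => (ArithmeticFunction.moebius n : ℂ) * ((r / n : ℝ) : ℂ) ^ s)
      ((r : ℂ) ^ s / riemannZeta s) := by
  have hinv := ArithmeticFunction.LSeries_zeta_mul_Lseries_moebius hs
  rw [ArithmeticFunction.LSeries_zeta_eq_riemannZeta hs] at hinv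
  have hsum := (ArithmeticFunction.LSeriesSummable_moebius_iff.2 hs).LSeriesHasSum.mul_left
    ((r : ℂ) ^ s)
  rw [eq_inv_of_mul_eq_one_right hinv, ← div_eq_mul_inv] at hsum
  refine hsum.congr_fun fun n => ?_
  rcases eq_or_ne n 0 with rfl | hn
  · simp
  · have hdiv := div_cpow_ofReal_nonneg hr n.cast_nonneg s
    rw [LSeries.term_of_ne_zero hn, ofReal_div, hdiv, ofReal_natCast]
    ring

theorem hasSum_integral_moebius_mul_cpow {r c : ℝ} (hr : 0 < r) (hc : 1 < c) (T₁ T₂ : ℝ) :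
    HasSum (fun n : ℕ => (ArithmeticFunction.moebius n : ℂ) *
      ∫ y in T₁..T₂, ((r / n : ℝ) : ℂ) ^ (c + y * I : ℂ)) (verticalIntegral T₁ T₂ c r) := by
  have hsummable : Summable fun n : ℕ => r ^ c * (n : ℝ) ^ (-c) :=
    (Real.summable_nat_rpow.2 (by linarith)).mul_left _
  simp only [← intervalIntegral.integral_const_mul]
  refine intervalIntegral.hasSum_integral_of_dominated_convergence
    (fun n _ => r ^ c * (n : ℝ) ^ (-c)) (fun n => ?_) (fun n => ?_)
    (Eventually.of_forall fun y _ => hsummable) intervalIntegrable_const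
    (Eventually.of_forall fun y _ => hasSum_moebius_mul_cpow hr.le (by simpa))
  · rcases n.eq_zero_or_pos with rfl | hn
    · simp only [ArithmeticFunction.map_zero, Int.cast_zero, zero_mul]
      exact aestronglyMeasurable_const
    · simp only [ofReal_cpow_add_mul_I (div_pos hr (Nat.cast_pos.2 hn))]
      exact Continuous.aestronglyMeasurable (by fun_prop)
  · refine Eventually.of_forall fun y _ => ?_
    rcases n.eq_zero_or_pos with rfl | hn
    · simp only [ArithmeticFunction.map_zero, Int.cast_zero, zero_mul, norm_zero]
      positivity
    · have hn' : (0 : ℝ) < n := Nat.cast_pos.2 hn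
      rw [norm_mul, norm_ofReal_cpow_add_mul_I (div_pos hr hn'), Real.div_rpow hr.le hn'.le,
        Real.rpow_neg hn'.le, ← div_eq_mul_inv]
      exact mul_le_of_le_one_left (by positivity) (norm_moebius_le_one n)

/-- The coefficient `μ(k / h)` of the diagonal contribution of the pair `(h, k)`; it vanishes
unless `h ∣ k`. -/
noncomputable def diagonalCoeff (h k : ℕ) : ℝ :=
  if h ∣ k then (ArithmeticFunction.moebius (k / h) : ℝ) else 0

/-- The integers `n` for which `n * h` is close to, but different from, `k`. -/
def nearMultiples (h k : ℕ) : Finset ℕ :=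
  {n ∈ Finset.Icc 1 (2 * k) | n * h ≠ k ∧ n * h < 2 * k}

/-- The sum controlling the oscillatory terms `n * h ≠ k` on the line `σ = 1 + δ`. -/
noncomputable def offDiagonalSum (δ : ℝ) (h k : ℕ) : ℝ :=
  ∑ n ∈ nearMultiples h k, ((k : ℝ) / |(k : ℝ) - (n * h : ℕ)|) ^ (1 - δ)

theorem hasSum_diagonalCoeff {h : ℕ} (hh : 0 < h) (k : ℕ) :
    HasSum (fun n : ℕ => if n * h = k then (ArithmeticFunction.moebius n : ℝ) else 0)
      (diagonalCoeff h k) := by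
  by_cases hdvd : h ∣ k
  · have hsingle := hasSum_single
      (f := fun n : ℕ => if n * h = k then (ArithmeticFunction.moebius n : ℝ) else 0) (k / h)
      fun n hn => if_neg fun hnk => hn (by rw [← hnk, Nat.mul_div_cancel _ hh])
    rw [if_pos (Nat.div_mul_cancel hdvd)] at hsingle
    rwa [diagonalCoeff, if_pos hdvd]
  · rw [diagonalCoeff, if_neg hdvd]
    exact hasSum_zero.congr_fun fun n => if_neg fun hnk => hdvd ⟨n, by rw [← hnk, mul_comm]⟩

theorem norm_integral_div_cpow_sub_le {δ T T₁ T₂ : ℝ} (hδ : 0 ≤ δ) (hδ1 : δ ≤ 1) (hT : T₁ ≤ T₂)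
    (hT3 : T₂ - T₁ ≤ 3 * T) {h k n : ℕ} (hh : 0 < h) (hk : 0 < k) (hn : 0 < n) :
    ‖(∫ y in T₁..T₂, ((k / h / n : ℝ) : ℂ) ^ ((1 + δ : ℝ) + y * I : ℂ)) -
        (if n * h = k then T₂ - T₁ else 0 : ℝ)‖ ≤
      4 * ((k : ℝ) / h) ^ (1 + δ) * (n : ℝ) ^ (-(1 + δ)) +
        if n ∈ nearMultiples h k then
          16 * T ^ δ * ((k : ℝ) / |(k : ℝ) - (n * h : ℕ)|) ^ (1 - δ) else 0 := by
  have hk' : (0 : ℝ) < k := Nat.cast_pos.2 hk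
  have hv : (0 : ℝ) < (n * h : ℕ) := Nat.cast_pos.2 (Nat.mul_pos hn hh)
  have hdiv : (k : ℝ) / h / n = k / (n * h : ℕ) := by rw [div_div, mul_comm, Nat.cast_mul]
  have hT0 : 0 ≤ T := by linarith
  have hfar_nonneg : 0 ≤ 4 * ((k : ℝ) / h) ^ (1 + δ) * (n : ℝ) ^ (-(1 + δ)) := by positivity
  have hnear_nonneg : (0 : ℝ) ≤ if n ∈ nearMultiples h k then
      16 * T ^ δ * ((k : ℝ) / |(k : ℝ) - (n * h : ℕ)|) ^ (1 - δ) else 0 := by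
    split_ifs <;> positivity
  rw [hdiv]
  by_cases hnk : n * h = k
  · refine le_of_eq_of_le ?_ (add_nonneg hfar_nonneg hnear_nonneg)
    rw [if_pos hnk, hnk, div_self hk'.ne']
    simp only [ofReal_one, one_cpow, intervalIntegral.integral_const, real_smul, mul_one,
      sub_self, norm_zero]
  rw [if_neg hnk, ofReal_zero, sub_zero]
  by_cases hfar : 2 * ((n * h : ℕ) : ℝ) ≤ k ∨ 2 * (k : ℝ) ≤ (n * h : ℕ)
  · refine (norm_integral_div_cpow_le_four_mul hk' hv hfar (1 + δ) T₁ T₂).trans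
      (le_add_of_le_of_nonneg (le_of_eq ?_) hnear_nonneg)
    rw [← hdiv, Real.div_rpow (by positivity) n.cast_nonneg, Real.rpow_neg n.cast_nonneg, mul_assoc,
      div_eq_mul_inv]
  · push Not at hfar
    have hlt : n * h < 2 * k := by exact_mod_cast hfar.2
    have hmem : n ∈ nearMultiples h k := by
      rw [nearMultiples, Finset.mem_filter, Finset.mem_Icc]
      exact ⟨⟨hn, (Nat.le_mul_of_pos_right n hh).trans hlt.le⟩, hnk, hlt⟩
    rw [if_pos hmem, mul_assoc (16 : ℝ)]
    exact le_add_of_nonneg_of_le hfar_nonneg (norm_integral_div_cpow_le_rpow hk' hv hfar.1 hfar.2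
      (by exact_mod_cast Ne.symm hnk) hδ hδ1 hT hT3)

theorem norm_verticalIntegral_sub_le {δ T T₁ T₂ : ℝ} (hδ : 0 < δ) (hδ1 : δ ≤ 1) (hT : T₁ ≤ T₂)
    (hT3 : T₂ - T₁ ≤ 3 * T) {h k : ℕ} (hh : 0 < h) (hk : 0 < k) :
    ‖verticalIntegral T₁ T₂ (1 + δ) ((k : ℝ) / h) - ((T₂ - T₁) * diagonalCoeff h k : ℝ)‖ ≤
      4 * ((k : ℝ) / h) ^ (1 + δ) * (∑' n : ℕ, (n : ℝ) ^ (-(1 + δ))) +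
        16 * T ^ δ * offDiagonalSum δ h k := by
  have hr : (0 : ℝ) < (k : ℝ) / h := div_pos (Nat.cast_pos.2 hk) (Nat.cast_pos.2 hh)
  have hintegral := hasSum_integral_moebius_mul_cpow hr (c := 1 + δ) (by linarith) T₁ T₂
  have hdiagonal := hasSum_ofReal.2 ((hasSum_diagonalCoeff hh k).mul_left (T₂ - T₁))
  have hfar := (Real.summable_nat_rpow (p := -(1 + δ)).2 (by linarith)).hasSum.mul_left
    (4 * ((k : ℝ) / h) ^ (1 + δ))
  have hnear : HasSum (fun n : ℕ => if n ∈ nearMultiples h k then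
      16 * T ^ δ * ((k : ℝ) / |(k : ℝ) - (n * h : ℕ)|) ^ (1 - δ) else 0)
      (16 * T ^ δ * offDiagonalSum δ h k) := by
    rw [offDiagonalSum, Finset.mul_sum, ← Finset.inter_self (nearMultiples h k),
      ← Finset.sum_ite_mem, Finset.inter_self]
    exact hasSum_sum_of_ne_finset_zero fun n hn => if_neg hn
  rw [← (hintegral.sub hdiagonal).tsum_eq]
  refine tsum_of_norm_bounded (hfar.add hnear) fun n => ?_
  rcases n.eq_zero_or_pos with rfl | hn
  · have hmem : 0 ∉ nearMultiples h k := by simp [nearMultiples]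
    simp only [ArithmeticFunction.map_zero, Int.cast_zero, zero_mul, if_neg hk.ne, mul_zero,
      ofReal_zero, sub_self, norm_zero, if_neg hmem, add_zero]
    positivity
  refine le_trans (le_of_eq_of_le ?_ (mul_le_of_le_one_left (norm_nonneg _)
    (norm_moebius_le_one n))) (norm_integral_div_cpow_sub_le hδ.le hδ1 hT hT3 hh hk hn)
  rw [← norm_mul, mul_sub]
  congr 2
  split_ifs <;> push_cast <;> ring

/-! ### Sums over the distance to an integer -/

theorem rpow_one_sub_add_le {a : ℝ} (ha : 0 ≤ a) (ha1 : a ≤ 1) (N : ℕ) :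
    (N : ℝ) ^ (1 - a) + (1 - a) * ((N : ℝ) + 1) ^ (-a) ≤ ((N : ℝ) + 1) ^ (1 - a) := by
  have hN : (0 : ℝ) < (N : ℝ) + 1 := by positivity
  have hbernoulli := rpow_one_add_le_one_add_mul_self (s := -1 / ((N : ℝ) + 1)) (p := 1 - a)
    (by rw [le_div_iff₀ hN]; linarith [N.cast_nonneg (α := ℝ)]) (by linarith) (by linarith)
  have hratio : 1 + -1 / ((N : ℝ) + 1) = N / (N + 1) := by field_simp; ring
  have hpow : ((N : ℝ) + 1) ^ (1 - a) = ((N : ℝ) + 1) ^ (-a) * (N + 1) := by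
    rw [← Real.rpow_add_one hN.ne', neg_add_eq_sub]
  rw [hratio, Real.div_rpow N.cast_nonneg hN.le, div_le_iff₀ (by positivity)] at hbernoulli
  rw [← le_sub_iff_add_le]
  refine hbernoulli.trans_eq ?_
  rw [hpow]
  field_simp
  ring

theorem sum_Icc_rpow_neg_le {a : ℝ} (ha : 0 ≤ a) (ha1 : a < 1) (N : ℕ) :
    ∑ n ∈ Finset.Icc 1 N, (n : ℝ) ^ (-a) ≤ (N : ℝ) ^ (1 - a) / (1 - a) := by
  have h1a : 0 < 1 - a := by linarith
  induction N with
  | zero => simp [Real.zero_rpow h1a.ne']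
  | succ N ih =>
    rw [Finset.sum_Icc_succ_top (by omega), Nat.cast_add_one]
    calc ∑ n ∈ Finset.Icc 1 N, (n : ℝ) ^ (-a) + ((N : ℝ) + 1) ^ (-a)
        ≤ (N : ℝ) ^ (1 - a) / (1 - a) + ((N : ℝ) + 1) ^ (-a) := by gcongr
      _ ≤ ((N : ℝ) + 1) ^ (1 - a) / (1 - a) := by
          rw [div_add' _ _ _ h1a.ne']
          gcongr
          linarith [rpow_one_sub_add_le ha ha1.le N]

theorem abs_natCast_sub_natCast (m n : ℕ) :
    |(m : ℝ) - n| = ((((m : ℤ) - n).natAbs : ℕ) : ℝ) := by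
  rw [Nat.cast_natAbs]
  push_cast
  rfl

theorem sum_natAbs_sub_le {f : ℕ → ℝ} (hf : ∀ d, 0 ≤ f d) {S D : Finset ℕ} (v : ℕ)
    (hD : ∀ k ∈ S, ((k : ℤ) - v).natAbs ∈ D) :
    ∑ k ∈ S, f ((k : ℤ) - v).natAbs ≤ 2 * ∑ d ∈ D, f d := by
  have hside (S' : Finset ℕ) (hS' : S' ⊆ S)
      (hinj : Set.InjOn (fun k : ℕ => ((k : ℤ) - v).natAbs) S') :
      ∑ k ∈ S', f ((k : ℤ) - v).natAbs ≤ ∑ d ∈ D, f d := by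
    rw [← Finset.sum_image (f := f) hinj]
    exact Finset.sum_le_sum_of_subset_of_nonneg
      (Finset.image_subset_iff.2 fun k hk => hD k (hS' hk)) fun d _ _ => hf d
  rw [← Finset.sum_filter_add_sum_filter_not S (fun k => k ≤ v), two_mul]
  refine add_le_add (hside _ (Finset.filter_subset _ _) fun a ha b hb hab => ?_)
    (hside _ (Finset.filter_subset _ _) fun a ha b hb hab => ?_) <;>
  · have ha' := (Finset.mem_filter.1 ha).2
    have hb' := (Finset.mem_filter.1 hb).2
    dsimp only at hab
    omega

theorem sum_rpow_natAbs_sub_le {δ : ℝ} (hδ : 0 < δ) (hδ1 : δ ≤ 1) {N v : ℕ} (hv : v ≤ 2 * N) :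
    ∑ k ∈ Finset.Icc 1 N with v ≠ k, ((((k : ℤ) - v).natAbs : ℕ) : ℝ) ^ (-(1 - δ)) ≤
      2 * ((2 * N) ^ δ / δ) := by
  refine (sum_natAbs_sub_le (f := fun d : ℕ => (d : ℝ) ^ (-(1 - δ))) (fun d => by positivity)
    (D := Finset.Icc 1 (2 * N)) v fun k hk => ?_).trans ?_
  · rw [Finset.mem_filter, Finset.mem_Icc] at hk
    rw [Finset.mem_Icc]
    have := hk.2
    omega
  · have hsum := sum_Icc_rpow_neg_le (a := 1 - δ) (by linarith) (by linarith) (2 * N)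
    rw [sub_sub_cancel] at hsum
    push_cast at hsum
    gcongr

theorem div_rpow_one_sub_div_le {δ k d v : ℝ} (hδ : 0 ≤ δ) (hδ1 : δ ≤ 1) (hk : 0 < k) (hd : 0 < d)
    (hv : 0 < v) (hvk : v ≤ 2 * k) :
    (k / d) ^ (1 - δ) / k ≤ 2 * v ^ (-δ) * d ^ (-(1 - δ)) := by
  have hhalf : (1 / 2 : ℝ) ≤ 2 ^ (-δ) :=
    calc (1 / 2 : ℝ) = 2 ^ (-1 : ℝ) := by rw [Real.rpow_neg_one, one_div]
      _ ≤ 2 ^ (-δ) := Real.rpow_le_rpow_of_exponent_le one_le_two (by linarith)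
  have hpow : k ^ (-δ) ≤ 2 * v ^ (-δ) :=
    calc k ^ (-δ) = 2 * (1 / 2 * k ^ (-δ)) := by ring
      _ ≤ 2 * (2 ^ (-δ) * k ^ (-δ)) := by gcongr
      _ = 2 * (2 * k) ^ (-δ) := by rw [Real.mul_rpow two_pos.le hk.le]
      _ ≤ 2 * v ^ (-δ) :=
          mul_le_mul_of_nonneg_left (Real.rpow_le_rpow_of_nonpos hv hvk (by linarith)) two_pos.le
  calc (k / d) ^ (1 - δ) / k = k ^ (1 - δ - 1) * d ^ (-(1 - δ)) := by
        rw [Real.div_rpow hk.le hd.le, Real.rpow_neg hd.le, Real.rpow_sub_one hk.ne']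
        ring
    _ ≤ 2 * v ^ (-δ) * d ^ (-(1 - δ)) := by
        rw [sub_sub_cancel_left]
        gcongr

theorem offDiagonalSum_div_le {δ : ℝ} (hδ : 0 ≤ δ) (hδ1 : δ ≤ 1) {N h k : ℕ} (hh : 0 < h)
    (hk : 0 < k) (hkN : k ≤ N) :
    offDiagonalSum δ h k / k ≤ ∑ n ∈ Finset.Icc 1 (2 * N / h) with n * h ≠ k,
      2 * ((n * h : ℕ) : ℝ) ^ (-δ) * ((((k : ℤ) - (n * h : ℕ)).natAbs : ℕ) : ℝ) ^ (-(1 - δ)) := by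
  rw [offDiagonalSum, Finset.sum_div]
  have hsub : nearMultiples h k ⊆ {n ∈ Finset.Icc 1 (2 * N / h) | n * h ≠ k} := fun n hn => by
    rw [nearMultiples, Finset.mem_filter, Finset.mem_Icc] at hn
    rw [Finset.mem_filter, Finset.mem_Icc, Nat.le_div_iff_mul_le hh]
    exact ⟨⟨hn.1.1, by omega⟩, hn.2.1⟩
  refine (Finset.sum_le_sum fun n hn => ?_).trans
    (Finset.sum_le_sum_of_subset_of_nonneg hsub fun n _ _ => by positivity)
  rw [nearMultiples, Finset.mem_filter, Finset.mem_Icc] at hn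
  obtain ⟨⟨hn1, -⟩, hne, hlt⟩ := hn
  rw [abs_natCast_sub_natCast]
  refine div_rpow_one_sub_div_le hδ hδ1 (Nat.cast_pos.2 hk) ?_
    (Nat.cast_pos.2 (Nat.mul_pos hn1 hh)) (by exact_mod_cast hlt.le)
  exact Nat.cast_pos.2 (Int.natAbs_pos.2 (by omega))

theorem sum_Icc_mul_rpow_neg_le {δ : ℝ} (hδ : 0 ≤ δ) (hδ1 : δ < 1) (N h : ℕ) :
    ∑ n ∈ Finset.Icc 1 (2 * N / h), ((n * h : ℕ) : ℝ) ^ (-δ) ≤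
      (h : ℝ) ^ (-δ) * ((2 * N / h : ℝ) ^ (1 - δ) / (1 - δ)) := by
  have hfloor : ((2 * N / h : ℕ) : ℝ) ≤ 2 * N / h := by exact_mod_cast Nat.cast_div_le (α := ℝ)
  calc ∑ n ∈ Finset.Icc 1 (2 * N / h), ((n * h : ℕ) : ℝ) ^ (-δ)
      = (h : ℝ) ^ (-δ) * ∑ n ∈ Finset.Icc 1 (2 * N / h), (n : ℝ) ^ (-δ) := by
        rw [Finset.mul_sum]
        refine Finset.sum_congr rfl fun n _ => ?_
        rw [Nat.cast_mul, Real.mul_rpow n.cast_nonneg h.cast_nonneg, mul_comm]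
    _ ≤ (h : ℝ) ^ (-δ) * (((2 * N / h : ℕ) : ℝ) ^ (1 - δ) / (1 - δ)) := by
        gcongr
        exact sum_Icc_rpow_neg_le hδ hδ1 _
    _ ≤ (h : ℝ) ^ (-δ) * ((2 * N / h : ℝ) ^ (1 - δ) / (1 - δ)) := by
        have : 0 < 1 - δ := by linarith
        gcongr

theorem rpow_neg_mul_div_rpow_mul_rpow {a b δ : ℝ} (ha : 0 < a) (hb : 0 < b) :
    b ^ (-δ) * ((a / b) ^ (1 - δ) * a ^ δ) = a / b := by
  rw [Real.div_rpow ha.le hb.le, Real.rpow_neg hb.le]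
  calc (b ^ δ)⁻¹ * (a ^ (1 - δ) / b ^ (1 - δ) * a ^ δ)
      = a ^ (1 - δ) * a ^ δ / (b ^ (1 - δ) * b ^ δ) := by field_simp
    _ = a / b := by
        rw [← Real.rpow_add ha, ← Real.rpow_add hb, sub_add_cancel, Real.rpow_one, Real.rpow_one]

theorem sum_offDiagonalSum_div_le {δ : ℝ} (hδ : 0 < δ) (hδ1 : δ < 1) {N h : ℕ} (hh : 0 < h) :
    ∑ k ∈ Finset.Icc 1 N, offDiagonalSum δ h k / k ≤ 8 / (δ * (1 - δ)) * (N / h) := by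
  rcases N.eq_zero_or_pos with rfl | hN
  · simp
  have hfirst : ∑ k ∈ Finset.Icc 1 N, offDiagonalSum δ h k / k ≤
      ∑ n ∈ Finset.Icc 1 (2 * N / h), 2 * ((n * h : ℕ) : ℝ) ^ (-δ) * (2 * ((2 * N) ^ δ / δ)) := by
    refine (Finset.sum_le_sum fun k hk => offDiagonalSum_div_le hδ.le hδ1.le hh
      (Finset.mem_Icc.1 hk).1 (Finset.mem_Icc.1 hk).2).trans ?_
    rw [Finset.sum_comm' (t' := Finset.Icc 1 (2 * N / h))
      (s' := fun n => {k ∈ Finset.Icc 1 N | n * h ≠ k})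
      (by intro k n; simp only [Finset.mem_filter]; tauto)]
    refine Finset.sum_le_sum fun n hn => ?_
    rw [Finset.mem_Icc, Nat.le_div_iff_mul_le hh] at hn
    rw [← Finset.mul_sum]
    exact mul_le_mul_of_nonneg_left (sum_rpow_natAbs_sub_le hδ hδ1.le hn.2) (by positivity)
  have h1δ : 0 < 1 - δ := by linarith
  rw [← Finset.sum_mul, ← Finset.mul_sum] at hfirst
  calc ∑ k ∈ Finset.Icc 1 N, offDiagonalSum δ h k / k
      ≤ 2 * ((h : ℝ) ^ (-δ) * ((2 * N / h : ℝ) ^ (1 - δ) / (1 - δ))) * (2 * ((2 * N) ^ δ / δ)) := by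
        refine hfirst.trans ?_
        gcongr
        exact sum_Icc_mul_rpow_neg_le hδ.le hδ1 N h
    _ = 4 / (δ * (1 - δ)) * ((h : ℝ) ^ (-δ) * ((2 * N / h : ℝ) ^ (1 - δ) * (2 * N) ^ δ)) := by
        field_simp
        norm_num
    _ = 8 / (δ * (1 - δ)) * (N / h) := by
        rw [rpow_neg_mul_div_rpow_mul_rpow (by positivity) (Nat.cast_pos.2 hh)]
        ring

theorem exp_neg_sq_le_two_mul_exp_neg (y : ℝ) : Real.exp (-y ^ 2) ≤ 2 * Real.exp (-y) := by
  have hquarter : Real.exp (1 / 4) ≤ 2 := by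
    rw [← Real.le_log_iff_exp_le two_pos]
    linarith [Real.log_two_gt_d9]
  calc Real.exp (-y ^ 2) ≤ Real.exp (1 / 4 + -y) := by
        gcongr
        linarith [sq_nonneg (y - 1 / 2)]
    _ = Real.exp (1 / 4) * Real.exp (-y) := Real.exp_add _ _
    _ ≤ 2 * Real.exp (-y) := by gcongr

theorem inv_one_sub_exp_neg_le {u : ℝ} (hu : 0 < u) : (1 - Real.exp (-u))⁻¹ ≤ 1 + 1 / u := by
  have hexp : Real.exp (-u) ≤ (u + 1)⁻¹ := by
    rw [Real.exp_neg]
    gcongr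
    exact Real.add_one_le_exp u
  have hsub : 1 - (u + 1)⁻¹ = u / (u + 1) := by field_simp; ring
  calc (1 - Real.exp (-u))⁻¹ ≤ (u / (u + 1))⁻¹ := by
        rw [← hsub]
        refine inv_anti₀ ?_ (by linarith)
        rw [hsub]
        positivity
    _ = 1 + 1 / u := by rw [inv_div, add_div, div_self hu.ne']

theorem sum_exp_neg_sq_mul_le {u : ℝ} (hu : 0 < u) (S : Finset ℕ) (m : ℕ) :
    ∑ n ∈ S, Real.exp (-(u * |(n : ℝ) - m|) ^ 2) ≤ 4 * (1 + 1 / u) := by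
  have hq1 : Real.exp (-u) < 1 := Real.exp_lt_one_iff.2 (by linarith)
  have hterm (n : ℕ) : Real.exp (-(u * |(n : ℝ) - m|) ^ 2) ≤
      2 * Real.exp (-u) ^ ((n : ℤ) - m).natAbs := by
    refine (exp_neg_sq_le_two_mul_exp_neg _).trans_eq ?_
    rw [abs_natCast_sub_natCast, ← Real.exp_nat_mul, mul_neg, mul_comm u]
  set D := S.image fun k : ℕ => ((k : ℤ) - m).natAbs
  have hgeometric : ∑ d ∈ D, Real.exp (-u) ^ d ≤ 1 + 1 / u := by
    refine le_trans ?_ (inv_one_sub_exp_neg_le hu)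
    rw [← tsum_geometric_of_lt_one (Real.exp_pos _).le hq1]
    exact (summable_geometric_of_lt_one (Real.exp_pos _).le hq1).sum_le_tsum _
      fun d _ => by positivity
  calc ∑ n ∈ S, Real.exp (-(u * |(n : ℝ) - m|) ^ 2)
      ≤ 2 * ∑ n ∈ S, Real.exp (-u) ^ ((n : ℤ) - m).natAbs := by
        rw [Finset.mul_sum]
        exact Finset.sum_le_sum fun n _ => hterm n
    _ ≤ 2 * (2 * ∑ d ∈ D, Real.exp (-u) ^ d) := by
        gcongr
        exact sum_natAbs_sub_le (fun d => by positivity) m fun k hk => Finset.mem_image_of_mem _ hk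
    _ ≤ 4 * (1 + 1 / u) := by linarith

/-! ### A mean value theorem for exponential sums -/

theorem integrable_exp_mul_gaussian {β : ℝ} (hβ : 0 < β) (t : ℝ) :
    Integrable fun y : ℝ => exp (I * t * y) * exp (-β * (y : ℂ) ^ 2) := by
  refine (integrable_cexp_quadratic' (b := -β) (by simpa) (I * t) 0).congr
    (Eventually.of_forall fun y => ?_)
  beta_reduce
  rw [← exp_add, add_zero, add_comm]

theorem norm_integral_exp_mul_gaussian_le {T : ℝ} (hT : 0 < T) (t : ℝ) :
    ‖∫ y : ℝ, exp (I * t * y) * exp (-((1 / T ^ 2 : ℝ) : ℂ) * (y : ℂ) ^ 2)‖ ≤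
      2 * T * Real.exp (-(T * t / 2) ^ 2) := by
  have hβ : 0 < 1 / T ^ 2 := by positivity
  have hfactor : ‖((Real.pi : ℂ) / (1 / T ^ 2 : ℝ)) ^ (1 / 2 : ℂ)‖ ≤ 2 * T := by
    rw [← ofReal_div, show (1 / 2 : ℂ) = (1 / 2 : ℝ) by norm_num,
      norm_cpow_eq_rpow_re_of_pos (div_pos Real.pi_pos hβ), ofReal_re, ← Real.sqrt_eq_rpow,
      div_div_eq_mul_div, div_one]
    refine Real.sqrt_le_iff.2 ⟨by positivity, ?_⟩
    rw [mul_pow, show (2 : ℝ) ^ 2 = 4 by norm_num]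
    gcongr
    exact Real.pi_le_four
  have hexp : -(t : ℂ) ^ 2 / (4 * (1 / T ^ 2 : ℝ)) = (-(T * t / 2) ^ 2 : ℝ) := by
    push_cast
    field_simp
    ring
  rw [fourierIntegral_gaussian (by rwa [ofReal_re]), norm_mul, hexp, norm_exp, ofReal_re]
  gcongr

/-- The exponential sum in `y` with coefficients `c n` and frequencies `l n`, `n ∈ S`. -/
noncomputable def expSum (S : Finset ℕ) (c : ℕ → ℂ) (l : ℕ → ℝ) (y : ℝ) : ℂ :=
  ∑ n ∈ S, c n * exp (I * l n * y)

theorem continuous_expSum (S : Finset ℕ) (c : ℕ → ℂ) (l : ℕ → ℝ) : Continuous (expSum S c l) := by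
  unfold expSum
  fun_prop

theorem norm_expSum_sq (S : Finset ℕ) (c : ℕ → ℂ) (l : ℕ → ℝ) (y : ℝ) :
    ((‖expSum S c l y‖ ^ 2 : ℝ) : ℂ) = ∑ m ∈ S, ∑ n ∈ S,
      c m * starRingEnd ℂ (c n) * exp (I * (l m - l n : ℝ) * y) := by
  rw [← Complex.normSq_eq_norm_sq, ← Complex.mul_conj, expSum, map_sum, Finset.sum_mul_sum]
  refine Finset.sum_congr rfl fun m _ => Finset.sum_congr rfl fun n _ => ?_
  have hconj : starRingEnd ℂ (I * l n * y) = -(I * l n * y) := by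
    simp only [map_mul, conj_I, conj_ofReal, neg_mul]
  have hexp : I * (l m - l n : ℝ) * y = I * l m * y + -(I * l n * y) := by
    push_cast
    ring
  rw [map_mul, ← exp_conj, hconj, hexp, exp_add]
  ring

section GaussianMean

variable (S : Finset ℕ) (c : ℕ → ℂ) (l : ℕ → ℝ)

theorem norm_expSum_sq_mul_gaussian (β y : ℝ) :
    ((‖expSum S c l y‖ ^ 2 * Real.exp (-β * y ^ 2) : ℝ) : ℂ) = ∑ m ∈ S, ∑ n ∈ S,
      c m * starRingEnd ℂ (c n) * (exp (I * (l m - l n : ℝ) * y) * exp (-β * (y : ℂ) ^ 2)) := by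
  rw [ofReal_mul, norm_expSum_sq, Finset.sum_mul]
  refine Finset.sum_congr rfl fun m _ => ?_
  rw [Finset.sum_mul]
  refine Finset.sum_congr rfl fun n _ => ?_
  push_cast
  ring

theorem integrable_norm_expSum_sq_mul_gaussian {β : ℝ} (hβ : 0 < β) :
    Integrable fun y : ℝ => ‖expSum S c l y‖ ^ 2 * Real.exp (-β * y ^ 2) := by
  have hcomplex : Integrable fun y : ℝ =>
      ((‖expSum S c l y‖ ^ 2 * Real.exp (-β * y ^ 2) : ℝ) : ℂ) := by
    simp only [norm_expSum_sq_mul_gaussian]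
    exact integrable_finsetSum _ fun m _ => integrable_finsetSum _ fun n _ =>
      (integrable_exp_mul_gaussian hβ _).const_mul _
  exact_mod_cast hcomplex.re

theorem integral_norm_expSum_sq_mul_gaussian {β : ℝ} (hβ : 0 < β) :
    ((∫ y : ℝ, ‖expSum S c l y‖ ^ 2 * Real.exp (-β * y ^ 2) : ℝ) : ℂ) = ∑ m ∈ S, ∑ n ∈ S,
      c m * starRingEnd ℂ (c n) *
        ∫ y : ℝ, exp (I * (l m - l n : ℝ) * y) * exp (-β * (y : ℂ) ^ 2) := by
  have hint (m n : ℕ) : Integrable fun y : ℝ => c m * starRingEnd ℂ (c n) *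
      (exp (I * (l m - l n : ℝ) * y) * exp (-β * (y : ℂ) ^ 2)) :=
    (integrable_exp_mul_gaussian hβ _).const_mul _
  rw [← integral_complex_ofReal]
  simp only [norm_expSum_sq_mul_gaussian]
  rw [integral_finsetSum _ fun m _ => integrable_finsetSum _ fun n _ => hint m n]
  refine Finset.sum_congr rfl fun m _ => ?_
  rw [integral_finsetSum _ fun n _ => hint m n]
  exact Finset.sum_congr rfl fun n _ => MeasureTheory.integral_const_mul _ _

theorem integral_norm_expSum_sq_mul_gaussian_le {T : ℝ} (hT : 0 < T) :
    ∫ y : ℝ, ‖expSum S c l y‖ ^ 2 * Real.exp (-(1 / T ^ 2) * y ^ 2) ≤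
      ∑ m ∈ S, ∑ n ∈ S, ‖c m‖ * ‖c n‖ * (2 * T * Real.exp (-(T * (l m - l n) / 2) ^ 2)) := by
  refine (le_abs_self _).trans ?_
  rw [← Real.norm_eq_abs, ← Complex.norm_real,
    integral_norm_expSum_sq_mul_gaussian S c l (by positivity)]
  refine norm_sum_le_of_le _ fun m _ => norm_sum_le_of_le _ fun n _ => ?_
  rw [norm_mul, norm_mul, RCLike.norm_conj]
  gcongr
  exact norm_integral_exp_mul_gaussian_le hT _

end GaussianMean

theorem sum_sum_mul_mul_le_of_sum_le {ι : Type*} {S : Finset ι} (a : ι → ℝ) {w : ι → ι → ℝ}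
    (hsymm : ∀ m n, w m n = w n m) (hw : ∀ m n, 0 ≤ w m n) {R : ℝ}
    (hrow : ∀ m ∈ S, ∑ n ∈ S, w m n ≤ R) :
    ∑ m ∈ S, ∑ n ∈ S, a m * a n * w m n ≤ R * ∑ m ∈ S, a m ^ 2 := by
  have hdiagonal : ∑ m ∈ S, ∑ n ∈ S, a m ^ 2 * w m n ≤ R * ∑ m ∈ S, a m ^ 2 := by
    rw [Finset.mul_sum]
    refine Finset.sum_le_sum fun m hm => ?_
    rw [← Finset.mul_sum, mul_comm]
    exact mul_le_mul_of_nonneg_right (hrow m hm) (sq_nonneg _)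
  have hswap : ∑ m ∈ S, ∑ n ∈ S, a n ^ 2 * w m n = ∑ m ∈ S, ∑ n ∈ S, a m ^ 2 * w m n := by
    rw [Finset.sum_comm]
    simp only [hsymm]
  have hamgm : 2 * ∑ m ∈ S, ∑ n ∈ S, a m * a n * w m n ≤
      ∑ m ∈ S, ∑ n ∈ S, a m ^ 2 * w m n + ∑ m ∈ S, ∑ n ∈ S, a n ^ 2 * w m n := by
    simp only [Finset.mul_sum, ← Finset.sum_add_distrib]
    refine Finset.sum_le_sum fun m _ => Finset.sum_le_sum fun n _ => ?_
    linarith [mul_le_mul_of_nonneg_right (two_mul_le_add_sq (a m) (a n)) (hw m n)]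
  linarith

theorem sum_exp_neg_sq_sub_le {S : Finset ℕ} {l : ℕ → ℝ} {N T : ℝ} (hN : 0 < N) (hT : 0 < T)
    (hsep : ∀ m ∈ S, ∀ n ∈ S, |(m : ℝ) - n| / N ≤ |l m - l n|) {m : ℕ} (hm : m ∈ S) :
    ∑ n ∈ S, Real.exp (-(T * (l m - l n) / 2) ^ 2) ≤ 4 * (1 + 2 * N / T) := by
  have hsum := sum_exp_neg_sq_mul_le (u := T / (2 * N)) (by positivity) S m
  rw [one_div_div] at hsum
  refine (Finset.sum_le_sum fun n hn => Real.exp_le_exp.2 (neg_le_neg ?_)).trans hsum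
  rw [sq_le_sq, abs_of_nonneg (by positivity), abs_div, abs_mul, abs_of_pos hT, abs_two,
    abs_sub_comm (l m)]
  calc T / (2 * N) * |(n : ℝ) - m| = T * (|(n : ℝ) - m| / N) / 2 := by field_simp
    _ ≤ T * |l n - l m| / 2 := by
        have := hsep n hn m hm
        gcongr

theorem intervalIntegral_le_exp_nine_mul_integral_gaussian {f : ℝ → ℝ} (hf : Continuous f)
    (hf0 : ∀ y, 0 ≤ f y) {T T₁ T₂ : ℝ} (hT : 0 < T) (hT₁ : 0 ≤ T₁) (hT₁₂ : T₁ ≤ T₂)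
    (hT₂ : T₂ ≤ 3 * T) (hint : Integrable fun y => f y * Real.exp (-(1 / T ^ 2) * y ^ 2)) :
    ∫ y in T₁..T₂, f y ≤ Real.exp 9 * ∫ y, f y * Real.exp (-(1 / T ^ 2) * y ^ 2) := by
  rw [← MeasureTheory.integral_const_mul, intervalIntegral.integral_of_le hT₁₂]
  refine (setIntegral_mono_on (hf.integrableOn_Icc.mono_set Ioc_subset_Icc_self)
    (hint.const_mul _).integrableOn measurableSet_Ioc fun y hy => ?_).trans
    (setIntegral_le_integral (hint.const_mul _) (Eventually.of_forall fun y =>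
      mul_nonneg (Real.exp_pos _).le (mul_nonneg (hf0 y) (Real.exp_pos _).le)))
  have hy2 : 1 / T ^ 2 * y ^ 2 ≤ 9 := by
    rw [one_div_mul_eq_div, div_le_iff₀ (by positivity), show (9 : ℝ) = 3 ^ 2 by norm_num,
      ← mul_pow]
    exact pow_le_pow_left₀ (hT₁.trans hy.1.le) (hy.2.trans hT₂) 2
  calc f y ≤ f y * Real.exp (9 + -(1 / T ^ 2) * y ^ 2) :=
        le_mul_of_one_le_right (hf0 y) (Real.one_le_exp (by linarith))
    _ = Real.exp 9 * (f y * Real.exp (-(1 / T ^ 2) * y ^ 2)) := by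
        rw [Real.exp_add]
        ring

theorem integral_norm_expSum_sq_le {S : Finset ℕ} (c : ℕ → ℂ) {l : ℕ → ℝ} {N T T₁ T₂ : ℝ}
    (hN : 0 < N) (hT : 0 < T) (hT₁ : 0 ≤ T₁) (hT₁₂ : T₁ ≤ T₂) (hT₂ : T₂ ≤ 3 * T)
    (hsep : ∀ m ∈ S, ∀ n ∈ S, |(m : ℝ) - n| / N ≤ |l m - l n|) :
    ∫ y in T₁..T₂, ‖expSum S c l y‖ ^ 2 ≤
      Real.exp 9 * 16 * (T + N) * ∑ n ∈ S, ‖c n‖ ^ 2 := by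
  have hrow (m : ℕ) (hm : m ∈ S) :
      ∑ n ∈ S, 2 * T * Real.exp (-(T * (l m - l n) / 2) ^ 2) ≤ 16 * (T + N) := by
    rw [← Finset.mul_sum]
    calc 2 * T * ∑ n ∈ S, Real.exp (-(T * (l m - l n) / 2) ^ 2)
        ≤ 2 * T * (4 * (1 + 2 * N / T)) :=
          mul_le_mul_of_nonneg_left (sum_exp_neg_sq_sub_le hN hT hsep hm) (by positivity)
      _ = 8 * T + 16 * N := by
          field_simp
          ring
      _ ≤ 16 * (T + N) := by linarith
  have hschur := sum_sum_mul_mul_le_of_sum_le (fun n => ‖c n‖)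
    (fun m n => by rw [← neg_sub (l n), mul_neg, neg_div, neg_sq])
    (fun m n => mul_nonneg (by positivity) (Real.exp_pos _).le) hrow
  calc ∫ y in T₁..T₂, ‖expSum S c l y‖ ^ 2
      ≤ Real.exp 9 * ∫ y, ‖expSum S c l y‖ ^ 2 * Real.exp (-(1 / T ^ 2) * y ^ 2) :=
        intervalIntegral_le_exp_nine_mul_integral_gaussian ((continuous_expSum S c l).norm.pow 2)
          (fun y => sq_nonneg _) hT hT₁ hT₁₂ hT₂
          (integrable_norm_expSum_sq_mul_gaussian S c l (by positivity))
    _ ≤ Real.exp 9 * (16 * (T + N) * ∑ n ∈ S, ‖c n‖ ^ 2) :=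
        mul_le_mul_of_nonneg_left
          ((integral_norm_expSum_sq_mul_gaussian_le S c l hT).trans hschur) (Real.exp_pos _).le
    _ = Real.exp 9 * 16 * (T + N) * ∑ n ∈ S, ‖c n‖ ^ 2 := by ring

theorem sq_intervalIntegral_le {f : ℝ → ℝ} (hf : Continuous f) {a b : ℝ} (hab : a ≤ b) :
    (∫ y in a..b, f y) ^ 2 ≤ (b - a) * ∫ y in a..b, f y ^ 2 := by
  rcases hab.eq_or_lt with rfl | hlt
  · simp
  set P := ∫ y in a..b, f y with hP
  have hvariance : 0 ≤ ∫ y in a..b, ((b - a) ^ 2 * f y ^ 2 - 2 * (b - a) * P * f y + P ^ 2) :=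
    intervalIntegral.integral_nonneg hab fun y _ => by nlinarith [sq_nonneg ((b - a) * f y - P)]
  rw [intervalIntegral.integral_add, intervalIntegral.integral_sub,
    intervalIntegral.integral_const_mul, intervalIntegral.integral_const_mul,
    intervalIntegral.integral_const, smul_eq_mul, ← hP] at hvariance
  · refine le_of_mul_le_mul_left ?_ (sub_pos.2 hlt)
    linarith
  all_goals exact Continuous.intervalIntegrable (by fun_prop) _ _

/-! ### The line to the left of the critical strip -/

theorem abs_sub_div_le_abs_log_div_sub_log_div {k m n N : ℝ} (hk : 0 < k) (hm : 0 < m)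
    (hn : 0 < n) (hmN : m ≤ N) (hnN : n ≤ N) :
    |m - n| / N ≤ |Real.log (k / m) - Real.log (k / n)| := by
  wlog hmn : m ≤ n generalizing m n
  · rw [abs_sub_comm m, abs_sub_comm (Real.log (k / m))]
    exact this hn hm hnN hmN (le_of_not_ge hmn)
  have hlog : Real.log (k / m) - Real.log (k / n) = Real.log (n / m) := by
    rw [Real.log_div hk.ne' hm.ne', Real.log_div hk.ne' hn.ne', Real.log_div hn.ne' hm.ne']
    ring
  calc |m - n| / N ≤ |m - n| / n := by gcongr
    _ = 1 - (n / m)⁻¹ := by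
        rw [abs_of_nonpos (by linarith), inv_div]
        field_simp
        ring
    _ ≤ Real.log (n / m) := Real.one_sub_inv_le_log_of_pos (div_pos hn hm)
    _ ≤ |Real.log (k / m) - Real.log (k / n)| := by
        rw [hlog]
        exact le_abs_self _

theorem continuous_riemannZeta_add_mul_I {c : ℝ} (hc : c ≠ 1) :
    Continuous fun y : ℝ => riemannZeta (c + y * I) := by
  refine continuous_iff_continuousAt.2 fun y => ContinuousAt.comp (g := riemannZeta)
    (differentiableAt_riemannZeta fun h => hc ?_).continuousAt (by fun_prop)
  simpa using congrArg re h

theorem intervalIntegrable_inv_riemannZeta {δ T₁ T₂ : ℝ} (hδ : 0 < δ) (hT₁ : 1 ≤ T₁)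
    (hT₁₂ : T₁ ≤ T₂) :
    IntervalIntegrable (fun y : ℝ => (riemannZeta ((-δ : ℝ) + y * I))⁻¹) volume T₁ T₂ := by
  obtain ⟨C, hC, hζ⟩ := exists_norm_inv_riemannZeta_neg_le hδ
  rw [intervalIntegrable_iff_integrableOn_Ioc_of_le hT₁₂]
  refine Measure.integrableOn_of_bounded (M := C) measure_Ioc_lt_top.ne
    (continuous_riemannZeta_add_mul_I (by linarith)).measurable.inv.aestronglyMeasurable
    ((ae_restrict_iff' measurableSet_Ioc).2 (Eventually.of_forall fun y hy => ?_))
  have hy1 : 1 ≤ y := hT₁.trans hy.1.le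
  exact (hζ y hy1).trans
    (mul_le_of_le_one_right hC.le (Real.rpow_le_one_of_one_le_of_nonpos hy1 (by norm_num)))

theorem sum_mul_verticalIntegral_eq {S : Finset ℕ} (hS : ∀ h ∈ S, 0 < h) (x : ℕ → ℂ) {k : ℕ}
    (hk : 0 < k) {c T₁ T₂ : ℝ}
    (hint : IntervalIntegrable (fun y : ℝ => (riemannZeta (c + y * I))⁻¹) volume T₁ T₂) :
    ∑ h ∈ S, x h * verticalIntegral T₁ T₂ c ((k : ℝ) / h) =
      ∫ y in T₁..T₂, expSum S (fun h => x h * (((k : ℝ) / h) ^ c : ℝ))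
        (fun h => Real.log ((k : ℝ) / h)) y * (riemannZeta (c + y * I))⁻¹ := by
  simp only [expSum, Finset.sum_mul]
  rw [intervalIntegral.integral_finsetSum fun h _ =>
    hint.continuousOn_mul (Continuous.continuousOn (by fun_prop))]
  refine Finset.sum_congr rfl fun h hh => ?_
  have hr : (0 : ℝ) < (k : ℝ) / h := div_pos (Nat.cast_pos.2 hk) (Nat.cast_pos.2 (hS h hh))
  rw [verticalIntegral, ← intervalIntegral.integral_const_mul]
  refine intervalIntegral.integral_congr fun y _ => ?_
  rw [ofReal_cpow_add_mul_I hr, mul_comm (Real.log ((k : ℝ) / h) : ℂ) I, div_eq_mul_inv]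
  ring

theorem exists_norm_integral_mul_inv_riemannZeta_le {δ : ℝ} (hδ : 0 < δ) :
    ∃ C : ℝ, 0 < C ∧ ∀ (D : ℝ → ℂ) (T₁ T₂ : ℝ), Continuous D → 1 ≤ T₁ → T₁ ≤ T₂ → T₂ ≤ 6 * T₁ →
      ‖∫ y in T₁..T₂, D y * (riemannZeta ((-δ : ℝ) + y * I))⁻¹‖ ≤
        C * √(∫ y in T₁..T₂, ‖D y‖ ^ 2) := by
  obtain ⟨C, hC, hζ⟩ := exists_norm_inv_riemannZeta_neg_le hδ
  refine ⟨C * √5, by positivity, fun D T₁ T₂ hD hT₁ hT₁₂ hT₂ => ?_⟩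
  have hT₁0 : 0 < T₁ := one_pos.trans_le hT₁
  set Q := ∫ y in T₁..T₂, ‖D y‖ ^ 2
  have hQ : 0 ≤ Q := intervalIntegral.integral_nonneg hT₁₂ fun y _ => sq_nonneg _
  have hcauchy : ∫ y in T₁..T₂, ‖D y‖ ≤ √T₁ * (√5 * √Q) := by
    rw [← Real.sqrt_mul (by norm_num), ← Real.sqrt_mul hT₁0.le]
    refine Real.le_sqrt_of_sq_le ((sq_intervalIntegral_le hD.norm hT₁₂).trans ?_)
    rw [← mul_assoc]
    exact mul_le_mul_of_nonneg_right (by linarith) hQ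
  have hpow : T₁ ^ (-(1 / 2) : ℝ) * √T₁ = 1 := by
    rw [Real.sqrt_eq_rpow, ← Real.rpow_add hT₁0, neg_add_cancel, Real.rpow_zero]
  calc ‖∫ y in T₁..T₂, D y * (riemannZeta ((-δ : ℝ) + y * I))⁻¹‖
      ≤ ∫ y in T₁..T₂, C * T₁ ^ (-(1 / 2) : ℝ) * ‖D y‖ := by
        refine intervalIntegral.norm_integral_le_of_norm_le hT₁₂
          (Eventually.of_forall fun y hy => ?_) (Continuous.intervalIntegrable (by fun_prop) _ _)
        rw [norm_mul, mul_comm]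
        refine mul_le_mul_of_nonneg_right ((hζ y (hT₁.trans hy.1.le)).trans ?_) (norm_nonneg _)
        exact mul_le_mul_of_nonneg_left
          (Real.rpow_le_rpow_of_nonpos hT₁0 hy.1.le (by norm_num)) hC.le
    _ ≤ C * T₁ ^ (-(1 / 2) : ℝ) * (√T₁ * (√5 * √Q)) := by
        rw [intervalIntegral.integral_const_mul]
        gcongr
    _ = C * (T₁ ^ (-(1 / 2) : ℝ) * √T₁) * √5 * √Q := by ring
    _ = C * √5 * √Q := by rw [hpow, mul_one]

theorem sum_norm_mul_rpow_sq_le {S : Finset ℕ} (x : ℕ → ℂ) {r : ℕ → ℝ} (hr : ∀ h ∈ S, 0 ≤ r h)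
    {q : ℝ} (hq : ∀ h ∈ S, r h ≤ q) :
    ∑ h ∈ S, ‖x h * (r h : ℂ)‖ ^ 2 ≤ q ^ 2 * ∑ h ∈ S, ‖x h‖ ^ 2 := by
  rw [Finset.mul_sum]
  refine Finset.sum_le_sum fun h hh => ?_
  rw [norm_mul, mul_pow, Complex.norm_real, Real.norm_of_nonneg (hr h hh), mul_comm]
  exact mul_le_mul_of_nonneg_right (pow_le_pow_left₀ (hr h hh) (hq h hh) 2) (sq_nonneg _)

theorem exists_norm_sum_verticalIntegral_le {δ : ℝ} (hδ : 0 < δ) :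
    ∃ C : ℝ, 0 < C ∧ ∀ (S : Finset ℕ) (x : ℕ → ℂ) (N k : ℕ) (T T₁ T₂ q : ℝ), 0 < N → 0 < k →
      S ⊆ Finset.Icc 1 N → 1 ≤ T₁ → T ≤ 2 * T₁ → T₁ ≤ T₂ → T₂ ≤ 3 * T → 0 ≤ q →
      (∀ h ∈ S, ((k : ℝ) / h) ^ (-δ) ≤ q) →
      ‖∑ h ∈ S, x h * verticalIntegral T₁ T₂ (-δ) ((k : ℝ) / h)‖ ≤
        C * q * √((T + N) * ∑ h ∈ S, ‖x h‖ ^ 2) := by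
  obtain ⟨C, hC, hbound⟩ := exists_norm_integral_mul_inv_riemannZeta_le hδ
  refine ⟨C * √(Real.exp 9 * 16), by positivity, ?_⟩
  intro S x N k T T₁ T₂ q hN hk hS hT₁ hTT₁ hT₁₂ hT₂ hq hqS
  have hT : 0 < T := by linarith
  have hk' : (0 : ℝ) < k := Nat.cast_pos.2 hk
  have hS1 (h : ℕ) (hh : h ∈ S) : 0 < h := (Finset.mem_Icc.1 (hS hh)).1
  have hSN (h : ℕ) (hh : h ∈ S) : (h : ℝ) ≤ N := Nat.cast_le.2 (Finset.mem_Icc.1 (hS hh)).2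
  rw [sum_mul_verticalIntegral_eq hS1 x hk (intervalIntegrable_inv_riemannZeta hδ hT₁ hT₁₂)]
  set c : ℕ → ℂ := fun h => x h * (((k : ℝ) / h) ^ (-δ) : ℝ)
  have hmean := integral_norm_expSum_sq_le c (Nat.cast_pos.2 hN : (0 : ℝ) < N) hT (by linarith)
    hT₁₂ hT₂ fun m hm n hn => abs_sub_div_le_abs_log_div_sub_log_div hk'
      (Nat.cast_pos.2 (hS1 m hm)) (Nat.cast_pos.2 (hS1 n hn)) (hSN m hm) (hSN n hn)
  have hcoeff : ∑ h ∈ S, ‖c h‖ ^ 2 ≤ q ^ 2 * ∑ h ∈ S, ‖x h‖ ^ 2 :=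
    sum_norm_mul_rpow_sq_le x (fun h _ => by positivity) hqS
  set X := ∑ h ∈ S, ‖x h‖ ^ 2
  calc ‖∫ y in T₁..T₂, expSum S c (fun h => Real.log ((k : ℝ) / h)) y *
        (riemannZeta ((-δ : ℝ) + y * I))⁻¹‖
      ≤ C * √(∫ y in T₁..T₂, ‖expSum S c (fun h => Real.log ((k : ℝ) / h)) y‖ ^ 2) :=
        hbound _ T₁ T₂ (continuous_expSum _ _ _) hT₁ hT₁₂ (by linarith)
    _ ≤ C * √(Real.exp 9 * 16 * (q ^ 2 * ((T + N) * X))) := by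
        gcongr
        exact hmean.trans
          ((mul_le_mul_of_nonneg_left hcoeff (by positivity)).trans_eq (by ring))
    _ = C * √(Real.exp 9 * 16) * q * √((T + N) * X) := by
        rw [Real.sqrt_mul (by positivity), Real.sqrt_mul (sq_nonneg q), Real.sqrt_sq hq]
        ring

/-! ### Near and far pairs -/

/-- Pairs `(h, k)` whose quotient `k / h` lies within the power `T ^ E` of `1`. These are treated
by moving the left side of the contour to `Re s = -δ`; for the others a fixed contour suffices,
because a power of `k / h` then outweighs any power of `T`. The distinction is needed since the
length of the Dirichlet polynomial is not assumed to be bounded by a power of `T`. -/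
def IsNearPair (E T : ℝ) (h k : ℕ) : Prop :=
  T ^ (-E) < (k : ℝ) / h ∧ (k : ℝ) / h < T ^ E

open Classical in
/-- The contribution of the left side of the contour to the pair `(h, k)`: the integral over
`Re s = -δ` for a near pair, and nothing for a far one. -/
noncomputable def nearVerticalIntegral (E δ T T₁ T₂ : ℝ) (h k : ℕ) : ℂ :=
  if IsNearPair E T h k then verticalIntegral T₁ T₂ (-δ) ((k : ℝ) / h) else 0

theorem IsNearPair.rpow_neg_le {E T δ : ℝ} {h k : ℕ} (hnear : IsNearPair E T h k) (hT : 0 < T)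
    (hδ : 0 ≤ δ) : ((k : ℝ) / h) ^ (-δ) ≤ T ^ (E * δ) := by
  calc ((k : ℝ) / h) ^ (-δ) ≤ (T ^ (-E)) ^ (-δ) :=
        Real.rpow_le_rpow_of_nonpos (by positivity) hnear.1.le (by linarith)
    _ = T ^ (E * δ) := by rw [← Real.rpow_mul hT.le, neg_mul_neg]

theorem IsNearPair.rpow_one_add_le {E T δ : ℝ} {h k : ℕ} (hnear : IsNearPair E T h k) (hT : 0 < T)
    (hδ : 0 ≤ δ) : ((k : ℝ) / h) ^ (1 + δ) ≤ T ^ (E * δ) * ((k : ℝ) / h) := by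
  have hr : 0 < (k : ℝ) / h := (Real.rpow_pos_of_pos hT _).trans hnear.1
  rw [Real.rpow_add hr, Real.rpow_one, mul_comm, Real.rpow_mul hT.le]
  exact mul_le_mul_of_nonneg_right (Real.rpow_le_rpow hr.le hnear.2.le hδ) hr.le

theorem offDiagonalSum_nonneg (δ : ℝ) (h k : ℕ) : 0 ≤ offDiagonalSum δ h k :=
  Finset.sum_nonneg fun _ _ => by positivity

theorem norm_verticalIntegral_sub_near_le {E T T₁ T₂ δ : ℝ} {h k : ℕ}
    (hnear : IsNearPair E T h k) (hδ : 0 < δ) (hδ1 : δ ≤ 1) (hT : 1 ≤ T) (hT₁₂ : T₁ ≤ T₂)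
    (hT₂ : T₂ - T₁ ≤ 3 * T) (hh : 0 < h) (hk : 0 < k) :
    ‖verticalIntegral T₁ T₂ (1 + δ) ((k : ℝ) / h) -
        (((T₂ - T₁) * diagonalCoeff h k : ℝ) : ℂ)‖ ≤
      4 * (∑' n : ℕ, (n : ℝ) ^ (-(1 + δ))) * T ^ ((E + 1) * δ) * (1 + (k : ℝ) / h) +
        16 * T ^ δ * offDiagonalSum δ h k := by
  have hT0 : 0 < T := one_pos.trans_le hT
  set S := ∑' n : ℕ, (n : ℝ) ^ (-(1 + δ))
  have : 0 ≤ S := tsum_nonneg fun n => by positivity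
  refine (norm_verticalIntegral_sub_le hδ hδ1 hT₁₂ hT₂ hh hk).trans (add_le_add_left ?_ _)
  calc 4 * ((k : ℝ) / h) ^ (1 + δ) * S
      ≤ 4 * (T ^ (E * δ) * ((k : ℝ) / h)) * S := by
        gcongr
        exact hnear.rpow_one_add_le hT0 hδ.le
    _ ≤ 4 * (T ^ ((E + 1) * δ) * (1 + (k : ℝ) / h)) * S := by
        gcongr
        · linarith
        · linarith
    _ = 4 * S * T ^ ((E + 1) * δ) * (1 + (k : ℝ) / h) := by ring

theorem exists_norm_zetaZeroSum_near_le (hRH : RiemannHypothesis) (K : ℝ → ℝ) {δ : ℝ}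
    (hδ : 0 < δ) (hδ1 : δ ≤ 1) (E : ℝ) :
    ∃ C : ℝ, 0 ≤ C ∧ ∀ (T T₁ T₂ : ℝ) (h k : ℕ), IsAdmissibleWindow K T T₁ T₂ → 0 < h → 0 < k →
      IsNearPair E T h k →
      ‖2 * Real.pi * zetaZeroSum T₁ T₂ ((k : ℝ) / h) -
          (((T₂ - T₁) * diagonalCoeff h k : ℝ) : ℂ) +
          verticalIntegral T₁ T₂ (-δ) ((k : ℝ) / h)‖ ≤
        C * T ^ ((E + 1) * δ) * (1 + (k : ℝ) / h) + 16 * T ^ δ * offDiagonalSum δ h k := by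
  set S := ∑' n : ℕ, (n : ℝ) ^ (-(1 + δ))
  have : 0 ≤ S := tsum_nonneg fun n => by positivity
  refine ⟨18 * |K δ| + 4 * S, by positivity, ?_⟩
  intro T T₁ T₂ h k hW hh hk hnear
  have hT : 0 < T := two_pos.trans_le hW.two_le
  have hr : 0 < (k : ℝ) / h := div_pos (Nat.cast_pos.2 hk) (Nat.cast_pos.2 hh)
  have hright := norm_verticalIntegral_sub_near_le hnear hδ hδ1 (one_le_two.trans hW.two_le)
    hW.le (by linarith [hW.le_three_mul, hW.three_le]) hh hk
  have hcontour := norm_two_pi_mul_zetaZeroSum_sub_le hRH (a := -δ) (b := 1 + δ) (by linarith)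
    (by linarith) (by linarith) (by linarith) hδ hδ1 hr hW
  have hpow : ((k : ℝ) / h) ^ (-δ) + ((k : ℝ) / h) ^ (1 + δ) ≤ T ^ (E * δ) * (1 + (k : ℝ) / h) :=
    (add_le_add (hnear.rpow_neg_le hT hδ.le) (hnear.rpow_one_add_le hT hδ.le)).trans_eq (by ring)
  have hcontour' := hcontour.trans (mul_le_mul_of_nonneg_left hpow (by positivity))
  set r := (k : ℝ) / h
  calc ‖2 * Real.pi * zetaZeroSum T₁ T₂ r - (((T₂ - T₁) * diagonalCoeff h k : ℝ) : ℂ) +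
        verticalIntegral T₁ T₂ (-δ) r‖
      = ‖(2 * Real.pi * zetaZeroSum T₁ T₂ r -
          (verticalIntegral T₁ T₂ (1 + δ) r - verticalIntegral T₁ T₂ (-δ) r)) +
          (verticalIntegral T₁ T₂ (1 + δ) r -
            (((T₂ - T₁) * diagonalCoeff h k : ℝ) : ℂ))‖ := by congr 1; ring
    _ ≤ _ := (norm_add_le _ _).trans (add_le_add hcontour' hright)
    _ = (18 * |K δ| + 4 * S) * T ^ ((E + 1) * δ) * (1 + r) +
          16 * T ^ δ * offDiagonalSum δ h k := by
        rw [add_mul E, one_mul, Real.rpow_add hT]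
        ring

theorem abs_mul_diagonalCoeff_le {L T : ℝ} (hL : 0 ≤ L) (hLT : L ≤ 3 * T) {h k : ℕ} (hh : 0 < h)
    (hk : 0 < k) (hr : T ≤ (k : ℝ) / h ∨ (k : ℝ) / h < 1) :
    |L * diagonalCoeff h k| ≤ 3 * ((k : ℝ) / h) := by
  unfold diagonalCoeff
  split_ifs with hdvd
  · have hone : 1 ≤ (k : ℝ) / h :=
      (one_le_div (Nat.cast_pos.2 hh)).2 (Nat.cast_le.2 (Nat.le_of_dvd hk hdvd))
    have hmoebius : |((ArithmeticFunction.moebius (k / h) : ℤ) : ℝ)| ≤ 1 :=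
      mod_cast ArithmeticFunction.abs_moebius_le_one
    rw [abs_mul, abs_of_nonneg hL]
    exact (mul_le_of_le_one_right hL hmoebius).trans
      (by linarith [hr.resolve_right (not_lt.2 hone)])
  · rw [mul_zero, abs_zero]
    positivity

theorem exists_norm_zetaZeroSum_far_le (hRH : RiemannHypothesis) (K : ℝ → ℝ) :
    ∃ E : ℝ, 0 ≤ E ∧ ∀ δ : ℝ, 0 < δ → δ ≤ 1 → ∃ C : ℝ, 0 < C ∧ ∀ (T T₁ T₂ : ℝ) (h k : ℕ),
      IsAdmissibleWindow K T T₁ T₂ → 0 < h → 0 < k → ¬IsNearPair E T h k →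
      ‖2 * Real.pi * zetaZeroSum T₁ T₂ ((k : ℝ) / h) -
          (((T₂ - T₁) * diagonalCoeff h k : ℝ) : ℂ)‖ ≤ C * T ^ δ * (1 + (k : ℝ) / h) := by
  obtain ⟨E, hE, hbound⟩ := exists_norm_zetaZeroSum_le hRH K
  refine ⟨E + 1, by positivity, fun δ hδ hδ1 => ?_⟩
  obtain ⟨C, hC, hsum⟩ := hbound δ hδ hδ1
  refine ⟨8 * C + 3, by positivity, fun T T₁ T₂ h k hW hh hk hfar => ?_⟩
  have hT : 1 < T := one_lt_two.trans_le hW.two_le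
  have hr : 0 < (k : ℝ) / h := div_pos (Nat.cast_pos.2 hk) (Nat.cast_pos.2 hh)
  have hcase : T ^ (E + 1) ≤ (k : ℝ) / h ∨ (k : ℝ) / h ≤ T ^ (-(E + 1)) := by
    by_contra! hcon
    exact hfar ⟨hcon.2, hcon.1⟩
  have hsum' := hsum T T₁ T₂ _ hW hr <| hcase.imp
    (Real.rpow_le_rpow_of_exponent_le hT.le (by linarith)).trans
    (le_trans · (Real.rpow_le_rpow_of_exponent_le hT.le (by linarith)))
  have hmain : |(T₂ - T₁) * diagonalCoeff h k| ≤ 3 * ((k : ℝ) / h) :=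
    abs_mul_diagonalCoeff_le (by linarith [hW.le])
      (by linarith [hW.le_three_mul, hW.three_le]) hh hk <| hcase.imp
      (Real.self_le_rpow_of_one_le hT.le (by linarith)).trans
      (lt_of_le_of_lt · (Real.rpow_lt_one_of_one_lt_of_neg hT (by linarith)))
  have hTδ : 1 ≤ T ^ δ := Real.one_le_rpow hT.le hδ.le
  set r := (k : ℝ) / h
  calc ‖2 * Real.pi * zetaZeroSum T₁ T₂ r - (((T₂ - T₁) * diagonalCoeff h k : ℝ) : ℂ)‖
      ≤ 2 * Real.pi * ‖zetaZeroSum T₁ T₂ r‖ + |(T₂ - T₁) * diagonalCoeff h k| := by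
        refine (norm_sub_le _ _).trans_eq ?_
        rw [norm_mul, norm_mul, Complex.norm_real, Complex.norm_real, norm_ofNat,
          Real.norm_of_nonneg Real.pi_pos.le, Real.norm_eq_abs]
    _ ≤ 2 * 4 * (C * T ^ δ * (1 + r)) + 3 * T ^ δ * (1 + r) := by
        gcongr
        · exact Real.pi_le_four
        · exact hmain.trans (mul_le_mul (by linarith) (by linarith) hr.le (by positivity))
    _ = (8 * C + 3) * T ^ δ * (1 + r) := by ring

theorem exists_norm_zetaZeroSum_remainder_le (hRH : RiemannHypothesis) (K : ℝ → ℝ) :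
    ∃ E : ℝ, 0 ≤ E ∧ ∀ δ : ℝ, 0 < δ → δ ≤ 1 → ∃ C : ℝ, 0 ≤ C ∧ ∀ (T T₁ T₂ : ℝ) (h k : ℕ),
      IsAdmissibleWindow K T T₁ T₂ → 0 < h → 0 < k →
      ‖2 * Real.pi * zetaZeroSum T₁ T₂ ((k : ℝ) / h) -
          (((T₂ - T₁) * diagonalCoeff h k : ℝ) : ℂ) + nearVerticalIntegral E δ T T₁ T₂ h k‖ ≤
        C * T ^ ((E + 1) * δ) * (1 + (k : ℝ) / h) + 16 * T ^ δ * offDiagonalSum δ h k := by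
  obtain ⟨E, hE, hbound⟩ := exists_norm_zetaZeroSum_far_le hRH K
  refine ⟨E, hE, fun δ hδ hδ1 => ?_⟩
  obtain ⟨Cfar, hCfar, hfar⟩ := hbound δ hδ hδ1
  obtain ⟨Cnear, hCnear, hnear⟩ := exists_norm_zetaZeroSum_near_le hRH K hδ hδ1 E
  refine ⟨Cfar + Cnear, by positivity, fun T T₁ T₂ h k hW hh hk => ?_⟩
  have hT : 1 ≤ T := one_le_two.trans hW.two_le
  unfold nearVerticalIntegral
  split_ifs with hpair
  · refine (hnear T T₁ T₂ h k hW hh hk hpair).trans ?_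
    gcongr
    exact le_add_of_nonneg_left hCfar.le
  · rw [add_zero]
    have hoff := offDiagonalSum_nonneg δ h k
    calc ‖2 * Real.pi * zetaZeroSum T₁ T₂ ((k : ℝ) / h) -
          (((T₂ - T₁) * diagonalCoeff h k : ℝ) : ℂ)‖
        ≤ Cfar * T ^ δ * (1 + (k : ℝ) / h) := hfar T T₁ T₂ h k hW hh hk hpair
      _ ≤ (Cfar + Cnear) * T ^ ((E + 1) * δ) * (1 + (k : ℝ) / h) := by
          gcongr
          · exact le_add_of_nonneg_right hCnear
          · nlinarith
      _ ≤ _ := le_add_of_nonneg_right (by positivity)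

/-! ### Reduction to the sums over pairs -/

theorem natCast_cpow_neg_mul_conj {ρ : ℂ} (hρ : ρ.re = 1 / 2) {h k : ℕ} (hk : 0 < k) :
    (h : ℂ) ^ (-ρ) * (starRingEnd ℂ) ((k : ℂ) ^ (-ρ)) = (((k : ℝ) / h : ℝ) : ℂ) ^ ρ / k := by
  have hconj_rho : (starRingEnd ℂ) (-ρ) = ρ - 1 := by
    apply Complex.ext
    · rw [conj_re, neg_re, sub_re, one_re, hρ]
      norm_num
    · simp
  have hconj : (starRingEnd ℂ) ((k : ℂ) ^ (-ρ)) = (k : ℂ) ^ (ρ - 1) := by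
    rw [← hconj_rho, cpow_conj _ _ (by rw [natCast_arg]; exact Real.pi_pos.ne), conj_natCast]
  have hdiv : (((k : ℝ) / h : ℝ) : ℂ) ^ ρ = (k : ℂ) ^ ρ / (h : ℂ) ^ ρ := by
    simpa only [ofReal_div, ofReal_natCast] using
      div_cpow_ofReal_nonneg (Nat.cast_nonneg (α := ℝ) k) (Nat.cast_nonneg (α := ℝ) h) ρ
  rw [hconj, hdiv, cpow_neg, cpow_sub _ _ (Nat.cast_ne_zero.2 hk.ne'), cpow_one]
  ring

theorem norm_dirichletPoly_sq (x : ℕ → ℝ) (M : ℝ) {ρ : ℂ} (hρ : ρ.re = 1 / 2) :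
    ((‖dirichletPoly x M ρ‖ ^ 2 : ℝ) : ℂ) = ∑ k ∈ Finset.Icc 1 ⌊M⌋₊, ∑ h ∈ Finset.Icc 1 ⌊M⌋₊,
      ((x k / k * x h : ℝ) : ℂ) * (((k : ℝ) / h : ℝ) : ℂ) ^ ρ := by
  rw [← Complex.normSq_eq_norm_sq, ← Complex.mul_conj, mul_comm, dirichletPoly, map_sum,
    Finset.sum_mul_sum]
  refine Finset.sum_congr rfl fun k hk => Finset.sum_congr rfl fun h _ => ?_
  calc (starRingEnd ℂ) ((x k : ℂ) * (k : ℂ) ^ (-ρ)) * ((x h : ℂ) * (h : ℂ) ^ (-ρ))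
      = (x k : ℂ) * x h * ((h : ℂ) ^ (-ρ) * (starRingEnd ℂ) ((k : ℂ) ^ (-ρ))) := by
        rw [map_mul, conj_ofReal]
        ring
    _ = ((x k / k * x h : ℝ) : ℂ) * (((k : ℝ) / h : ℝ) : ℂ) ^ ρ := by
        rw [natCast_cpow_neg_mul_conj hρ (Finset.mem_Icc.1 hk).1]
        push_cast
        ring

theorem zetaZeroMoment_eq (hRH : RiemannHypothesis) (x : ℕ → ℝ) (M : ℝ) {T₁ T₂ : ℝ}
    (hT₁ : 0 < T₁) :
    zetaZeroMoment x M T₁ T₂ = ∑ k ∈ Finset.Icc 1 ⌊M⌋₊, ∑ h ∈ Finset.Icc 1 ⌊M⌋₊,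
      ((x k / k * x h : ℝ) : ℂ) * zetaZeroSum T₁ T₂ ((k : ℝ) / h) := by
  simp only [zetaZeroMoment, zetaZeroSum, Finset.mul_sum]
  rw [Finset.sum_congr rfl fun k _ => Finset.sum_comm, Finset.sum_comm]
  refine Finset.sum_congr rfl fun ρ hρ => ?_
  rw [Set.Finite.mem_toFinset] at hρ
  rw [norm_dirichletPoly_sq x M
    (re_eq_half_of_riemannZeta_eq_zero hRH hρ.1 (by linarith [hρ.2.2.1]))]
  simp only [Finset.mul_sum, mul_left_comm]

theorem sum_filter_mul_le_eq_sum_filter_dvd {α : Type*} [AddCommMonoid α] (f : ℕ → ℕ → α) (N : ℕ) :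
    ∑ p ∈ Finset.Icc 1 N ×ˢ Finset.Icc 1 N with p.1 * p.2 ≤ N, f p.1 (p.2 * p.1) =
      ∑ p ∈ Finset.Icc 1 N ×ˢ Finset.Icc 1 N with p.1 ∣ p.2, f p.1 p.2 := by
  refine Finset.sum_bij' (fun p _ => (p.1, p.2 * p.1)) (fun p _ => (p.1, p.2 / p.1))
    ?_ ?_ ?_ ?_ fun _ _ => rfl
  all_goals
    rintro ⟨h, n⟩ hp
    simp only [Finset.mem_filter, Finset.mem_product, Finset.mem_Icc] at hp ⊢
  · obtain ⟨⟨⟨hh, hhN⟩, hn, -⟩, hle⟩ := hp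
    exact ⟨⟨⟨hh, hhN⟩, Nat.mul_pos hn hh, by rwa [mul_comm]⟩, Dvd.intro_left _ rfl⟩
  · obtain ⟨⟨⟨hh, hhN⟩, hn, hnN⟩, hdvd⟩ := hp
    rw [Nat.mul_div_cancel' hdvd]
    exact ⟨⟨⟨hh, hhN⟩, Nat.div_pos (Nat.le_of_dvd hn hdvd) hh, (Nat.div_le_self n h).trans hnN⟩,
      hnN⟩
  · rw [Nat.mul_div_cancel _ hp.1.1.1]
  · rw [Nat.div_mul_cancel hp.2]

theorem moebiusQuadraticForm_eq (x : ℕ → ℝ) {M : ℝ} (hM : 0 ≤ M) :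
    moebiusQuadraticForm x M = ∑ k ∈ Finset.Icc 1 ⌊M⌋₊, ∑ h ∈ Finset.Icc 1 ⌊M⌋₊,
      x k / k * x h * diagonalCoeff h k := by
  set f : ℕ → ℕ → ℝ := fun h k => x k / k * x h * (ArithmeticFunction.moebius (k / h) : ℝ)
  calc moebiusQuadraticForm x M
      = ∑ p ∈ Finset.Icc 1 ⌊M⌋₊ ×ˢ Finset.Icc 1 ⌊M⌋₊ with p.1 * p.2 ≤ ⌊M⌋₊,
          f p.1 (p.2 * p.1) := by
        simp only [moebiusQuadraticForm, Nat.le_floor_iff hM]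
        refine Finset.sum_congr rfl fun p hp => ?_
        have hp1 : 0 < p.1 :=
          (Finset.mem_Icc.1 (Finset.mem_product.1 (Finset.mem_filter.1 hp).1).1).1
        simp only [f, Nat.mul_div_cancel _ hp1]
        ring
    _ = ∑ p ∈ Finset.Icc 1 ⌊M⌋₊ ×ˢ Finset.Icc 1 ⌊M⌋₊ with p.1 ∣ p.2, f p.1 p.2 :=
        sum_filter_mul_le_eq_sum_filter_dvd f ⌊M⌋₊
    _ = ∑ k ∈ Finset.Icc 1 ⌊M⌋₊, ∑ h ∈ Finset.Icc 1 ⌊M⌋₊,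
          x k / k * x h * diagonalCoeff h k := by
        rw [Finset.sum_comm, ← Finset.sum_product', Finset.sum_filter]
        refine Finset.sum_congr rfl fun p _ => ?_
        rw [diagonalCoeff, mul_ite, mul_zero]

theorem abs_le_seqNormSup (x : ℕ → ℝ) {M : ℝ} {n : ℕ} (hn : n ∈ Finset.Icc 1 ⌊M⌋₊) :
    |x n| ≤ seqNormSup x M := by
  rw [← Real.norm_eq_abs, ← coe_nnnorm]
  exact NNReal.coe_le_coe.2 (Finset.le_sup (f := fun n => ‖x n‖₊) hn)

theorem seqNormSup_nonneg (x : ℕ → ℝ) (M : ℝ) : 0 ≤ seqNormSup x M := NNReal.coe_nonneg _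

theorem seqNormOne_nonneg (x : ℕ → ℝ) (M : ℝ) : 0 ≤ seqNormOne x M :=
  Finset.sum_nonneg fun _ _ => abs_nonneg _

theorem sum_sum_abs_mul_one_add_div (x : ℕ → ℝ) (M : ℝ) :
    ∑ k ∈ Finset.Icc 1 ⌊M⌋₊, ∑ h ∈ Finset.Icc 1 ⌊M⌋₊, |x k / k * x h| * (1 + (k : ℝ) / h) =
      2 * (seqNormOne (fun n => x n / n) M * seqNormOne x M) := by
  have hterm (k : ℕ) (hk : k ∈ Finset.Icc 1 ⌊M⌋₊) (h : ℕ) :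
      |x k / k * x h| * (1 + (k : ℝ) / h) = |x k / k| * |x h| + |x k| * |x h / h| := by
    have hk' : (k : ℝ) ≠ 0 := Nat.cast_ne_zero.2 (Nat.one_le_iff_ne_zero.1 (Finset.mem_Icc.1 hk).1)
    rw [abs_mul, abs_div, abs_div, Nat.abs_cast, Nat.abs_cast]
    field_simp
  calc ∑ k ∈ Finset.Icc 1 ⌊M⌋₊, ∑ h ∈ Finset.Icc 1 ⌊M⌋₊, |x k / k * x h| * (1 + (k : ℝ) / h)
      = ∑ k ∈ Finset.Icc 1 ⌊M⌋₊, ∑ h ∈ Finset.Icc 1 ⌊M⌋₊,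
          (|x k / k| * |x h| + |x k| * |x h / h|) :=
        Finset.sum_congr rfl fun k hk => Finset.sum_congr rfl fun h _ => hterm k hk h
    _ = 2 * (seqNormOne (fun n => x n / n) M * seqNormOne x M) := by
        simp only [Finset.sum_add_distrib, ← Finset.sum_mul_sum, seqNormOne]
        ring

theorem sum_sum_abs_mul_offDiagonalSum_le {δ : ℝ} (hδ : 0 < δ) (hδ1 : δ < 1) (x : ℕ → ℝ) {M : ℝ}
    (hM : 0 ≤ M) :
    ∑ k ∈ Finset.Icc 1 ⌊M⌋₊, ∑ h ∈ Finset.Icc 1 ⌊M⌋₊, |x k / k * x h| * offDiagonalSum δ h k ≤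
      8 / (δ * (1 - δ)) * (seqNormOne (fun n => x n / n) M * (M * seqNormSup x M)) := by
  have : 0 < 1 - δ := sub_pos.2 hδ1
  have hterm (h k : ℕ) (hk : k ∈ Finset.Icc 1 ⌊M⌋₊) :
      |x k / k * x h| * offDiagonalSum δ h k ≤
        |x h| * seqNormSup x M * (offDiagonalSum δ h k / k) := by
    have hoff : 0 ≤ offDiagonalSum δ h k / k :=
      div_nonneg (offDiagonalSum_nonneg δ h k) k.cast_nonneg
    calc |x k / k * x h| * offDiagonalSum δ h k
        = |x h| * |x k| * (offDiagonalSum δ h k / k) := by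
          rw [abs_mul, abs_div, Nat.abs_cast]
          ring
      _ ≤ |x h| * seqNormSup x M * (offDiagonalSum δ h k / k) := by
          gcongr
          exact abs_le_seqNormSup x hk
  have hsum (h : ℕ) (hh : h ∈ Finset.Icc 1 ⌊M⌋₊) :
      ∑ k ∈ Finset.Icc 1 ⌊M⌋₊, offDiagonalSum δ h k / k ≤ 8 / (δ * (1 - δ)) * (M / h) := by
    refine (sum_offDiagonalSum_div_le hδ hδ1 (Finset.mem_Icc.1 hh).1).trans ?_
    gcongr
    exact Nat.floor_le hM
  have hsup := seqNormSup_nonneg x M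
  rw [Finset.sum_comm]
  calc ∑ h ∈ Finset.Icc 1 ⌊M⌋₊, ∑ k ∈ Finset.Icc 1 ⌊M⌋₊, |x k / k * x h| * offDiagonalSum δ h k
      ≤ ∑ h ∈ Finset.Icc 1 ⌊M⌋₊, |x h| * seqNormSup x M * (8 / (δ * (1 - δ)) * (M / h)) := by
        refine Finset.sum_le_sum fun h hh => (Finset.sum_le_sum (hterm h)).trans ?_
        rw [← Finset.mul_sum]
        exact mul_le_mul_of_nonneg_left (hsum h hh) (mul_nonneg (abs_nonneg _) hsup)
    _ = 8 / (δ * (1 - δ)) * (seqNormOne (fun n => x n / n) M * (M * seqNormSup x M)) := by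
        rw [seqNormOne, Finset.sum_mul, Finset.mul_sum]
        refine Finset.sum_congr rfl fun h _ => ?_
        rw [abs_div, Nat.abs_cast]
        ring

theorem seqNormOne_sq_eq (x : ℕ → ℝ) (M : ℝ) :
    seqNormOne (fun n => x n ^ 2) M = ∑ h ∈ Finset.Icc 1 ⌊M⌋₊, x h ^ 2 :=
  Finset.sum_congr rfl fun _ _ => abs_of_nonneg (sq_nonneg _)

theorem floor_mul_seqNormOne_sq_le (x : ℕ → ℝ) {M : ℝ} (hM : 0 ≤ M) :
    ⌊M⌋₊ * seqNormOne (fun n => x n ^ 2) M ≤ (M * seqNormSup x M) ^ 2 := by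
  have hcard : seqNormOne (fun n => x n ^ 2) M ≤ ⌊M⌋₊ * seqNormSup x M ^ 2 := by
    rw [seqNormOne_sq_eq]
    refine (Finset.sum_le_card_nsmul _ _ (seqNormSup x M ^ 2) fun h hh => ?_).trans_eq ?_
    · exact sq_le_sq.2 ((abs_le_seqNormSup x hh).trans (le_abs_self _))
    · rw [Nat.card_Icc, Nat.add_sub_cancel, nsmul_eq_mul]
  calc ⌊M⌋₊ * seqNormOne (fun n => x n ^ 2) M
      ≤ ⌊M⌋₊ * (⌊M⌋₊ * seqNormSup x M ^ 2) := by gcongr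
    _ = (⌊M⌋₊ * seqNormSup x M) ^ 2 := by ring
    _ ≤ (M * seqNormSup x M) ^ 2 := by
        have := seqNormSup_nonneg x M
        gcongr
        exact Nat.floor_le hM

theorem sqrt_add_mul_seqNormOne_sq_le (x : ℕ → ℝ) {M T : ℝ} (hM : 0 ≤ M) (hT : 0 ≤ T) :
    √((T + ⌊M⌋₊) * seqNormOne (fun n => x n ^ 2) M) ≤
      T ^ (1 / 2 : ℝ) * (seqNormOne (fun n => x n ^ 2) M) ^ (1 / 2 : ℝ) + M * seqNormSup x M := by
  have hX := mul_nonneg hT (seqNormOne_nonneg (fun n => x n ^ 2) M)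
  have hsup := mul_nonneg hM (seqNormSup_nonneg x M)
  rw [← Real.sqrt_eq_rpow, ← Real.sqrt_eq_rpow, ← Real.sqrt_mul hT, add_mul]
  refine Real.sqrt_le_iff.2 ⟨add_nonneg (Real.sqrt_nonneg _) hsup, ?_⟩
  rw [add_sq, Real.sq_sqrt hX]
  linarith [floor_mul_seqNormOne_sq_le x hM, mul_nonneg (Real.sqrt_nonneg (T *
    seqNormOne (fun n => x n ^ 2) M)) hsup]

theorem exists_norm_sum_nearVerticalIntegral_le {δ : ℝ} (hδ : 0 < δ) (E : ℝ) :
    ∃ C : ℝ, 0 < C ∧ ∀ (K : ℝ → ℝ) (T T₁ T₂ M : ℝ) (x : ℕ → ℝ) (k : ℕ),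
      IsAdmissibleWindow K T T₁ T₂ → 1 ≤ M → 0 < k →
      ‖∑ h ∈ Finset.Icc 1 ⌊M⌋₊, (x h : ℂ) * nearVerticalIntegral E δ T T₁ T₂ h k‖ ≤
        C * T ^ (E * δ) * (T ^ (1 / 2 : ℝ) * seqNormOne (fun n => x n ^ 2) M ^ (1 / 2 : ℝ) +
          M * seqNormSup x M) := by
  classical
  obtain ⟨C, hC, hbound⟩ := exists_norm_sum_verticalIntegral_le hδ
  refine ⟨C, hC, fun K T T₁ T₂ M x k hW hM hk => ?_⟩
  have hT : 0 < T := two_pos.trans_le hW.two_le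
  set S := {h ∈ Finset.Icc 1 ⌊M⌋₊ | IsNearPair E T h k}
  have hS : S ⊆ Finset.Icc 1 ⌊M⌋₊ := Finset.filter_subset _ _
  have hsum : ∑ h ∈ Finset.Icc 1 ⌊M⌋₊, (x h : ℂ) * nearVerticalIntegral E δ T T₁ T₂ h k =
      ∑ h ∈ S, (x h : ℂ) * verticalIntegral T₁ T₂ (-δ) ((k : ℝ) / h) := by
    rw [Finset.sum_filter]
    refine Finset.sum_congr rfl fun h _ => ?_
    unfold nearVerticalIntegral
    split_ifs
    · rfl
    · rw [mul_zero]
  have hsquares : ∑ h ∈ S, ‖(x h : ℂ)‖ ^ 2 ≤ seqNormOne (fun n => x n ^ 2) M := by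
    simp only [Complex.norm_real, Real.norm_eq_abs, sq_abs, seqNormOne_sq_eq]
    exact Finset.sum_le_sum_of_subset_of_nonneg hS fun _ _ _ => sq_nonneg _
  rw [hsum]
  calc ‖∑ h ∈ S, (x h : ℂ) * verticalIntegral T₁ T₂ (-δ) ((k : ℝ) / h)‖
      ≤ C * T ^ (E * δ) * √((T + ⌊M⌋₊) * ∑ h ∈ S, ‖(x h : ℂ)‖ ^ 2) :=
        hbound S (fun h => x h) ⌊M⌋₊ k T T₁ T₂ _ (Nat.floor_pos.2 hM) hk hS
          (by linarith [hW.three_le]) hW.le_two_mul hW.le hW.le_three_mul (by positivity)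
          fun h hh => (Finset.mem_filter.1 hh).2.rpow_neg_le hT hδ.le
    _ ≤ C * T ^ (E * δ) * √((T + ⌊M⌋₊) * seqNormOne (fun n => x n ^ 2) M) := by gcongr
    _ ≤ _ := mul_le_mul_of_nonneg_left
        (sqrt_add_mul_seqNormOne_sq_le x (zero_le_one.trans hM) hT.le) (by positivity)

theorem exists_norm_sum_sum_nearVerticalIntegral_le {δ : ℝ} (hδ : 0 < δ) (E : ℝ) :
    ∃ C : ℝ, 0 < C ∧ ∀ (K : ℝ → ℝ) (T T₁ T₂ M : ℝ) (x : ℕ → ℝ), IsAdmissibleWindow K T T₁ T₂ →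
      1 ≤ M →
      ‖∑ k ∈ Finset.Icc 1 ⌊M⌋₊, ∑ h ∈ Finset.Icc 1 ⌊M⌋₊,
          ((x k / k * x h : ℝ) : ℂ) * nearVerticalIntegral E δ T T₁ T₂ h k‖ ≤
        C * T ^ (E * δ) * seqNormOne (fun n => x n / n) M *
          (T ^ (1 / 2 : ℝ) * seqNormOne (fun n => x n ^ 2) M ^ (1 / 2 : ℝ) +
            M * seqNormSup x M) := by
  obtain ⟨C, hC, hbound⟩ := exists_norm_sum_nearVerticalIntegral_le hδ E
  refine ⟨C, hC, fun K T T₁ T₂ M x hW hM => ?_⟩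
  set W := T ^ (1 / 2 : ℝ) * seqNormOne (fun n => x n ^ 2) M ^ (1 / 2 : ℝ) + M * seqNormSup x M
  calc ‖∑ k ∈ Finset.Icc 1 ⌊M⌋₊, ∑ h ∈ Finset.Icc 1 ⌊M⌋₊,
        ((x k / k * x h : ℝ) : ℂ) * nearVerticalIntegral E δ T T₁ T₂ h k‖
      ≤ ∑ k ∈ Finset.Icc 1 ⌊M⌋₊, |x k / k| * (C * T ^ (E * δ) * W) := by
        refine norm_sum_le_of_le _ fun k hk => ?_
        simp only [ofReal_mul, mul_assoc, ← Finset.mul_sum]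
        rw [norm_mul, Complex.norm_real, Real.norm_eq_abs, ← mul_assoc C]
        exact mul_le_mul_of_nonneg_left (hbound K T T₁ T₂ M x k hW hM (Finset.mem_Icc.1 hk).1)
          (abs_nonneg _)
    _ = C * T ^ (E * δ) * seqNormOne (fun n => x n / n) M * W := by
        rw [← Finset.sum_mul, seqNormOne]
        ring

theorem norm_sum_sum_mul_le_of_norm_le {δ : ℝ} (hδ : 0 < δ) (hδ1 : δ < 1) (x : ℕ → ℝ) {M : ℝ}
    (hM : 0 ≤ M) (R : ℕ → ℕ → ℂ) {A B : ℝ} (hB : 0 ≤ B)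
    (hR : ∀ h k : ℕ, 0 < h → 0 < k →
      ‖R h k‖ ≤ A * (1 + (k : ℝ) / h) + B * offDiagonalSum δ h k) :
    ‖∑ k ∈ Finset.Icc 1 ⌊M⌋₊, ∑ h ∈ Finset.Icc 1 ⌊M⌋₊, ((x k / k * x h : ℝ) : ℂ) * R h k‖ ≤
      seqNormOne (fun n => x n / n) M *
        (2 * A * seqNormOne x M + 8 / (δ * (1 - δ)) * B * (M * seqNormSup x M)) := by
  set F := Finset.Icc 1 ⌊M⌋₊
  calc ‖∑ k ∈ F, ∑ h ∈ F, ((x k / k * x h : ℝ) : ℂ) * R h k‖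
      ≤ ∑ k ∈ F, ∑ h ∈ F, (A * (|x k / k * x h| * (1 + (k : ℝ) / h)) +
          B * (|x k / k * x h| * offDiagonalSum δ h k)) := by
        refine norm_sum_le_of_le _ fun k hk => norm_sum_le_of_le _ fun h hh => ?_
        rw [norm_mul, Complex.norm_real, Real.norm_eq_abs]
        exact (mul_le_mul_of_nonneg_left
          (hR h k (Finset.mem_Icc.1 hh).1 (Finset.mem_Icc.1 hk).1) (abs_nonneg _)).trans_eq
          (by ring)
    _ = A * (∑ k ∈ F, ∑ h ∈ F, |x k / k * x h| * (1 + (k : ℝ) / h)) +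
          B * (∑ k ∈ F, ∑ h ∈ F, |x k / k * x h| * offDiagonalSum δ h k) := by
        simp only [Finset.sum_add_distrib, Finset.mul_sum]
    _ ≤ A * (2 * (seqNormOne (fun n => x n / n) M * seqNormOne x M)) + B *
          (8 / (δ * (1 - δ)) * (seqNormOne (fun n => x n / n) M * (M * seqNormSup x M))) := by
        rw [sum_sum_abs_mul_one_add_div]
        gcongr
        exact sum_sum_abs_mul_offDiagonalSum_le hδ hδ1 x hM
    _ = _ := by ring

theorem two_pi_mul_zetaZeroMoment_sub (hRH : RiemannHypothesis) (x : ℕ → ℝ) {M T₁ T₂ : ℝ}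
    (hM : 0 ≤ M) (hT₁ : 0 < T₁) (V : ℕ → ℕ → ℂ) :
    2 * Real.pi * (zetaZeroMoment x M T₁ T₂ -
        (((T₂ - T₁) / (2 * Real.pi) * moebiusQuadraticForm x M : ℝ) : ℂ)) =
      (∑ k ∈ Finset.Icc 1 ⌊M⌋₊, ∑ h ∈ Finset.Icc 1 ⌊M⌋₊, ((x k / k * x h : ℝ) : ℂ) *
        (2 * Real.pi * zetaZeroSum T₁ T₂ ((k : ℝ) / h) -
          (((T₂ - T₁) * diagonalCoeff h k : ℝ) : ℂ) + V h k)) -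
      ∑ k ∈ Finset.Icc 1 ⌊M⌋₊, ∑ h ∈ Finset.Icc 1 ⌊M⌋₊, ((x k / k * x h : ℝ) : ℂ) * V h k := by
  have hmain : 2 * Real.pi * (((T₂ - T₁) / (2 * Real.pi) * moebiusQuadraticForm x M : ℝ) : ℂ) =
      (((T₂ - T₁) * moebiusQuadraticForm x M : ℝ) : ℂ) := by
    have : (Real.pi : ℂ) ≠ 0 := ofReal_ne_zero.2 Real.pi_ne_zero
    push_cast
    field_simp
  rw [mul_sub, hmain, zetaZeroMoment_eq hRH x M hT₁, moebiusQuadraticForm_eq x hM]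
  push_cast
  simp only [Finset.mul_sum, ← Finset.sum_sub_distrib]
  refine Finset.sum_congr rfl fun k _ => Finset.sum_congr rfl fun h _ => ?_
  ring

theorem norm_le_norm_two_pi_mul (z : ℂ) : ‖z‖ ≤ ‖2 * Real.pi * z‖ := by
  rw [norm_mul, norm_mul, Complex.norm_real, norm_ofNat, Real.norm_of_nonneg Real.pi_pos.le]
  exact le_mul_of_one_le_left (norm_nonneg _) (by linarith [Real.pi_gt_three])

theorem exists_norm_zetaZeroMoment_sub_le (hRH : RiemannHypothesis) (K : ℝ → ℝ) :
    ∃ E : ℝ, 0 ≤ E ∧ ∀ δ : ℝ, 0 < δ → δ < 1 → ∃ C : ℝ, 0 ≤ C ∧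
      ∀ (T T₁ T₂ M : ℝ) (x : ℕ → ℝ), IsAdmissibleWindow K T T₁ T₂ → 1 ≤ M →
      ‖zetaZeroMoment x M T₁ T₂ -
          (((T₂ - T₁) / (2 * Real.pi) * moebiusQuadraticForm x M : ℝ) : ℂ)‖ ≤
        C * T ^ ((E + 1) * δ) * seqNormOne (fun n => x n / n) M *
          (M * seqNormSup x M + seqNormOne x M +
            T ^ (1 / 2 : ℝ) * seqNormOne (fun n => x n ^ 2) M ^ (1 / 2 : ℝ)) := by
  obtain ⟨E, hE, hbound⟩ := exists_norm_zetaZeroSum_remainder_le hRH K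
  refine ⟨E, hE, fun δ hδ hδ1 => ?_⟩
  obtain ⟨C₁, hC₁, hremainder⟩ := hbound δ hδ hδ1.le
  obtain ⟨C₂, hC₂, hleft⟩ := exists_norm_sum_sum_nearVerticalIntegral_le hδ E
  set G := 8 / (δ * (1 - δ)) * 16
  have hG : 0 ≤ G :=
    mul_nonneg (div_nonneg (by norm_num) (mul_nonneg hδ.le (sub_nonneg.2 hδ1.le))) (by norm_num)
  refine ⟨2 * C₁ + G + C₂, by positivity, fun T T₁ T₂ M x hW hM => ?_⟩
  have hT : 1 ≤ T := one_le_two.trans hW.two_le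
  have hM0 : 0 ≤ M := zero_le_one.trans hM
  have hR := norm_sum_sum_mul_le_of_norm_le hδ hδ1 x hM0 _ (by positivity) fun h k =>
    hremainder T T₁ T₂ h k hW
  have hV := hleft K T T₁ T₂ M x hW hM
  have hX := seqNormOne_nonneg (fun n => x n / n) M
  have hX1 := seqNormOne_nonneg x M
  have hMsup := mul_nonneg hM0 (seqNormSup_nonneg x M)
  have hW2 : 0 ≤ T ^ (1 / 2 : ℝ) * seqNormOne (fun n => x n ^ 2) M ^ (1 / 2 : ℝ) :=
    mul_nonneg (by positivity) (Real.rpow_nonneg (seqNormOne_nonneg _ M) _)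
  set X := seqNormOne (fun n => x n / n) M
  set W := T ^ (1 / 2 : ℝ) * seqNormOne (fun n => x n ^ 2) M ^ (1 / 2 : ℝ)
  set P := T ^ ((E + 1) * δ)
  have hP : T ^ δ ≤ P := Real.rpow_le_rpow_of_exponent_le hT (by nlinarith)
  have hP' : T ^ (E * δ) ≤ P := Real.rpow_le_rpow_of_exponent_le hT (by linarith)
  refine (norm_le_norm_two_pi_mul _).trans ?_
  rw [two_pi_mul_zetaZeroMoment_sub hRH x hM0 (by linarith [hW.three_le])
    (nearVerticalIntegral E δ T T₁ T₂)]
  calc _ ≤ X * (2 * (C₁ * P) * seqNormOne x M +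
            8 / (δ * (1 - δ)) * (16 * T ^ δ) * (M * seqNormSup x M)) +
          C₂ * T ^ (E * δ) * X * (W + M * seqNormSup x M) :=
        (norm_sub_le _ _).trans (add_le_add hR hV)
    _ ≤ X * (2 * (C₁ * P) * seqNormOne x M +
            8 / (δ * (1 - δ)) * (16 * P) * (M * seqNormSup x M)) +
          C₂ * P * X * (W + M * seqNormSup x M) := by
        have : 0 < 1 - δ := sub_pos.2 hδ1
        gcongr
    _ = P * X * (2 * C₁ * seqNormOne x M + G * (M * seqNormSup x M) +
          C₂ * (W + M * seqNormSup x M)) := by ring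
    _ ≤ P * X * ((2 * C₁ + G + C₂) * (M * seqNormSup x M + seqNormOne x M + W)) := by
        gcongr
        nlinarith [mul_nonneg hC₁ hMsup, mul_nonneg hC₁ hW2, mul_nonneg hG hX1,
          mul_nonneg hG hW2, mul_nonneg hC₂.le hX1]
    _ = _ := by ring

theorem exists_isAdmissibleWindow
    (hsimple : {ρ : ℂ | riemannZeta ρ = 0 ∧ deriv riemannZeta ρ = 0}.Finite) (B : ℝ) (K : ℝ → ℝ) :
    ∃ T₀ : ℝ, ∀ T T₁ T₂ : ℝ, T₀ ≤ T → |T₁ - T| ≤ B → |T₂ - 2 * T| ≤ B →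
      IsGoodHeight K T₁ → IsGoodHeight K T₂ → IsAdmissibleWindow K T T₁ T₂ := by
  obtain ⟨Y, hY⟩ := (hsimple.image Complex.im).bddAbove
  refine ⟨max (2 * B + 6) (B + Y + 1), fun T T₁ T₂ hT hT₁ hT₂ hgood₁ hgood₂ => ?_⟩
  have hB : 0 ≤ B := (abs_nonneg _).trans hT₁
  have hTB : 2 * B + 6 ≤ T := (le_max_left _ _).trans hT
  have hTY : B + Y + 1 ≤ T := (le_max_right _ _).trans hT
  rw [abs_le] at hT₁ hT₂
  refine ⟨by linarith, by linarith, by linarith, by linarith, by linarith,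
    fun s hs him hderiv => ?_, hgood₁, hgood₂⟩
  have : s.im ≤ Y := hY ⟨s, ⟨hs, hderiv⟩, rfl⟩
  linarith

theorem seqNorm_error_nonneg (x : ℕ → ℝ) {M T : ℝ} (hM : 0 ≤ M) (hT : 0 ≤ T) :
    0 ≤ M * seqNormSup x M + seqNormOne x M +
      T ^ (1 / 2 : ℝ) * seqNormOne (fun n => x n ^ 2) M ^ (1 / 2 : ℝ) :=
  add_nonneg (add_nonneg (mul_nonneg hM (seqNormSup_nonneg x M)) (seqNormOne_nonneg x M))
    (mul_nonneg (Real.rpow_nonneg hT _) (Real.rpow_nonneg (seqNormOne_nonneg _ M) _))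

theorem proposition2
    (hRH : RiemannHypothesis)
    (hsimple : {ρ : ℂ | riemannZeta ρ = 0 ∧ deriv riemannZeta ρ = 0}.Finite)
    (B : ℝ) (K : ℝ → ℝ) (ε : ℝ) (hε : 0 < ε) :
    ∃ C T₀ : ℝ, ∀ (T T₁ T₂ M : ℝ) (x : ℕ → ℝ),
      T₀ ≤ T →
      |T₁ - T| ≤ B → |T₂ - 2 * T| ≤ B →
      IsGoodHeight K T₁ → IsGoodHeight K T₂ →
      1 ≤ M →
      (∀ δ : ℝ, 0 < δ → seqNormOne (fun n => x n / n) M ≤ K δ * T ^ δ) →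
      ‖zetaZeroMoment x M T₁ T₂ -
          (((T₂ - T₁) / (2 * Real.pi) * moebiusQuadraticForm x M : ℝ) : ℂ)‖ ≤
        C * (T ^ ε * (M * seqNormSup x M + seqNormOne x M +
          T ^ (1 / 2 : ℝ) * (seqNormOne (fun n => x n ^ 2) M) ^ (1 / 2 : ℝ))) := by
  obtain ⟨E, hE, hbound⟩ := exists_norm_zetaZeroMoment_sub_le hRH K
  obtain ⟨T₀, hwindow⟩ := exists_isAdmissibleWindow hsimple B K
  obtain ⟨δ, hδ, hδmin⟩ := exists_between (lt_min (div_pos hε (by linarith : 0 < E + 2)) one_pos)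
  obtain ⟨hδε, hδ1⟩ := lt_min_iff.1 hδmin
  obtain ⟨C, hC, hmoment⟩ := hbound δ hδ hδ1
  refine ⟨C * |K δ|, T₀, fun T T₁ T₂ M x hT hT₁ hT₂ hgood₁ hgood₂ hM hx => ?_⟩
  have hW := hwindow T T₁ T₂ hT hT₁ hT₂ hgood₁ hgood₂
  have hT0 : 0 < T := two_pos.trans_le hW.two_le
  have hpow : T ^ ((E + 1) * δ) * T ^ δ ≤ T ^ ε := by
    rw [← Real.rpow_add hT0]
    refine Real.rpow_le_rpow_of_exponent_le (one_le_two.trans hW.two_le) ?_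
    linarith [(lt_div_iff₀ (by linarith)).1 hδε]
  have hKδ : seqNormOne (fun n => x n / n) M ≤ |K δ| * T ^ δ :=
    (hx δ hδ).trans (mul_le_mul_of_nonneg_right (le_abs_self _) (by positivity))
  have herror := seqNorm_error_nonneg x (zero_le_one.trans hM) hT0.le
  set W := M * seqNormSup x M + seqNormOne x M +
    T ^ (1 / 2 : ℝ) * seqNormOne (fun n => x n ^ 2) M ^ (1 / 2 : ℝ)
  calc _ ≤ C * T ^ ((E + 1) * δ) * seqNormOne (fun n => x n / n) M * W := hmoment T T₁ T₂ M x hW hM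
    _ ≤ C * T ^ ((E + 1) * δ) * (|K δ| * T ^ δ) * W := by gcongr
    _ = C * |K δ| * (T ^ ((E + 1) * δ) * T ^ δ * W) := by ring
    _ ≤ C * |K δ| * (T ^ ε * W) := by gcongr
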